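/- Let $P$ be a convex polygon in the plane with $n\ge 3$ vertices $v_1,\dots,v_n$ labelled counterclockwise, all interior angles being strictly less than $\pi$; let $e_i$ be the open edge of $\partial P$ following $v_i$. A *gluing* of $P$ is given by a partition of $\partial P$, by finitely many points, into open intervals that are matched in pairs of equal length; each interval is glued isometrically to its partner, corresponding endpoints are identified, and gluing is extended transitively to an equivalence relation. It is an *Aleksandrov gluing* if the total face angle of $P$ glued together at any point is at most $2\pi$ (the face angle at a vertex is the interior angle, and in the interior of an edge it is $\pi$) and the space obtained from the closed region $P$ by the gluing is homeomorphic to the 2-sphere; $P$ *folds* via its Aleksandrov gluings. The *combinatorial gluing tree* of such a gluing has as nodes those classes of mutually glued points of $\partial P$ that do not consist of exactly two points or that contain a vertex of $P$; two distinct nodes are adjacent if an arc of $\partial P$ leads from one to the other without meeting a node in its interior; and each node is labelled by the set of all vertices $v_i$ and edges $e_i$ having a point in that class. Two gluing trees are different if there is no label-preserving graph isomorphism between them. **Theorem.** There is a constant $C$ such that, for every $n\ge 3$, every convex polygon with $n$ vertices has only finitely many, and at most $C n^3$, different combinatorial gluing trees arising from its Aleksandrov gluings. Moreover, there is a constant $c>0$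 such that, for every $n\ge 3$, some convex polygon with $n$ vertices has at least $c\,n^2$ different combinatorial gluing trees arising from its Aleksandrov gluings. -/

import Mathlib

/-! # Foldings of convex polygons and their combinatorial gluing trees -/

noncomputable section

namespace PolygonFolding

/-- The Euclidean plane. -/
abbrev Plane : Type := EuclideanSpace ℝ (Fin 2)

/-- Twice the signed area of the triangle `a b c`: positive iff `c` lies strictly to the left of
the directed line from `a` to `b`. -/
def signedArea (a b c : Plane) : ℝ :=
  (b 0 - a 0) * (c 1 - a 1) - (b 1 - a 1) * (c 0 - a 0)

/-- A convex polygon with `n ≥ 3` vertices, labelled counterclockwise: every vertex which is not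
an endpoint of an edge lies strictly to the left of that edge. In particular all interior angles
are strictly less than `π`. -/
structure ConvexPolygon (n : ℕ) extends Polygon Plane n where
  three_le : 3 ≤ n
  convex : ∀ i j : Fin n, j ≠ i → j ≠ finRotate n i →
    0 < signedArea (vertices i) (vertices (finRotate n i)) (vertices j)

namespace ConvexPolygon

variable {n : ℕ} (P : ConvexPolygon n)

/-- The closed region of the plane bounded by the polygon. -/
def region : Set Plane := convexHull ℝ (Set.range P.vertices)

/-- The boundary `∂P`: the union of the closed edges. -/
def bdry : Set Plane := P.toPolygon.boundary ℝ

/-- The length of the edge from the `i`-th vertex to the next one. -/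
def edgeLength (i : Fin n) : ℝ := dist (P.vertices i) (P.vertices (finRotate n i))

/-- The perimeter of the polygon. -/
def perimeter : ℝ := ∑ i, P.edgeLength i

/-- The distance, measured counterclockwise along `∂P`, from the first vertex to the `i`-th. -/
def mark (i : Fin n) : ℝ := ∑ j ∈ Finset.Iio i, P.edgeLength j

/-- The counterclockwise arc-length parametrization of `∂P`, starting at the first vertex and
periodic with period the perimeter. After reduction of `t` to `u ∈ [0, perimeter)`, the `i`-th
summand is the part of the `i`-th edge that has been traversed when the length `u` has been
covered: nothing if `u ≤ mark i`, the whole edge if `u ≥ mark i + edgeLength i`. -/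
def boundaryPoint (t : ℝ) : Plane :=
  P.vertices ⟨0, lt_of_lt_of_le (by decide) P.three_le⟩ +
    ∑ i, max 0 (min 1 ((P.perimeter * Int.fract (t / P.perimeter) - P.mark i) /
      P.edgeLength i)) • (P.vertices (finRotate n i) - P.vertices i)

open Classical in
/-- The face angle of the polygon at a boundary point: the interior angle at a vertex, and `π` in
the interior of an edge. -/
def faceAngle (x : Plane) : ℝ :=
  if h : ∃ i, P.vertices i = x then
    EuclideanGeometry.angle (P.vertices ((finRotate n).symm h.choose)) (P.vertices h.choose)
      (P.vertices (finRotate n h.choose))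
  else Real.pi

/-- The elements of the polygon, as point sets: `Sum.inl i` is the vertex `v_i`, and `Sum.inr i`
is the open edge `e_i` from `v_i` to the next vertex. -/
def elementSet : Fin n ⊕ Fin n → Set Plane
  | Sum.inl i => {P.vertices i}
  | Sum.inr i => openSegment ℝ (P.vertices i) (P.vertices (finRotate n i))

end ConvexPolygon

/-- A gluing of `∂P` to itself. The boundary is partitioned by finitely many points into `m` open
intervals, the `k`-th being the counterclockwise arc of length `len k` starting at parameter
`start k`. The intervals are matched in pairs of equal length, and each is glued isometrically to
its partner, either preserving or reversing the counterclockwise direction. -/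
structure Gluing {n : ℕ} (P : ConvexPolygon n) where
  m : ℕ
  start : Fin m → ℝ
  len : Fin m → ℝ
  partner : Fin m → Fin m
  reversed : Fin m → Bool
  len_pos : ∀ k, 0 < len k
  disjoint : ∀ k l, k ≠ l →
    Disjoint (P.boundaryPoint '' Set.Ioo (start k) (start k + len k))
      (P.boundaryPoint '' Set.Ioo (start l) (start l + len l))
  cover : P.bdry ⊆ ⋃ k, P.boundaryPoint '' Set.Icc (start k) (start k + len k)
  partner_partner : ∀ k, partner (partner k) = k
  partner_ne : ∀ k, partner k ≠ k
  len_partner : ∀ k, len (partner k) = len k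
  reversed_partner : ∀ k, reversed (partner k) = reversed k

namespace Gluing

variable {n : ℕ} {P : ConvexPolygon n} (G : Gluing P)

/-- The identifications made directly by the glued pairs of intervals, including those of
corresponding endpoints. -/
def Glued (x y : Plane) : Prop :=
  ∃ k, ∃ t ∈ Set.Icc 0 (G.len k), x = P.boundaryPoint (G.start k + t) ∧
    y = P.boundaryPoint (G.start (G.partner k) + if G.reversed k then G.len k - t else t)

/-- Gluing is transitive: the equivalence relation generated by the direct identifications. It is
trivial off `∂P`. -/
def setoid : Setoid Plane := Relation.EqvGen.setoid G.Glued

/-- The surface obtained from the polygonal region by gluing its boundary. -/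
abbrev Surface : Type := Quotient (Setoid.comap (Subtype.val : P.region → Plane) G.setoid)

/-- An Aleksandrov gluing: no more than `2π` face angle is glued together at any point, and the
glued surface is homeomorphic to a sphere. -/
structure IsAleksandrov : Prop where
  angle_le : ∀ s : Finset Plane, (∀ x ∈ s, x ∈ P.bdry) → (∀ x ∈ s, ∀ y ∈ s, G.setoid x y) →
    ∑ x ∈ s, P.faceAngle x ≤ 2 * Real.pi
  sphere : Nonempty (G.Surface ≃ₜ Metric.sphere (0 : EuclideanSpace ℝ (Fin 3)) 1)

/-- The nodes of the gluing tree: the sets `c` of mutually glued points of `∂P` which do not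
consist of exactly two points, or which contain a vertex of the polygon. -/
def IsNode (c : Set Plane) : Prop :=
  (∃ x ∈ P.bdry, c = {y | G.setoid x y}) ∧ (c.ncard ≠ 2 ∨ ∃ i, P.vertices i ∈ c)

end Gluing

/-- A graph whose nodes are labelled by sets of elements of `α`. -/
structure LabeledGraph (α : Type) where
  Node : Type
  graph : SimpleGraph Node
  label : Node → Set α

namespace LabeledGraph

variable {α : Type}

/-- Two labelled graphs are the same if there is a graph isomorphism preserving all labels. -/
def Same (S T : LabeledGraph α) : Prop :=
  ∃ f : S.graph ≃g T.graph, ∀ a, T.label (f a) = S.label a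

/-- The equivalence relation of label-preserving isomorphism. -/
instance isoSetoid (α : Type) : Setoid (LabeledGraph α) where
  r := Same
  iseqv := by
    refine ⟨fun S => ⟨RelIso.refl _, fun _ => rfl⟩, ?_, ?_⟩
    · rintro S T ⟨f, hf⟩
      refine ⟨f.symm, fun a => ?_⟩
      rw [← hf (f.symm a), RelIso.apply_symm_apply]
    · rintro S T U ⟨f, hf⟩ ⟨g, hg⟩
      exact ⟨f.trans g, fun a => by rw [RelIso.trans_apply, hg, hf]⟩

end LabeledGraph

/-- The combinatorial gluing tree of a gluing. Two nodes are joined when some arc of `∂P` leads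
from one to the other without meeting a node in between; a node is labelled by the set of all
vertices and edges of the polygon that are glued together there. -/
def Gluing.gluingTree {n : ℕ} {P : ConvexPolygon n} (G : Gluing P) :
    LabeledGraph (Fin n ⊕ Fin n) where
  Node := {c : Set Plane // G.IsNode c}
  graph := SimpleGraph.fromRel fun c d => ∃ s t : ℝ, s < t ∧
    P.boundaryPoint s ∈ c.1 ∧ P.boundaryPoint t ∈ d.1 ∧
    ∀ u ∈ Set.Ioo s t, ∀ e, G.IsNode e → P.boundaryPoint u ∉ e
  label c := {a | ∃ x ∈ P.elementSet a, x ∈ c.1}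

/-- The set of all different combinatorial gluing trees, up to label-preserving isomorphism, of
the Aleksandrov gluings of the convex polygon `P`. -/
def ConvexPolygon.gluingTrees {n : ℕ} (P : ConvexPolygon n) :
    Set (Quotient (LabeledGraph.isoSetoid (Fin n ⊕ Fin n))) :=
  {T | ∃ G : Gluing P, G.IsAleksandrov ∧ T = Quotient.mk _ G.gluingTree}

end PolygonFolding

end

/-! Topology. A map from the region to the sphere that respects the gluing up to sign descends to a
map from the glued surface to the projective plane. The glued surface is a sphere, so that map lifts
and the signs were trivial (`eq_of_eq_or_neg_on_fibres`). For a test map running from pole to pole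
across a narrow collar around a glued pair (`Gluing.collar_map`), this shows that all arcs are glued
with reversed direction (`IsAleksandrov.reversed`) and that glued pairs do not cross
(`IsAleksandrov.noncrossing`). Hence the boundary is zipped up like the contour of a tree: an arc
with glued ends is folded at its midpoint unless it contains three mutually glued points
(`IsAleksandrov.fold_or_triple`), and in every case it contains a leaf.

Geometry. The turning angles add up to 2π and the glued arcs form a connected graph, so the total
curvature is at most 4π. A leaf has curvature at least π, whence at most four leaves. Four leaves
force equality everywhere; every vertex then lies in a flat class of at least three points, which
requires n ≤ 6 (`IsAleksandrov.le_six_of_four_leaves`). For n > 6 the boundary is therefore either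
folded in half about one point m, or cut at three mutually glued points p, q, r with each of the
three arcs folded at its midpoint.

Counting. Nodes occur only at vertices, cut points, fold midpoints and mirror images of vertices. So
the labelled tree depends only on the order of vertex parameters relative to cuts, and of sums of
two vertex parameters relative to sums of consecutive cuts (`FoldsAlong.same`). A half folding is
thus classified by the position of 2m among O(n²) values. At a branch point the bound 2π leaves room
for at most one non-vertex. Three vertices can be chosen in n³ ways. If one of the points is not a
vertex, the other two have turning angles adding up to at least π; any two such pairs of vertices
meet, so there are only O(n) of them, each with O(n²) types for the third point. For n ≤ 6 a tree
has at most n + 4 nodes, and a constant absorbs the finitely many labelled graphs.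

Lower bound. Folding the boundary in half always gives a sphere: in polar coordinates it is the
quotient of the unit disc by z ~ 1/z on the circle, realised by z + 1/z. In a polygon whose edges
double in length, the sums of two vertex parameters are distinct (the last vertex being left aside),
and the half folding that glues two vertices records this pair in a label. This yields quadratically
many trees. -/

open Topology

/-! ### Lifting maps from the sphere; sign ambiguities -/

/-- The unit sphere in three-dimensional Euclidean space. -/
abbrev UnitSphere : Type := Metric.sphere (0 : EuclideanSpace ℝ (Fin 3)) 1

/-- A continuous map from the 2-sphere lifts through every covering map. -/
theorem IsCoveringMap.exists_lift_sphere {E B : Type*} [TopologicalSpace E] [TopologicalSpace B]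
    {p : E → B} (hp : IsCoveringMap p) (hs : Function.Surjective p)
    (f : C(UnitSphere, B)) :
    ∃ g : C(UnitSphere, E), ∀ x, p (g x) = f x := by
  -- The stereographic charts from `v` and from `-v` cover the sphere by two planes. A plane is
  -- simply connected, so `f` lifts over each chart; the overlap is a punctured plane, which is
  -- connected, so two lifts with the same value at one point agree on it and can be patched.
  let v : UnitSphere := ⟨EuclideanSpace.single 0 1, by simp ⟩
  have hv : ‖(v : EuclideanSpace ℝ (Fin 3))‖ = 1 := norm_eq_of_mem_sphere v
  let st := stereographic hv
  let W := (Submodule.span ℝ {(v : EuclideanSpace ℝ (Fin 3))})ᗮ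
  have hsrc : st.source = {v}ᶜ := stereographic_source hv
  have htgt : st.target = Set.univ := stereographic_target hv
  have hσc : Continuous st.symm := by
    have := st.symm.continuousOn
    rw [OpenPartialHomeomorph.symm_source, htgt] at this
    exact continuousOn_univ.mp this
  let σ : C(W, UnitSphere) := ⟨st.symm, hσc⟩
  have hσ1 : ∀ w : W, st (σ w) = w := fun w => st.right_inv (by rw [htgt]; trivial)
  have hσ2 : ∀ x : UnitSphere, x ≠ v → σ (st x) = x := fun x hx => st.left_inv (by rw [hsrc]; exact hx)
  have hσv : ∀ w : W, σ w ≠ v := fun w => by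
    have := st.map_target (x := w) (by rw [htgt]; trivial)
    rw [hsrc] at this; exact this
  have hσ0 : st (-v) = 0 := stereographic_apply_neg v
  let ν : C(UnitSphere, UnitSphere) := ⟨fun x => -x, continuous_neg⟩
  have hrank : Module.finrank ℝ W = 2 := by
    have : Fact (Module.finrank ℝ (EuclideanSpace ℝ (Fin 3)) = 2 + 1) := ⟨by simp⟩
    exact Submodule.finrank_orthogonal_span_singleton (by
      intro h; rw [h] at hv; simp at hv)
  have hrank' : 1 < Module.rank ℝ W := by
    rw [← Module.finrank_eq_rank, hrank]; norm_cast
  have hvv : -v ≠ v := fun h => ne_neg_of_mem_unit_sphere ℝ v h.symm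
  have : Nontrivial W := Module.nontrivial_of_finrank_pos (R := ℝ) (by omega)
  obtain ⟨w₁, hw₁⟩ := exists_ne (0 : W)
  have hne : -σ w₁ ≠ v := by
    intro h
    apply hw₁
    rw [← hσ1 w₁, ← hσ0, show σ w₁ = -v from neg_eq_iff_eq_neg.mp h]
  obtain ⟨e₁, he₁⟩ := hs (f (σ w₁))
  obtain ⟨g₁, ⟨hg₁, hg₁'⟩, -⟩ := hp.existsUnique_continuousMap_lifts (f.comp σ) w₁ e₁ he₁
  -- The second lift starts at the same value `e₁` over the common point `σ w₁`; this makes the two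
  -- lifts compatible.
  obtain ⟨g₂, ⟨hg₂, hg₂'⟩, -⟩ := hp.existsUnique_continuousMap_lifts ((f.comp ν).comp σ)
    (st (-σ w₁)) e₁ (by
      change p e₁ = f (-(σ (st (-σ w₁))))
      rw [hσ2 _ hne, neg_neg, he₁])
  have hg₁p : ∀ w, p (g₁ w) = f (σ w) := fun w => congrFun hg₁' w
  have hg₂p : ∀ w, p (g₂ w) = f (-σ w) := fun w => congrFun hg₂' w
  have stc : ContinuousOn st {v}ᶜ := by rw [← hsrc]; exact st.continuousOn
  have hc1 : ContinuousOn (fun x => g₁ (st x)) {v}ᶜ := g₁.continuous.comp_continuousOn stc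
  have hc2 : ContinuousOn (fun x : UnitSphere => g₂ (st (-x))) {-v}ᶜ := by
    refine g₂.continuous.comp_continuousOn (stc.comp continuous_neg.continuousOn ?_)
    intro x hx hx'
    apply hx
    rw [Set.mem_singleton_iff] at hx' ⊢
    rw [← hx', neg_neg]
  have hA : IsPreconnected (σ '' {0}ᶜ) :=
    ((isConnected_compl_singleton_of_one_lt_rank hrank' 0).isPreconnected).image _ σ.continuous.continuousOn
  have hAeq : σ '' {0}ᶜ = ({v}ᶜ ∩ {-v}ᶜ : Set UnitSphere) := by
    ext x
    constructor
    · rintro ⟨w, hw, rfl⟩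
      refine ⟨hσv w, fun h => hw ?_⟩
      rw [Set.mem_singleton_iff] at h ⊢
      rw [← hσ1 w, h, hσ0]
    · rintro ⟨h1, h2⟩
      refine ⟨st x, fun h => h2 ?_, hσ2 x h1⟩
      rw [Set.mem_singleton_iff] at h ⊢
      rw [← hσ2 x h1, h, ← hσ0, hσ2 _ hvv]
  rw [hAeq] at hA
  have heq : Set.EqOn (fun x => g₁ (st x)) (fun x : UnitSphere => g₂ (st (-x))) ({v}ᶜ ∩ {-v}ᶜ) := by
    refine hp.eqOn_of_comp_eqOn hA (hc1.mono Set.inter_subset_left)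
      (hc2.mono Set.inter_subset_right) ?_ (a := σ w₁) ?_ ?_
    · rintro x ⟨h1, h2⟩
      have h3 : -x ≠ v := fun h => h2 (by rw [Set.mem_singleton_iff, ← h, neg_neg])
      change p (g₁ (st x)) = p (g₂ (st (-x)))
      rw [hg₁p, hg₂p, hσ2 x h1, hσ2 _ h3, neg_neg]
    · rw [← hAeq]; exact ⟨w₁, hw₁, rfl⟩
    · rw [hσ1, hg₁, hg₂]
  classical
  let g : UnitSphere → E := fun x => if x = v then g₂ (st (-x)) else g₁ (st x)
  have e1 : Set.EqOn g (fun x => g₁ (st x)) {v}ᶜ := fun x hx => if_neg hx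
  have e2 : Set.EqOn g (fun x => g₂ (st (-x))) {-v}ᶜ := by
    intro x hx
    by_cases h : x = v
    · simp [g, h]
    · rw [e1 h]; exact heq ⟨h, hx⟩
  refine ⟨⟨g, continuous_iff_continuousAt.mpr fun x => ?_⟩, fun x => ?_⟩
  · by_cases h : x = v
    · exact (hc2.congr e2).continuousAt (isOpen_compl_singleton.mem_nhds (by
        rw [h]; exact fun h' => hvv h'.symm))
    · exact (hc1.congr e1).continuousAt (isOpen_compl_singleton.mem_nhds h)
  · change p (g x) = f x
    by_cases h : x = v
    · have h3 : -x ≠ v := by rw [h]; exact hvv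
      rw [show g x = g₂ (st (-x)) from if_pos h, hg₂p, hσ2 _ h3, neg_neg]
    · rw [e1 h, hg₁p, hσ2 x h]

/-- The antipodal action of the units of `ℤ` on the unit sphere. -/
instance sphereUnitsAction : MulAction ℤˣ UnitSphere where
  smul u x := ⟨(u : ℤ) • (x : EuclideanSpace ℝ (Fin 3)), by
    rcases Int.units_eq_one_or u with rfl | rfl <;> simp⟩
  one_smul x := by ext1; exact one_smul ℤ _
  mul_smul u w x := by
    ext1
    change ((u * w : ℤˣ) : ℤ) • (x : EuclideanSpace ℝ (Fin 3)) = (u : ℤ) • ((w : ℤ) • _)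
    rw [Units.val_mul, mul_smul]

theorem sphere_neg_one_smul (x : UnitSphere) :
    (-1 : ℤˣ) • x = -x := by
  ext1
  change ((-1 : ℤˣ) : ℤ) • (x : EuclideanSpace ℝ (Fin 3)) = _
  simp

instance : ContinuousConstSMul ℤˣ UnitSphere where
  continuous_const_smul u := by
    rcases Int.units_eq_one_or u with rfl | rfl
    · simp only [one_smul]; exact continuous_id
    · simpa only [sphere_neg_one_smul] using continuous_neg

/-- Freeness of the antipodal action: this is what makes the quotient map to the projective plane a
covering. -/
instance : IsCancelSMul ℤˣ UnitSphere where
  right_cancel' u w x h := by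
    have hx : x ≠ -x := ne_neg_of_mem_unit_sphere ℝ x
    rcases Int.units_eq_one_or u with rfl | rfl <;> rcases Int.units_eq_one_or w with rfl | rfl
    · rfl
    · rw [one_smul, sphere_neg_one_smul] at h; exact absurd h hx
    · rw [one_smul, sphere_neg_one_smul] at h; exact absurd h.symm hx
    · rfl

/-- On a connected space with a quotient map onto a sphere, a sphere-valued map which agrees up to
sign on the fibres agrees on the fibres. -/
theorem eq_of_eq_or_neg_on_fibres {X K : Type*} [TopologicalSpace X] [TopologicalSpace K]
    [PreconnectedSpace K]
    (e : X ≃ₜ UnitSphere) {q : K → X} (hq : IsQuotientMap q)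
    {F : K → UnitSphere} (hF : Continuous F)
    (h : ∀ x y, q x = q y → F x = F y ∨ F x = -F y) {x y : K} (hxy : q x = q y) : F x = F y := by
  have hcov : IsCoveringMap (Quotient.mk (MulAction.orbitRel ℤˣ
      UnitSphere)) :=
    isQuotientCoveringMap_quotientMk_of_properlyDiscontinuousSMul.isCoveringMap
  set p := Quotient.mk (MulAction.orbitRel ℤˣ UnitSphere)
  have hpeq : ∀ a b, p a = p b ↔ a = b ∨ a = -b := by
    intro a b
    rw [Quotient.eq, MulAction.orbitRel_apply, MulAction.mem_orbit_iff]
    constructor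
    · rintro ⟨u, hu⟩
      rcases Int.units_eq_one_or u with rfl | rfl
      · left; rw [← hu, one_smul]
      · right; rw [← hu, sphere_neg_one_smul]
    · rintro (rfl | rfl)
      · exact ⟨1, one_smul _ _⟩
      · exact ⟨-1, sphere_neg_one_smul _⟩
  -- In the projective plane the sign disappears, so the map factors through `q`.
  let f : C(K, _) := ⟨fun k => p (F k), hcov.continuous.comp hF⟩
  have hf : ∀ a b, q a = q b → f a = f b := fun a b hab => (hpeq _ _).2 (h a b hab)
  obtain ⟨f', hf'⟩ : ∃ f' : C(X, Quotient (MulAction.orbitRel ℤˣ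
      UnitSphere)), ∀ k, f' (q k) = p (F k) :=
    have hq' : IsQuotientMap (⟨q, hq.continuous⟩ : C(K, X)) := hq
    ⟨hq'.lift f hf, fun k => congrArg (fun g : C(K, _) => g k) (hq'.lift_comp f hf)⟩
  obtain ⟨g, hg⟩ := hcov.exists_lift_sphere Quotient.mk_surjective
    (f'.comp ⟨e.symm, e.symm.continuous⟩)
  have hG : ∀ k, p (g (e (q k))) = p (F k) := fun k => by
    rw [hg]; simp [hf']
  have hGc : Continuous fun k => g (e (q k)) :=
    g.continuous.comp (e.continuous.comp hq.continuous)
  -- The lift pulled back to `K` and `F` cover the same map. As `K` is connected, the pullback is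
  -- `F` or `-F` globally, and it is constant on the fibres of `q`.
  rcases (hpeq _ _).1 (hG x) with h1 | h1
  · have := hcov.eq_of_comp_eq hGc hF (funext hG) x h1
    rw [← congrFun this x, ← congrFun this y, hxy]
  · have := hcov.eq_of_comp_eq hGc hF.neg (funext fun k => (hG k).trans ((hpeq _ _).2
      (Or.inr (neg_neg _).symm))) x h1
    have h2 := congrFun this x
    have h3 := congrFun this y
    simp only [hxy] at h2
    exact neg_injective (h2.symm.trans h3)

/-! ### Arc-length parametrization of the boundary -/

noncomputable section
namespace PolygonFolding

theorem signedArea_lineMap (a b c d : Plane) (r : ℝ) :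
    signedArea a b (AffineMap.lineMap c d r) =
      (1 - r) * signedArea a b c + r * signedArea a b d := by
  simp only [signedArea, AffineMap.lineMap_apply, vsub_eq_sub, vadd_eq_add, PiLp.add_apply,
    PiLp.smul_apply, PiLp.sub_apply, smul_eq_mul]
  ring

theorem signedArea_self_left (a b : Plane) : signedArea a b a = 0 := by simp [signedArea]

theorem signedArea_self_right (a b : Plane) : signedArea a b b = 0 := by
  simp only [signedArea]; ring

theorem val_finRotate {n : ℕ} (i : Fin n) :
    (finRotate n i).val = if i.val + 1 = n then 0 else i.val + 1 := by
  obtain ⟨m, rfl⟩ : ∃ m, n = m + 1 := ⟨n - 1, by have := i.pos; omega⟩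
  rw [coe_finRotate]
  simp only [Fin.ext_iff, Fin.val_last, Nat.add_right_cancel_iff]

namespace ConvexPolygon

variable {n : ℕ} (P : ConvexPolygon n)

theorem pos {n : ℕ} (P : ConvexPolygon n) : 0 < n := lt_of_lt_of_le (by decide) P.three_le

theorem finRotate_ne {n : ℕ} (P : ConvexPolygon n) (i : Fin n) : finRotate n i ≠ i := by
  have := P.three_le
  rw [Ne, Fin.ext_iff, val_finRotate]
  split_ifs <;> omega

theorem finRotate_finRotate_ne {n : ℕ} (P : ConvexPolygon n) (i : Fin n) : finRotate n (finRotate n i) ≠ i := by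
  have := P.three_le
  rw [Ne, Fin.ext_iff, val_finRotate, val_finRotate]
  split_ifs <;> omega

theorem signedArea_nonneg (i j : Fin n) :
    0 ≤ signedArea (P.vertices i) (P.vertices (finRotate n i)) (P.vertices j) := by
  by_cases h1 : j = i
  · rw [h1, signedArea_self_left]
  by_cases h2 : j = finRotate n i
  · rw [h2, signedArea_self_right]
  exact (P.convex i j h1 h2).le

theorem vertices_finRotate_ne (i : Fin n) : P.vertices (finRotate n i) ≠ P.vertices i := by
  intro h
  have h1 := P.convex i (finRotate n (finRotate n i)) (P.finRotate_finRotate_ne i)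
    (P.finRotate_ne _)
  rw [h] at h1
  simp [signedArea] at h1

theorem edgeLength_pos (i : Fin n) : 0 < P.edgeLength i :=
  dist_pos.2 (P.vertices_finRotate_ne i).symm

theorem perimeter_pos : 0 < P.perimeter :=
  Finset.sum_pos (fun i _ => P.edgeLength_pos i) ⟨⟨0, P.pos⟩, Finset.mem_univ _⟩

theorem mark_nonneg (i : Fin n) : 0 ≤ P.mark i :=
  Finset.sum_nonneg fun j _ => (P.edgeLength_pos j).le

theorem mark_add_edgeLength (i : Fin n) :
    P.mark i + P.edgeLength i = ∑ j ∈ Finset.Iic i, P.edgeLength j := by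
  have h : Finset.Iic i = insert i (Finset.Iio i) := by
    ext j
    simp only [Finset.mem_Iic, Finset.mem_insert, Finset.mem_Iio]
    exact le_iff_eq_or_lt
  rw [mark, h, Finset.sum_insert (by simp), add_comm]

theorem mark_add_edgeLength_le_perimeter (i : Fin n) :
    P.mark i + P.edgeLength i ≤ P.perimeter := by
  rw [mark_add_edgeLength]
  exact Finset.sum_le_sum_of_subset_of_nonneg (Finset.subset_univ _)
    fun j _ _ => (P.edgeLength_pos j).le

theorem mark_lt_perimeter (i : Fin n) : P.mark i < P.perimeter :=
  lt_of_lt_of_le (lt_add_of_pos_right _ (P.edgeLength_pos i))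
    (P.mark_add_edgeLength_le_perimeter i)

theorem mark_add_edgeLength_le_mark {i j : Fin n} (h : i < j) :
    P.mark i + P.edgeLength i ≤ P.mark j := by
  rw [mark_add_edgeLength]
  exact Finset.sum_le_sum_of_subset_of_nonneg (fun k hk => by
    simp only [Finset.mem_Iic, Finset.mem_Iio] at *; exact lt_of_le_of_lt hk h)
    fun j _ _ => (P.edgeLength_pos j).le

theorem mark_zero : P.mark ⟨0, P.pos⟩ = 0 := by
  rw [mark, Finset.sum_eq_zero]
  intro j hj
  rw [Finset.mem_Iio, Fin.lt_def] at hj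
  simp at hj

theorem mark_finRotate (i : Fin n) (h : i.val + 1 ≠ n) :
    P.mark (finRotate n i) = P.mark i + P.edgeLength i := by
  rw [mark_add_edgeLength, mark]
  congr 1
  ext j
  rw [Finset.mem_Iio, Finset.mem_Iic, Fin.lt_def, Fin.le_def, val_finRotate, if_neg h]
  omega

theorem finRotate_last (i : Fin n) (h : i.val + 1 = n) : finRotate n i = ⟨0, P.pos⟩ := by
  rw [Fin.ext_iff, val_finRotate, if_pos h]

theorem mark_last (i : Fin n) (h : i.val + 1 = n) :
    P.mark i + P.edgeLength i = P.perimeter := by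
  rw [mark_add_edgeLength, perimeter]
  congr 1
  ext j
  simp only [Finset.mem_Iic, Finset.mem_univ, iff_true, Fin.le_def]
  omega

theorem exists_mark_le_lt {u : ℝ} (h0 : 0 ≤ u) (h1 : u < P.perimeter) :
    ∃ i, P.mark i ≤ u ∧ u < P.mark i + P.edgeLength i := by
  by_contra hcon
  push Not at hcon
  have key : ∀ k (hk : k < n), P.mark ⟨k, hk⟩ ≤ u := by
    intro k
    induction k with
    | zero => intro hk; rw [P.mark_zero]; exact h0
    | succ k ih =>
      intro hk
      have h2 := hcon ⟨k, by omega⟩ (ih (by omega))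
      have h3 := P.mark_finRotate ⟨k, by omega⟩ (by simp; omega)
      have h4 : finRotate n ⟨k, by omega⟩ = ⟨k + 1, hk⟩ := by
        rw [Fin.ext_iff, val_finRotate, if_neg (by simp; omega)]
      rw [h4] at h3
      rw [h3]; exact h2
  have hn := P.pos
  have h5 := hcon ⟨n - 1, by omega⟩ (key _ _)
  rw [P.mark_last _ (by simp; omega)] at h5
  linarith

/-- The arc-length parametrization of the boundary on `[0, perimeter]`. -/
def basePoint (u : ℝ) : Plane :=
  P.vertices ⟨0, P.pos⟩ +
    ∑ i, max 0 (min 1 ((u - P.mark i) / P.edgeLength i)) •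
      (P.vertices (finRotate n i) - P.vertices i)

theorem boundaryPoint_eq (t : ℝ) :
    P.boundaryPoint t = P.basePoint (P.perimeter * Int.fract (t / P.perimeter)) := rfl

theorem sum_Iio_sub (i : Fin n) :
    ∑ j ∈ Finset.Iio i, (P.vertices (finRotate n j) - P.vertices j) =
      P.vertices i - P.vertices ⟨0, P.pos⟩ := by
  obtain ⟨k, hk⟩ := i
  induction k with
  | zero =>
    rw [sub_self, Finset.sum_eq_zero]
    intro j hj
    rw [Finset.mem_Iio, Fin.lt_def] at hj
    simp at hj
  | succ k ih =>
    have h1 : Finset.Iio (⟨k + 1, hk⟩ : Fin n) = insert ⟨k, by omega⟩ (Finset.Iio ⟨k, by omega⟩) := by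
      ext j
      simp only [Finset.mem_Iio, Finset.mem_insert, Fin.lt_def, Fin.ext_iff]
      omega
    have h4 : finRotate n ⟨k, by omega⟩ = ⟨k + 1, hk⟩ := by
      rw [Fin.ext_iff, val_finRotate, if_neg (by simp; omega)]
    rw [h1, Finset.sum_insert (by simp), ih, h4]
    abel

theorem basePoint_of_mem {u : ℝ} {i : Fin n} (h0 : P.mark i ≤ u)
    (h1 : u ≤ P.mark i + P.edgeLength i) :
    P.basePoint u = AffineMap.lineMap (P.vertices i) (P.vertices (finRotate n i))
      ((u - P.mark i) / P.edgeLength i) := by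
  have hterm : ∀ j, max 0 (min 1 ((u - P.mark j) / P.edgeLength j)) •
      (P.vertices (finRotate n j) - P.vertices j) =
      (if j ∈ Finset.Iio i then (P.vertices (finRotate n j) - P.vertices j) else 0) +
      (if j = i then ((u - P.mark j) / P.edgeLength j) •
        (P.vertices (finRotate n j) - P.vertices j) else 0) := by
    intro j
    have hj := P.edgeLength_pos j
    rcases lt_trichotomy j i with h | h | h
    · rw [if_pos (Finset.mem_Iio.2 h), if_neg h.ne, min_eq_left, max_eq_right zero_le_one, one_smul,
        add_zero]
      rw [le_div_iff₀ hj]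
      have := P.mark_add_edgeLength_le_mark h
      linarith
    · subst h
      rw [if_neg (by simp), if_pos rfl, zero_add, min_eq_right, max_eq_right]
      · exact div_nonneg (by linarith) hj.le
      · rw [div_le_one hj]; linarith
    · rw [if_neg (by simp [h.le]), if_neg h.ne', max_eq_left, zero_smul, add_zero]
      refine min_le_of_right_le (div_nonpos_of_nonpos_of_nonneg ?_ hj.le)
      have := P.mark_add_edgeLength_le_mark h
      linarith
  rw [basePoint, Finset.sum_congr rfl fun j _ => hterm j, Finset.sum_add_distrib,
    Finset.sum_ite_mem, Finset.univ_inter, P.sum_Iio_sub, Finset.sum_ite_eq' Finset.univ i,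
    if_pos (Finset.mem_univ i), AffineMap.lineMap_apply, vsub_eq_sub, vadd_eq_add]
  abel

theorem basePoint_zero : P.basePoint 0 = P.vertices ⟨0, P.pos⟩ := by
  have h0 := P.mark_zero
  rw [P.basePoint_of_mem (i := ⟨0, P.pos⟩) h0.le (by
    rw [h0, zero_add]; exact (P.edgeLength_pos _).le), h0]
  simp

theorem basePoint_perimeter : P.basePoint P.perimeter = P.vertices ⟨0, P.pos⟩ := by
  have hn := P.pos
  have h1 := P.mark_last ⟨n - 1, by omega⟩ (by simp; omega)
  rw [← h1, P.basePoint_of_mem (i := ⟨n - 1, by omega⟩) (by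
    linarith [P.edgeLength_pos ⟨n - 1, by omega⟩]) le_rfl, add_sub_cancel_left,
    div_self (P.edgeLength_pos _).ne', AffineMap.lineMap_apply_one,
    P.finRotate_last _ (by simp; omega)]

theorem continuous_basePoint : Continuous P.basePoint := by
  unfold basePoint
  fun_prop

theorem boundaryPoint_add_int_mul (t : ℝ) (k : ℤ) :
    P.boundaryPoint (t + k * P.perimeter) = P.boundaryPoint t := by
  rw [boundaryPoint_eq, boundaryPoint_eq, add_div, mul_div_cancel_right₀ _ P.perimeter_pos.ne',
    Int.fract_add_intCast]

theorem boundaryPoint_add_perimeter (t : ℝ) :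
    P.boundaryPoint (t + P.perimeter) = P.boundaryPoint t := by
  simpa using P.boundaryPoint_add_int_mul t 1

theorem boundaryPoint_of_mem_Icc {t : ℝ} (h0 : 0 ≤ t) (h1 : t ≤ P.perimeter) :
    P.boundaryPoint t = P.basePoint t := by
  have hL := P.perimeter_pos
  rcases h1.eq_or_lt with rfl | h1
  · rw [boundaryPoint_eq, div_self hL.ne', Int.fract_one, mul_zero, P.basePoint_zero,
      P.basePoint_perimeter]
  · rw [boundaryPoint_eq, Int.fract_eq_self.2 ⟨div_nonneg h0 hL.le, (div_lt_one hL).2 h1⟩,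
      mul_div_cancel₀ _ hL.ne']

/-- Reduction of a parameter modulo the perimeter. -/
theorem exists_add_int_mul_mem (c t : ℝ) :
    ∃ k : ℤ, c ≤ t + k * P.perimeter ∧ t + k * P.perimeter < c + P.perimeter := by
  have hL := P.perimeter_pos
  refine ⟨-⌊(t - c) / P.perimeter⌋, ?_, ?_⟩
  · have := Int.floor_le ((t - c) / P.perimeter)
    rw [le_div_iff₀ hL] at this
    push_cast; linarith
  · have := Int.lt_floor_add_one ((t - c) / P.perimeter)
    rw [div_lt_iff₀ hL] at this
    push_cast; linarith

theorem continuous_boundaryPoint : Continuous P.boundaryPoint := by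
  have hL := P.perimeter_pos
  have h : Continuous fun t : ℝ => P.basePoint (P.perimeter * Int.fract t) := by
    refine ContinuousOn.comp_fract'' (f := fun s : ℝ => P.basePoint (P.perimeter * s)) ?_ ?_
    · exact (P.continuous_basePoint.comp (continuous_const.mul continuous_id)).continuousOn
    · simp only [mul_zero, mul_one, P.basePoint_zero, P.basePoint_perimeter]
  exact h.comp (continuous_id.div_const _)

theorem boundaryPoint_of_mem {t : ℝ} {i : Fin n} (h0 : P.mark i ≤ t)
    (h1 : t ≤ P.mark i + P.edgeLength i) :
    P.boundaryPoint t = AffineMap.lineMap (P.vertices i) (P.vertices (finRotate n i))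
      ((t - P.mark i) / P.edgeLength i) := by
  rw [P.boundaryPoint_of_mem_Icc ((P.mark_nonneg i).trans h0)
    (h1.trans (P.mark_add_edgeLength_le_perimeter i)), P.basePoint_of_mem h0 h1]

theorem boundaryPoint_mark (i : Fin n) : P.boundaryPoint (P.mark i) = P.vertices i := by
  rw [P.boundaryPoint_of_mem le_rfl (by linarith [P.edgeLength_pos i])]
  simp

/-- Half-open edges are disjoint: a point of edge `j` before its end lies on the line of another
edge `i` only if `v_j` does, by positivity of the signed areas, so `j` follows `i`. By symmetry `i`
follows `j`, impossible for n ≥ 3. -/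
theorem lineMap_edge_inj {i j : Fin n} {r s : ℝ} (hr : 0 ≤ r) (hr' : r < 1) (hs : 0 ≤ s)
    (hs' : s < 1)
    (h : (AffineMap.lineMap (P.vertices i) (P.vertices (finRotate n i)) r : Plane) =
      AffineMap.lineMap (P.vertices j) (P.vertices (finRotate n j)) s) : i = j ∧ r = s := by
  have key : ∀ (i j : Fin n) (r s : ℝ), 0 ≤ s → s < 1 →
      (AffineMap.lineMap (P.vertices i) (P.vertices (finRotate n i)) r : Plane) =
      AffineMap.lineMap (P.vertices j) (P.vertices (finRotate n j)) s → i ≠ j →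
      j = finRotate n i := by
    intro i j r s hs hs' h hij
    by_contra hne
    have h1 := congrArg (signedArea (P.vertices i) (P.vertices (finRotate n i))) h
    rw [signedArea_lineMap, signedArea_lineMap, signedArea_self_left, signedArea_self_right] at h1
    have h2 := P.convex i j (Ne.symm hij) hne
    have h3 := P.signedArea_nonneg i (finRotate n j)
    have h4 := mul_pos (sub_pos.2 hs') h2
    have h5 := mul_nonneg hs h3
    linarith
  have hij : i = j := by
    by_contra hij
    have h1 := key i j r s hs hs' h hij
    have h2 := key j i s r hr hr' h.symm (Ne.symm hij)
    rw [h1] at h2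
    exact P.finRotate_finRotate_ne i h2.symm
  subst hij
  exact ⟨rfl, (AffineMap.lineMap_injective ℝ (P.vertices_finRotate_ne i).symm) h⟩

theorem basePoint_injOn : Set.InjOn P.basePoint (Set.Ico 0 P.perimeter) := by
  intro s hs t ht h
  obtain ⟨i, hi, hi'⟩ := P.exists_mark_le_lt hs.1 hs.2
  obtain ⟨j, hj, hj'⟩ := P.exists_mark_le_lt ht.1 ht.2
  rw [P.basePoint_of_mem hi hi'.le, P.basePoint_of_mem hj hj'.le] at h
  have pi := P.edgeLength_pos i
  have pj := P.edgeLength_pos j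
  obtain ⟨rfl, h2⟩ := P.lineMap_edge_inj (div_nonneg (by linarith) pi.le)
    ((div_lt_one pi).2 (by linarith)) (div_nonneg (by linarith) pj.le)
    ((div_lt_one pj).2 (by linarith)) h
  rw [div_left_inj' pi.ne'] at h2
  linarith

/-- This lets all later arguments run on the real line, with boundary points as parameters modulo
the perimeter and the cyclic order as the order of lifts. -/
theorem boundaryPoint_eq_iff {s t : ℝ} :
    P.boundaryPoint s = P.boundaryPoint t ↔ ∃ k : ℤ, t = s + k * P.perimeter := by
  constructor
  · intro h
    obtain ⟨a, ha, ha'⟩ := P.exists_add_int_mul_mem 0 s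
    obtain ⟨b, hb, hb'⟩ := P.exists_add_int_mul_mem 0 t
    rw [← P.boundaryPoint_add_int_mul s a, ← P.boundaryPoint_add_int_mul t b,
      P.boundaryPoint_of_mem_Icc ha (by linarith), P.boundaryPoint_of_mem_Icc hb (by linarith)] at h
    have := P.basePoint_injOn ⟨ha, by linarith⟩ ⟨hb, by linarith⟩ h
    exact ⟨a - b, by push_cast; linarith⟩
  · rintro ⟨k, rfl⟩
    rw [P.boundaryPoint_add_int_mul]

theorem eq_of_boundaryPoint_eq {s t : ℝ} (h : P.boundaryPoint s = P.boundaryPoint t)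
    (h1 : |s - t| < P.perimeter) : s = t := by
  obtain ⟨k, rfl⟩ := P.boundaryPoint_eq_iff.1 h
  have hL := P.perimeter_pos
  rw [sub_add_cancel_left, abs_neg, abs_mul, abs_of_pos hL] at h1
  have h2 : |(k : ℝ)| < 1 := by
    by_contra h3
    push Not at h3
    nlinarith
  have h3 : |k| < 1 := by exact_mod_cast h2
  rw [Int.abs_lt_one_iff] at h3
  simp [h3]

theorem range_boundaryPoint : Set.range P.boundaryPoint = P.bdry := by
  apply Set.Subset.antisymm
  · rintro _ ⟨t, rfl⟩
    obtain ⟨a, ha, ha'⟩ := P.exists_add_int_mul_mem 0 t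
    rw [← P.boundaryPoint_add_int_mul t a]
    obtain ⟨i, hi, hi'⟩ := P.exists_mark_le_lt ha (by linarith)
    have pi := P.edgeLength_pos i
    rw [P.boundaryPoint_of_mem hi hi'.le]
    refine Set.mem_iUnion.2 ⟨i, _, ⟨div_nonneg (by linarith) pi.le,
      (div_le_one pi).2 (by linarith)⟩, rfl⟩
  · intro x hx
    obtain ⟨i, r, hr, rfl⟩ := Set.mem_iUnion.1 hx
    have pi := P.edgeLength_pos i
    refine ⟨P.mark i + r * P.edgeLength i, ?_⟩
    rw [P.boundaryPoint_of_mem (i := i) (by nlinarith [hr.1]) (by nlinarith [hr.2]),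
      add_sub_cancel_left, mul_div_cancel_right₀ _ pi.ne']

theorem boundaryPoint_mem_bdry (t : ℝ) : P.boundaryPoint t ∈ P.bdry := by
  rw [← range_boundaryPoint]; exact ⟨t, rfl⟩

theorem exists_boundaryPoint_eq {x : Plane} (hx : x ∈ P.bdry) (c : ℝ) :
    ∃ t, c ≤ t ∧ t < c + P.perimeter ∧ P.boundaryPoint t = x := by
  rw [← range_boundaryPoint] at hx
  obtain ⟨t, rfl⟩ := hx
  obtain ⟨k, h1, h2⟩ := P.exists_add_int_mul_mem c t
  exact ⟨_, h1, h2, P.boundaryPoint_add_int_mul t k⟩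

theorem boundaryPoint_mem_inl {t : ℝ} {i : Fin n} :
    P.boundaryPoint t ∈ P.elementSet (Sum.inl i) ↔ ∃ k : ℤ, t = P.mark i + k * P.perimeter := by
  rw [← boundaryPoint_eq_iff, P.boundaryPoint_mark]
  exact eq_comm

theorem mark_injective : Function.Injective P.mark := by
  intro i j h
  rcases lt_trichotomy i j with h1 | h1 | h1
  · have := P.mark_add_edgeLength_le_mark h1
    have := P.edgeLength_pos i
    linarith
  · exact h1
  · have := P.mark_add_edgeLength_le_mark h1
    have := P.edgeLength_pos j
    linarith

theorem vertices_injective : Function.Injective P.vertices := by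
  intro i j h
  rw [← P.boundaryPoint_mark, ← P.boundaryPoint_mark] at h
  refine P.mark_injective (P.eq_of_boundaryPoint_eq h ?_)
  rw [abs_lt]
  constructor <;> linarith [P.mark_nonneg i, P.mark_nonneg j, P.mark_lt_perimeter i,
    P.mark_lt_perimeter j]

theorem boundaryPoint_mem_inr {t : ℝ} {i : Fin n} :
    P.boundaryPoint t ∈ P.elementSet (Sum.inr i) ↔
      ∃ k : ℤ, P.mark i + k * P.perimeter < t ∧
        t < P.mark i + P.edgeLength i + k * P.perimeter := by
  have pi := P.edgeLength_pos i
  constructor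
  · intro h
    change _ ∈ openSegment ℝ _ _ at h
    rw [openSegment_eq_image_lineMap] at h
    obtain ⟨r, hr, hr'⟩ := h
    have h1 : P.boundaryPoint (P.mark i + r * P.edgeLength i) = P.boundaryPoint t := by
      rw [← hr', P.boundaryPoint_of_mem (i := i) (by nlinarith [hr.1]) (by nlinarith [hr.2]),
        add_sub_cancel_left, mul_div_cancel_right₀ _ pi.ne']
    obtain ⟨k, rfl⟩ := P.boundaryPoint_eq_iff.1 h1
    exact ⟨k, by nlinarith [hr.1], by nlinarith [hr.2]⟩
  · rintro ⟨k, h1, h2⟩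
    have h3 := P.boundaryPoint_add_int_mul t (-k)
    push_cast at h3
    change _ ∈ openSegment ℝ _ _
    rw [openSegment_eq_image_lineMap, ← h3, P.boundaryPoint_of_mem (i := i) (by linarith)
      (by linarith)]
    exact ⟨_, ⟨div_pos (by linarith) pi, (div_lt_one pi).2 (by linarith)⟩, rfl⟩

theorem isClosed_bdry_image (a b : ℝ) : IsCompact (P.boundaryPoint '' Set.Icc a b) :=
  isCompact_Icc.image P.continuous_boundaryPoint

theorem isCompact_bdry : IsCompact P.bdry := by
  have : P.bdry = P.boundaryPoint '' Set.Icc 0 P.perimeter := by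
    apply Set.Subset.antisymm
    · intro x hx
      obtain ⟨t, h1, h2, h3⟩ := P.exists_boundaryPoint_eq hx 0
      exact ⟨t, ⟨h1, by linarith⟩, h3⟩
    · rintro _ ⟨t, -, rfl⟩
      exact P.boundaryPoint_mem_bdry t
  rw [this]
  exact P.isClosed_bdry_image _ _

theorem bdry_subset_region : P.bdry ⊆ P.region := by
  intro x hx
  obtain ⟨i, hi⟩ := Set.mem_iUnion.1 hx
  rw [Polygon.edgeSet, affineSegment_eq_segment] at hi
  exact (convex_convexHull ℝ _).segment_subset (subset_convexHull ℝ _ (Set.mem_range_self i))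
    (subset_convexHull ℝ _ (Set.mem_range_self (finRotate n i))) hi

end ConvexPolygon
end PolygonFolding
end

/-! ### The gluing relation in terms of parameters -/

noncomputable section
namespace PolygonFolding
namespace Gluing

variable {n : ℕ} {P : ConvexPolygon n} (G : Gluing P)

/-- Two boundary parameters are related if the corresponding points are glued together. -/
def Rel (x y : ℝ) : Prop := G.setoid (P.boundaryPoint x) (P.boundaryPoint y)

/-- The parameter glued by the `k`-th pair to the point at distance `t` along the `k`-th arc. -/
def img (k : Fin G.m) (t : ℝ) : ℝ :=
  G.start (G.partner k) + if G.reversed k then G.len k - t else t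

/-- The parameter `x` lies in the interior of the `k`-th arc, at distance `t` from its start. -/
def InArc (k : Fin G.m) (t x : ℝ) : Prop :=
  0 < t ∧ t < G.len k ∧ P.boundaryPoint x = P.boundaryPoint (G.start k + t)

variable {G}

theorem Rel.refl (x : ℝ) : G.Rel x x := G.setoid.refl _

theorem Rel.symm {x y : ℝ} (h : G.Rel x y) : G.Rel y x := G.setoid.symm h

theorem Rel.trans {x y z : ℝ} (h : G.Rel x y) (h' : G.Rel y z) : G.Rel x z := G.setoid.trans h h'

theorem Rel.of_eq {x y : ℝ} (h : P.boundaryPoint x = P.boundaryPoint y) : G.Rel x y := by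
  unfold Rel; rw [h]

theorem Rel.shift {x y : ℝ} (h : G.Rel x y) (j k : ℤ) :
    G.Rel (x + j * P.perimeter) (y + k * P.perimeter) := by
  unfold Rel
  rwa [P.boundaryPoint_add_int_mul, P.boundaryPoint_add_int_mul]

theorem rel_add_perimeter (x : ℝ) : G.Rel x (x + P.perimeter) :=
  Rel.of_eq (P.boundaryPoint_add_perimeter x).symm

theorem Rel.of_glued {k : Fin G.m} {t : ℝ} (h0 : 0 ≤ t) (h1 : t ≤ G.len k) :
    G.Rel (G.start k + t) (G.img k t) :=
  Relation.EqvGen.rel _ _ ⟨k, t, ⟨h0, h1⟩, rfl, rfl⟩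

variable (G)

/-- An arc as long as the whole boundary would leave no room for its disjoint partner of the same
length. -/
theorem len_lt_perimeter (k : Fin G.m) : G.len k < P.perimeter := by
  by_contra hlt
  push Not at hlt
  have hL := P.perimeter_pos
  obtain ⟨j, h1, h2⟩ := P.exists_add_int_mul_mem (G.start k) (G.start (G.partner k))
  have hd := G.disjoint (G.partner k) k (G.partner_ne k)
  set a := G.start (G.partner k) + j * P.perimeter
  set δ := (G.start k + P.perimeter - a) / 2 with hδ
  have hδ0 : 0 < δ := by rw [hδ]; linarith
  have hδ1 : δ ≤ P.perimeter / 2 := by rw [hδ]; linarith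
  refine Set.disjoint_left.1 hd ⟨G.start (G.partner k) + δ, ⟨by linarith, ?_⟩, rfl⟩
    ⟨a + δ, ⟨by linarith, ?_⟩, ?_⟩
  · rw [G.len_partner]; linarith
  · have : 2 * δ = G.start k + P.perimeter - a := by rw [hδ]; ring
    linarith
  · rw [show a + δ = G.start (G.partner k) + δ + j * P.perimeter by simp only [a]; ring,
      P.boundaryPoint_add_int_mul]

variable {G}

theorem InArc.unique {k l : Fin G.m} {s t x : ℝ} (h : G.InArc k s x) (h' : G.InArc l t x) :
    k = l ∧ s = t := by
  obtain ⟨h0, h1, h2⟩ := h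
  obtain ⟨h0', h1', h2'⟩ := h'
  have hkl : k = l := by
    by_contra hne
    refine Set.disjoint_left.1 (G.disjoint k l hne) ⟨G.start k + s, ⟨by linarith, by linarith⟩, rfl⟩
      ⟨G.start l + t, ⟨by linarith, by linarith⟩, ?_⟩
    rw [← h2, ← h2']
  subst hkl
  have h3 := P.eq_of_boundaryPoint_eq (h2.symm.trans h2') (by
    rw [add_sub_add_left_eq_sub, abs_lt]
    constructor <;> linarith [G.len_lt_perimeter k])
  exact ⟨rfl, by linarith⟩

theorem InArc.add {k : Fin G.m} {t x : ℝ} (h : G.InArc k t x) {s : ℝ} (h0 : 0 < t + s)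
    (h1 : t + s < G.len k) : G.InArc k (t + s) (x + s) := by
  refine ⟨h0, h1, ?_⟩
  obtain ⟨j, hj⟩ := P.boundaryPoint_eq_iff.1 h.2.2
  rw [show G.start k + (t + s) = x + s + j * P.perimeter by linarith,
    P.boundaryPoint_add_int_mul]

theorem InArc.congr {k : Fin G.m} {t x y : ℝ} (h : G.InArc k t x)
    (hxy : P.boundaryPoint y = P.boundaryPoint x) : G.InArc k t y :=
  ⟨h.1, h.2.1, hxy.trans h.2.2⟩

/-- An end of one arc is never interior to another: moving both points by a small `e` that stays
inside both open arcs reduces the claim to `InArc.unique`. -/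
theorem InArc.unique_closed {k l : Fin G.m} {s t x : ℝ} (h : G.InArc k s x) (h0 : 0 ≤ t)
    (h1 : t ≤ G.len l) (h2 : P.boundaryPoint x = P.boundaryPoint (G.start l + t)) :
    k = l ∧ s = t := by
  have hl := G.len_pos l
  obtain ⟨h3, h4, -⟩ := id h
  obtain ⟨j, hj⟩ := P.boundaryPoint_eq_iff.1 h2
  have key : ∀ e : ℝ, 0 < s + e → s + e < G.len k → 0 < t + e → t + e < G.len l →
      k = l ∧ s = t := by
    intro e he1 he2 he3 he4
    have a1 := h.add he1 he2
    have a2 : G.InArc l (t + e) (x + e) := ⟨he3, he4, by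
      rw [show G.start l + (t + e) = x + e + j * P.perimeter by linarith,
        P.boundaryPoint_add_int_mul]⟩
    obtain ⟨h5, h6⟩ := a1.unique a2
    exact ⟨h5, by linarith⟩
  rcases h0.eq_or_lt with h0 | h0
  · have hm : 0 < min (G.len k - s) (G.len l) := lt_min (by linarith) hl
    refine key (min (G.len k - s) (G.len l) / 2) ?_ ?_ ?_ ?_ <;>
      linarith [min_le_left (G.len k - s) (G.len l), min_le_right (G.len k - s) (G.len l)]
  rcases h1.eq_or_lt with h1 | h1
  · have hm : 0 < min s (G.len l) := lt_min h3 hl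
    refine key (-(min s (G.len l) / 2)) ?_ ?_ ?_ ?_ <;>
      linarith [min_le_left s (G.len l), min_le_right s (G.len l)]
  · exact key 0 (by linarith) (by linarith) (by linarith) (by linarith)

variable (G)

theorem img_offset {k : Fin G.m} {t : ℝ} :
    ∃ u, G.img k t = G.start (G.partner k) + u ∧ (0 ≤ t → t ≤ G.len k → 0 ≤ u ∧ u ≤ G.len k) ∧
      (0 < t → t < G.len k → 0 < u ∧ u < G.len k) ∧
      (u = if G.reversed k then G.len k - t else t) ∧
      (t = if G.reversed k then G.len k - u else u) := by
  refine ⟨_, rfl, ?_, ?_, rfl, ?_⟩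
  · intro h0 h1; split_ifs <;> constructor <;> linarith
  · intro h0 h1; split_ifs <;> constructor <;> linarith
  · split_ifs <;> ring

variable {G}

theorem InArc.img {k : Fin G.m} {t x : ℝ} (h : G.InArc k t x) :
    G.InArc (G.partner k) (if G.reversed k then G.len k - t else t) (G.img k t) := by
  refine ⟨?_, ?_, rfl⟩
  · split_ifs <;> linarith [h.1, h.2.1]
  · rw [G.len_partner]; split_ifs <;> linarith [h.1, h.2.1]

/-- The only way the generated relation is ever bounded from above: a set closed under direct
identifications is a union of classes. -/
theorem setoid_invariant {A : Set Plane} (h : ∀ x y, G.Glued x y → (x ∈ A ↔ y ∈ A)) {x y : Plane}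
    (hxy : G.setoid x y) : x ∈ A ↔ y ∈ A := by
  induction hxy with
  | rel x y hxy => exact h x y hxy
  | refl => rfl
  | symm _ _ _ ih => exact ih.symm
  | trans _ _ _ _ _ ih1 ih2 => exact ih1.trans ih2

theorem mem_bdry_iff_of_setoid {x y : Plane} (hxy : G.setoid x y) :
    x ∈ P.bdry ↔ y ∈ P.bdry := by
  refine setoid_invariant (fun x y h => ?_) hxy
  obtain ⟨k, t, -, rfl, rfl⟩ := h
  exact iff_of_true (P.boundaryPoint_mem_bdry _) (P.boundaryPoint_mem_bdry _)

theorem eq_of_setoid_of_notMem {x y : Plane} (hxy : G.setoid x y) (hx : x ∉ P.bdry) : y = x := by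
  refine (setoid_invariant (A := {x}) (fun a b h => ?_) hxy).1 rfl
  obtain ⟨k, t, -, rfl, rfl⟩ := h
  refine iff_of_false ?_ ?_ <;>
  · rintro h
    rw [Set.mem_singleton_iff] at h
    exact hx (h ▸ P.boundaryPoint_mem_bdry _)

/-- The class of an interior point of an arc consists of this point and its image. -/
theorem InArc.eq_or_eq_of_setoid {k : Fin G.m} {t x : ℝ} (h : G.InArc k t x) {y : Plane}
    (hy : G.setoid (P.boundaryPoint x) y) :
    y = P.boundaryPoint x ∨ y = P.boundaryPoint (G.img k t) := by
  have h' := h.img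
  have inv : ∀ a b, G.Glued a b →
      (a ∈ ({P.boundaryPoint x, P.boundaryPoint (G.img k t)} : Set Plane) ↔
        b ∈ ({P.boundaryPoint x, P.boundaryPoint (G.img k t)} : Set Plane)) := by
    rintro a b ⟨l, s, ⟨hs0, hs1⟩, rfl, rfl⟩
    change _ ↔ P.boundaryPoint (G.img l s) ∈ _
    simp only [Set.mem_insert_iff, Set.mem_singleton_iff]
    constructor
    · rintro (h1 | h1)
      · obtain ⟨rfl, rfl⟩ := h.unique_closed hs0 hs1 h1.symm
        exact Or.inr rfl
      · obtain ⟨rfl, h3⟩ := h'.unique_closed hs0 hs1 h1.symm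
        left
        have h4 : G.img (G.partner k) s = G.start k + t := by
          rw [Gluing.img, G.partner_partner, G.reversed_partner, G.len_partner, ← h3]
          split_ifs <;> ring
        rw [h4, h.2.2]
    · obtain ⟨u, hu1, hu2, -, hu4, hu5⟩ := G.img_offset (k := l) (t := s)
      obtain ⟨hu2, hu3⟩ := hu2 hs0 hs1
      rintro (h1 | h1)
      · rw [hu1] at h1
        obtain ⟨rfl, rfl⟩ := h.unique_closed hu2 (by rw [G.len_partner]; exact hu3) h1.symm
        right
        have h4 : G.img (G.partner l) t = G.start l + s := by
          rw [Gluing.img, G.partner_partner, G.reversed_partner, G.len_partner, hu5]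
        rw [h4]
      · rw [hu1] at h1
        obtain ⟨h2, h3⟩ := h'.unique_closed hu2 (by rw [G.len_partner]; exact hu3) h1.symm
        have h2' : k = l := by rw [← G.partner_partner k, h2, G.partner_partner]
        subst h2'
        left
        rw [h.2.2, hu5, ← h3]
        congr 2
        split_ifs <;> ring
  exact (setoid_invariant inv hy).1 (Or.inl rfl)

variable (G)

/-- Every parameter has an arc immediately to its right. -/
theorem exists_arc_right (x : ℝ) : ∃ k t, 0 ≤ t ∧ t < G.len k ∧
    P.boundaryPoint x = P.boundaryPoint (G.start k + t) := by
  by_contra hcon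
  push Not at hcon
  have hL := P.perimeter_pos
  have h1 : ∀ k, ∃ e > 0, ∀ d, 0 < d → d < e →
      P.boundaryPoint (x + d) ∉ P.boundaryPoint '' Set.Icc (G.start k) (G.start k + G.len k) := by
    intro k
    obtain ⟨j, hj1, hj2⟩ := P.exists_add_int_mul_mem (G.start k) x
    have hk : G.len k ≤ x + j * P.perimeter - G.start k := by
      by_contra hlt
      push Not at hlt
      refine hcon k (x + j * P.perimeter - G.start k) (by linarith) hlt ?_
      rw [add_sub_cancel, P.boundaryPoint_add_int_mul]
    refine ⟨G.start k + P.perimeter - (x + j * P.perimeter), by linarith, ?_⟩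
    rintro d hd0 hd1 ⟨y, ⟨hy1, hy2⟩, hy3⟩
    have h3 : P.boundaryPoint y = P.boundaryPoint (x + d + j * P.perimeter) := by
      rw [hy3, P.boundaryPoint_add_int_mul]
    have h4 := P.eq_of_boundaryPoint_eq h3 (by rw [abs_lt]; constructor <;> linarith)
    linarith
  choose e he0 he using h1
  obtain ⟨k0, -⟩ := Set.mem_iUnion.1 (G.cover (P.boundaryPoint_mem_bdry x))
  obtain ⟨k1, -, hk1⟩ := Finset.exists_min_image Finset.univ e ⟨k0, Finset.mem_univ _⟩
  obtain ⟨k, hk⟩ := Set.mem_iUnion.1 (G.cover (P.boundaryPoint_mem_bdry (x + e k1 / 2)))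
  have := he0 k1
  exact he k (e k1 / 2) (by linarith) (by linarith [hk1 k (Finset.mem_univ _)]) hk

end Gluing
end PolygonFolding
end

/-! ### The collar map; reversed direction and non-crossing -/

noncomputable section
namespace PolygonFolding
open Topology

/-- The point of the sphere with polar angle `u` and azimuth `h`. -/
def polar (u h : ℝ) : UnitSphere :=
  ⟨!₂[Real.sin u * Real.cos h, Real.sin u * Real.sin h, Real.cos u], by
    rw [mem_sphere_zero_iff_norm, EuclideanSpace.norm_eq, Real.sqrt_eq_one, Fin.sum_univ_three]
    simp only [Real.norm_eq_abs, sq_abs]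
    simp
    nlinarith [Real.sin_sq_add_cos_sq u, Real.sin_sq_add_cos_sq h]⟩

theorem continuous_polar : Continuous fun p : ℝ × ℝ => polar p.1 p.2 := by
  unfold polar
  refine Continuous.subtype_mk ?_ _
  refine (PiLp.continuous_toLp 2 _).comp (continuous_pi fun i => ?_)
  fin_cases i <;> simp <;> fun_prop

theorem polar_zero (h h' : ℝ) : polar 0 h = polar 0 h' := by
  ext i; fin_cases i <;> simp [polar]

theorem polar_pi (h h' : ℝ) : polar Real.pi h = -polar 0 h' := by
  ext i; fin_cases i <;> simp [polar]

theorem polar_pi_sub (u : ℝ) : polar (Real.pi - u) Real.pi = -polar u 0 := by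
  ext i; fin_cases i <;> simp [polar]

/-- Truncation to the unit interval. -/
def clamp (r : ℝ) : ℝ := max 0 (min 1 r)

theorem continuous_clamp : Continuous clamp := by unfold clamp; fun_prop

theorem clamp_of_nonpos {r : ℝ} (h : r ≤ 0) : clamp r = 0 :=
  max_eq_left (min_le_of_right_le h)

theorem clamp_of_one_le {r : ℝ} (h : 1 ≤ r) : clamp r = 1 := by
  rw [clamp, min_eq_left h, max_eq_right zero_le_one]

theorem clamp_of_mem {r : ℝ} (h0 : 0 ≤ r) (h1 : r ≤ 1) : clamp r = r := by
  rw [clamp, min_eq_right h1, max_eq_right h0]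

namespace ConvexPolygon
variable {n : ℕ} (P : ConvexPolygon n)

/-- A continuous function on a period, with equal end values, is induced by a continuous function on
the plane. -/
theorem exists_continuous_extension (c : ℝ) {f : ℝ → ℝ} (hf : Continuous f)
    (hc : f c = f (c + P.perimeter)) :
    ∃ g : C(Plane, ℝ), ∀ t ∈ Set.Icc c (c + P.perimeter), g (P.boundaryPoint t) = f t := by
  have hL := P.perimeter_pos
  let φ : Set.Icc c (c + P.perimeter) → P.bdry := fun t =>
    ⟨P.boundaryPoint t, P.boundaryPoint_mem_bdry t⟩
  have hφc : Continuous φ := (P.continuous_boundaryPoint.comp continuous_subtype_val).subtype_mk _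
  have hφs : Function.Surjective φ := by
    rintro ⟨x, hx⟩
    obtain ⟨t, h1, h2, h3⟩ := P.exists_boundaryPoint_eq hx c
    exact ⟨⟨t, h1, h2.le⟩, Subtype.ext h3⟩
  have hq : IsQuotientMap φ := hφc.isClosedMap.isQuotientMap hφc hφs
  choose lift hlift using hφs
  have hval : ∀ t, f (lift (φ t)) = f t := by
    have key : ∀ s t : Set.Icc c (c + P.perimeter), s.1 ≤ t.1 → φ s = φ t → f s = f t := by
      rintro ⟨s, hs, hs'⟩ ⟨t, ht, ht'⟩ hst h
      have h1 : P.boundaryPoint s = P.boundaryPoint t := congrArg Subtype.val h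
      simp only at hst ⊢
      by_cases hlt : t - s < P.perimeter
      · rw [P.eq_of_boundaryPoint_eq h1 (by rw [abs_lt]; constructor <;> linarith)]
      · rw [show s = c by linarith, show t = c + P.perimeter by linarith, hc]
    intro t
    rcases le_total (lift (φ t)).1 t.1 with h | h
    · exact key _ _ h (hlift _)
    · exact (key _ _ h (hlift _).symm).symm
  have hcont : Continuous fun x => f (lift x) := by
    rw [hq.continuous_iff]
    have : ((fun x => f (lift x)) ∘ φ) = fun t : Set.Icc c (c + P.perimeter) => f t := funext hval
    rw [this]
    exact hf.comp continuous_subtype_val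
  -- Tietze extension from the compact boundary to the plane.
  obtain ⟨g, hg⟩ := ContinuousMap.exists_restrict_eq P.isCompact_bdry.isClosed
    (⟨fun x => f (lift x), hcont⟩ : C(P.bdry, ℝ))
  refine ⟨g, fun t ht => ?_⟩
  have := congrArg (fun F : C(P.bdry, ℝ) => F (φ ⟨t, ht⟩)) hg
  simp only [ContinuousMap.restrict_apply, ContinuousMap.coe_mk] at this
  exact this.trans (hval ⟨t, ht⟩)

end ConvexPolygon

namespace Gluing
variable {n : ℕ} {P : ConvexPolygon n} {G : Gluing P}

/-- Were the partner `y` this close to `x`, the parameter `x + e = y - e` would be interior both to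
arc `k` and to its partner, whichever way they are glued. -/
theorem InArc.not_overlap {k : Fin G.m} {t x y e : ℝ} (h : G.InArc k t x)
    (hy : P.boundaryPoint y = P.boundaryPoint (G.img k t)) (he : |e| < t) (he' : |e| < G.len k - t)
    (h2 : y - x = 2 * e) : False := by
  rw [abs_lt] at he he'
  have h1 := h.add (s := e) (by linarith) (by linarith)
  obtain ⟨u, hu1, -, hu3, hu4, hu5⟩ := G.img_offset (k := k) (t := t)
  obtain ⟨hu6, hu7⟩ := hu3 h.1 h.2.1
  have h3 : G.InArc (G.partner k) u y := ⟨hu6, by rwa [G.len_partner], by rw [hy, hu1]⟩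
  have h4 := h3.add (s := -e) (by rw [hu4]; split_ifs <;> linarith)
    (by rw [hu4, G.len_partner]; split_ifs <;> linarith)
  rw [show y + -e = x + e by linarith] at h4
  exact G.partner_ne k (h1.unique h4).1.symm


/-- Along the boundary the map runs down a meridian in the collar of `x`, rests at the south pole up
to the collar of `y`, runs back to the north pole there, and rests until `x` returns. The way back
uses the same meridian if the arcs are glued in reversed direction, so partners get equal values,
and the opposite one otherwise, so partners get antipodal values. All other boundary points go to a
pole, so gluing is respected up to sign. The map detects both orientation (last clause) and
separation by the pair `x`, `y` (the two clauses on poles). -/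
theorem collar_map {k : Fin G.m} {t x y e : ℝ} (h : G.InArc k t x)
    (hy : P.boundaryPoint y = P.boundaryPoint (G.img k t)) (hxy : x < y)
    (hyx : y < x + P.perimeter) (he0 : 0 < e) (he : e < t) (he' : e < G.len k - t) :
    ∃ F : Plane → UnitSphere, Continuous F ∧
      (∀ a b, G.setoid a b → F a = F b ∨ F a = -F b) ∧
      (∀ s, x + e ≤ s → s ≤ y - e → F (P.boundaryPoint s) = -polar 0 0) ∧
      (∀ s, y + e ≤ s → s ≤ x + P.perimeter - e → F (P.boundaryPoint s) = polar 0 0) ∧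
      (G.reversed k = false → F (P.boundaryPoint x) = -F (P.boundaryPoint y)) := by
  have hpi := Real.pi_pos
  have hgap1 : x + e < y - e := by
    by_contra hlt
    have h0 : |(y - x) / 2| ≤ e := by rw [abs_le]; constructor <;> linarith
    exact h.not_overlap hy (lt_of_le_of_lt h0 he) (lt_of_le_of_lt h0 he') (by ring)
  have hgap2 : y + e < x + P.perimeter - e := by
    by_contra hlt
    have h0 : |(y - (x + P.perimeter)) / 2| ≤ e := by rw [abs_le]; constructor <;> linarith
    exact (h.congr (P.boundaryPoint_add_perimeter x)).not_overlap hy (lt_of_le_of_lt h0 he)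
      (lt_of_le_of_lt h0 he') (by ring)
  obtain ⟨L, hL⟩ : ∃ L, L = P.perimeter := ⟨_, rfl⟩
  rw [← hL] at hgap2 ⊢
  -- the polar angle
  let fu : ℝ → ℝ := fun s => Real.pi *
    (clamp ((s - (x - e)) / (2 * e)) - clamp ((s - (y - e)) / (2 * e)))
  have hfu : Continuous fu := by
    have := continuous_clamp
    fun_prop
  obtain ⟨hb, hbdef⟩ : ∃ hb : ℝ, hb = if G.reversed k then 0 else 1 := ⟨_, rfl⟩
  -- The azimuth changes only while the map rests at a pole, where it has no effect; this keeps it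
  -- continuous and periodic.
  let fh : ℝ → ℝ := fun s => hb * (Real.pi *
    (clamp ((s - (x + e)) / (y - e - (x + e))) -
      clamp ((s - (y + e)) / (x + L - e - (y + e)))))
  have hfh : Continuous fh := by
    have := continuous_clamp
    fun_prop
  have div1 : ∀ {a b : ℝ}, 0 < b → b ≤ a → 1 ≤ a / b := fun hb h => (one_le_div hb).2 h
  have div0 : ∀ {a b : ℝ}, 0 < b → a ≤ 0 → a / b ≤ 0 := fun hb h =>
    div_nonpos_of_nonpos_of_nonneg h hb.le
  have e2 : 0 < 2 * e := by linarith
  have d1 : 0 < y - e - (x + e) := by linarith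
  have d2 : 0 < x + L - e - (y + e) := by linarith
  -- values of the polar angle
  have fu1 : ∀ s, x - e ≤ s → s ≤ x + e → fu s = Real.pi * ((s - (x - e)) / (2 * e)) := by
    intro s h1 h2
    simp only [fu]
    rw [clamp_of_mem (div_nonneg (by linarith) e2.le) ((div_le_one e2).2 (by linarith)),
      clamp_of_nonpos (div0 e2 (by linarith)), sub_zero]
  have fu2 : ∀ s, x + e ≤ s → s ≤ y - e → fu s = Real.pi := by
    intro s h1 h2
    simp only [fu]
    rw [clamp_of_one_le (div1 e2 (by linarith)), clamp_of_nonpos (div0 e2 (by linarith)), sub_zero,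
      mul_one]
  have fu3 : ∀ s, y - e ≤ s → s ≤ y + e → fu s = Real.pi - Real.pi * ((s - (y - e)) / (2 * e)) := by
    intro s h1 h2
    simp only [fu]
    rw [clamp_of_one_le (div1 e2 (by linarith)), clamp_of_mem (div_nonneg (by linarith) e2.le)
      ((div_le_one e2).2 (by linarith))]
    ring
  have fu4 : ∀ s, y + e ≤ s → fu s = 0 := by
    intro s h1
    simp only [fu]
    rw [clamp_of_one_le (div1 e2 (by linarith)), clamp_of_one_le (div1 e2 (by linarith))]
    ring
  have fh1 : ∀ s, s ≤ x + e → fh s = 0 := by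
    intro s h1
    simp only [fh]
    rw [clamp_of_nonpos (div0 d1 (by linarith)), clamp_of_nonpos (div0 d2 (by linarith))]
    ring
  have fh2 : ∀ s, y - e ≤ s → s ≤ y + e → fh s = hb * Real.pi := by
    intro s h1 h2
    simp only [fh]
    rw [clamp_of_one_le (div1 d1 (by linarith)), clamp_of_nonpos (div0 d2 (by linarith))]
    ring
  have fh3 : ∀ s, x + L - e ≤ s → fh s = 0 := by
    intro s h1
    simp only [fh]
    rw [clamp_of_one_le (div1 d1 (by linarith)), clamp_of_one_le (div1 d2 (by linarith))]
    ring
  have hu0 : fu (x - e) = fu (x - e + P.perimeter) := by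
    rw [← hL, fu1 _ le_rfl (by linarith), fu4 _ (by linarith), sub_self, zero_div, mul_zero]
  have hh0 : fh (x - e) = fh (x - e + P.perimeter) := by
    rw [← hL, fh1 _ (by linarith), fh3 _ (by linarith)]
  clear_value fu fh
  have hgu := P.exists_continuous_extension (x - e) hfu hu0
  have hgh := P.exists_continuous_extension (x - e) hfh hh0
  rw [← hL] at hgu hgh
  obtain ⟨gu, hgu⟩ := hgu
  obtain ⟨gh, hgh⟩ := hgh
  obtain ⟨F, hFc, hF⟩ : ∃ F : Plane → UnitSphere, Continuous F ∧ ∀ z, F z = polar (gu z) (gh z) :=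
    ⟨_, continuous_polar.comp (gu.continuous.prodMk gh.continuous), fun _ => rfl⟩
  have hFx : ∀ s, |s| ≤ e → F (P.boundaryPoint (x + s)) =
      polar (Real.pi * ((s + e) / (2 * e))) 0 := by
    intro s hs
    rw [abs_le] at hs
    rw [hF, hgu _ ⟨by linarith, by linarith⟩, hgh _ ⟨by linarith, by linarith⟩,
      fu1 _ (by linarith) (by linarith), fh1 _ (by linarith)]
    congr 3; ring
  have hFy : ∀ s, |s| ≤ e → F (P.boundaryPoint (y + s)) =
      polar (Real.pi - Real.pi * ((s + e) / (2 * e))) (hb * Real.pi) := by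
    intro s hs
    rw [abs_le] at hs
    rw [hF, hgu _ ⟨by linarith, by linarith⟩, hgh _ ⟨by linarith, by linarith⟩,
      fu3 _ (by linarith) (by linarith), fh2 _ (by linarith) (by linarith)]
    congr 4; ring
  have hF2 : ∀ s, x + e ≤ s → s ≤ y - e → F (P.boundaryPoint s) = -polar 0 0 := by
    intro s h1 h2
    rw [hF, hgu _ ⟨by linarith, by linarith⟩, fu2 s h1 h2]
    exact polar_pi _ _
  have hF4 : ∀ s, y + e ≤ s → s ≤ x + L - e → F (P.boundaryPoint s) = polar 0 0 := by
    intro s h1 h2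
    rw [hF, hgu _ ⟨by linarith, by linarith⟩, fu4 s h1]
    exact polar_zero _ _
  clear hgu hgh fu1 fu2 fu3 fu4 fh1 fh2 fh3
  -- partners inside the collar
  have hsign : ∀ s, |s| ≤ e → G.reversed k = false →
      F (P.boundaryPoint (x + s)) = -F (P.boundaryPoint (y + s)) := by
    intro s hs hr
    rw [hFx s hs, hFy s hs, show hb * Real.pi = Real.pi by simp [hbdef, hr], polar_pi_sub, neg_neg]
  have hsame : ∀ s, |s| ≤ e → G.reversed k = true →
      F (P.boundaryPoint (x + s)) = F (P.boundaryPoint (y - s)) := by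
    intro s hs hr
    rw [hFx s hs, sub_eq_add_neg, hFy (-s) (by rwa [abs_neg]), show hb * Real.pi = 0 by
      simp [hbdef, hr]]
    congr 1
    field_simp
    ring
  obtain ⟨j, hj⟩ := P.boundaryPoint_eq_iff.1 hy
  have himg : ∀ s, P.boundaryPoint (G.img k (t + s)) =
      P.boundaryPoint (if G.reversed k then y - s else y + s) := by
    intro s
    rw [P.boundaryPoint_eq_iff]
    refine ⟨-j, ?_⟩
    simp only [Gluing.img] at hj ⊢
    push_cast
    split_ifs at hj ⊢ <;> linarith
  have hin : ∀ s, |s| ≤ e → G.InArc k (t + s) (x + s) := by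
    intro s hs
    rw [abs_le] at hs
    exact h.add (by linarith) (by linarith)
  -- points outside of the collar
  have houtside : ∀ z ∈ P.bdry, (∃ s, |s| ≤ e ∧ z = P.boundaryPoint (x + s)) ∨
      (∃ s, |s| ≤ e ∧ z = P.boundaryPoint (y + s)) ∨ F z = polar 0 0 ∨ F z = -polar 0 0 := by
    intro z hz
    obtain ⟨s, hs1, hs2, rfl⟩ := P.exists_boundaryPoint_eq hz (x - e)
    by_cases c1 : s ≤ x + e
    · left; exact ⟨s - x, by rw [abs_le]; constructor <;> linarith, by rw [add_sub_cancel]⟩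
    by_cases c2 : s ≤ y - e
    · right; right; right; exact hF2 s (by linarith) c2
    by_cases c3 : s ≤ y + e
    · right; left; exact ⟨s - y, by rw [abs_le]; constructor <;> linarith, by rw [add_sub_cancel]⟩
    · right; right; left; exact hF4 s (by linarith) (by linarith)
  have hcollar : ∀ s, |s| ≤ e → ∀ z w, (z = P.boundaryPoint (x + s) ∨
      z = P.boundaryPoint (if G.reversed k then y - s else y + s)) → (w = P.boundaryPoint (x + s) ∨
      w = P.boundaryPoint (if G.reversed k then y - s else y + s)) → F z = F w ∨ F z = -F w := by
    intro s hs z w hz hw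
    cases hr : G.reversed k
    · have := hsign s hs hr
      simp only [hr, Bool.false_eq_true, if_false] at hz hw
      rcases hz with rfl | rfl <;> rcases hw with rfl | rfl
      · exact Or.inl rfl
      · exact Or.inr this
      · exact Or.inr (by rw [this, neg_neg])
      · exact Or.inl rfl
    · have := hsame s hs hr
      simp only [hr, if_true] at hz hw
      rcases hz with rfl | rfl <;> rcases hw with rfl | rfl
      · exact Or.inl rfl
      · exact Or.inl this
      · exact Or.inl this.symm
      · exact Or.inl rfl
  have hclass : ∀ s, |s| ≤ e → ∀ z w, (z = P.boundaryPoint (x + s) ∨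
      z = P.boundaryPoint (if G.reversed k then y - s else y + s)) → G.setoid z w →
      (w = P.boundaryPoint (x + s) ∨
      w = P.boundaryPoint (if G.reversed k then y - s else y + s)) := by
    intro s hs z w hz hzw
    have hrel : G.setoid (P.boundaryPoint (x + s)) w := by
      rcases hz with rfl | rfl
      · exact hzw
      · refine G.setoid.trans ?_ hzw
        rw [← himg, (hin s hs).2.2]
        exact Rel.of_glued (hin s hs).1.le (hin s hs).2.1.le
    have := (hin s hs).eq_or_eq_of_setoid hrel
    rwa [himg] at this
  have hpair : ∀ z w, G.setoid z w → ((∃ s, |s| ≤ e ∧ z = P.boundaryPoint (x + s)) ∨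
      (∃ s, |s| ≤ e ∧ z = P.boundaryPoint (y + s))) → F z = F w ∨ F z = -F w := by
    rintro z w hzw (⟨s, hs, rfl⟩ | ⟨s, hs, rfl⟩)
    · exact hcollar s hs _ _ (Or.inl rfl) (hclass s hs _ w (Or.inl rfl) hzw)
    · cases hr : G.reversed k
      · have hz : P.boundaryPoint (y + s) =
          P.boundaryPoint (if G.reversed k then y - s else y + s) := by simp [hr]
        exact hcollar s hs _ _ (Or.inr hz) (hclass s hs _ w (Or.inr hz) hzw)
      · have hz : P.boundaryPoint (y + s) =
          P.boundaryPoint (if G.reversed k then y - -s else y + -s) := by simp [hr]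
        have hs' : |-s| ≤ e := by rwa [abs_neg]
        exact hcollar (-s) hs' _ _ (Or.inr hz) (hclass (-s) hs' _ w (Or.inr hz) hzw)
  refine ⟨F, hFc, ?_, hF2, hF4, ?_⟩
  · intro a b hab
    by_cases ha : a ∈ P.bdry
    · have hb := (mem_bdry_iff_of_setoid hab).1 ha
      rcases houtside a ha with h1 | h1 | h1
      · exact hpair a b hab (Or.inl h1)
      · exact hpair a b hab (Or.inr h1)
      rcases houtside b hb with h2 | h2 | h2
      · rcases hpair b a (G.setoid.symm hab) (Or.inl h2) with h3 | h3
        · exact Or.inl h3.symm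
        · exact Or.inr (by rw [h3, neg_neg])
      · rcases hpair b a (G.setoid.symm hab) (Or.inr h2) with h3 | h3
        · exact Or.inl h3.symm
        · exact Or.inr (by rw [h3, neg_neg])
      · rcases h1 with h1 | h1 <;> rcases h2 with h2 | h2 <;> rw [h1, h2] <;> simp
    · rw [eq_of_setoid_of_notMem hab ha]
      exact Or.inl rfl
  · intro hr
    simpa using hsign 0 (by simpa using he0.le) hr

/-- In a gluing to a sphere, sphere-valued functions respecting the gluing up to sign
respect the gluing. -/
theorem IsAleksandrov.eq_of_setoid (hG : G.IsAleksandrov) {F : Plane → UnitSphere}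
    (hF : Continuous F) (h : ∀ a b, G.setoid a b → F a = F b ∨ F a = -F b) {a b : Plane}
    (ha : a ∈ P.bdry) (hab : G.setoid a b) : F a = F b := by
  obtain ⟨e⟩ := hG.sphere
  have hb := (mem_bdry_iff_of_setoid hab).1 ha
  have : PreconnectedSpace P.region :=
    isPreconnected_iff_preconnectedSpace.1 (convex_convexHull ℝ _).isPreconnected
  refine eq_of_eq_or_neg_on_fibres (K := P.region) e isQuotientMap_quotient_mk'
    (F := fun z => F z) (hF.comp continuous_subtype_val) ?_
    (x := ⟨a, P.bdry_subset_region ha⟩) (y := ⟨b, P.bdry_subset_region hb⟩) ?_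
  · intro x y hxy
    exact h x y (Quotient.exact (s := Setoid.comap (Subtype.val : P.region → Plane) G.setoid) hxy)
  · exact Quotient.sound hab

theorem neg_ne_self (x : UnitSphere) : -x ≠ x := fun h => ne_neg_of_mem_unit_sphere ℝ x h.symm

theorem InArc.rel_img {k : Fin G.m} {t x : ℝ} (h : G.InArc k t x) : G.Rel x (G.img k t) :=
  (Rel.of_eq h.2.2).trans (Rel.of_glued h.1.le h.2.1.le)

/-- An arc glued in the same direction contains a Möbius band. Concretely, the collar map at its
midpoint takes antipodal values at two glued points, contradicting `IsAleksandrov.eq_of_setoid`. -/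
theorem IsAleksandrov.reversed (hG : G.IsAleksandrov) (k : Fin G.m) : G.reversed k = true := by
  by_contra hr
  rw [Bool.not_eq_true] at hr
  have hk := G.len_pos k
  have h : G.InArc k (G.len k / 2) (G.start k + G.len k / 2) := ⟨by linarith, by linarith, rfl⟩
  set x := G.start k + G.len k / 2
  obtain ⟨j, hj1, hj2⟩ := P.exists_add_int_mul_mem x (G.img k (G.len k / 2))
  set y := G.img k (G.len k / 2) + j * P.perimeter
  have hy : P.boundaryPoint y = P.boundaryPoint (G.img k (G.len k / 2)) :=
    P.boundaryPoint_add_int_mul _ _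
  have hxy : x < y := by
    refine lt_of_le_of_ne hj1 fun hxy => h.not_overlap (e := 0) hy ?_ ?_ ?_
    · simpa using hk
    · simpa using by linarith
    · rw [hxy]; ring
  obtain ⟨F, hF, h1, -, -, h2⟩ := collar_map h hy hxy hj2 (e := G.len k / 4) (by linarith)
    (by linarith) (by linarith)
  have h3 := hG.eq_of_setoid hF h1 (P.boundaryPoint_mem_bdry x)
    (h.rel_img.trans (Rel.of_eq hy.symm))
  rw [h3] at h2
  exact neg_ne_self _ (h2 hr).symm

/-- No glued pair of points separates two points which are glued together in the interior
of arcs. -/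
theorem InArc.not_cross {k : Fin G.m} {t x y z w : ℝ} (h : G.InArc k t x) (hG : G.IsAleksandrov)
    (hR : G.Rel x y) (hxz : x < z) (hzy : z < y) (hyw : y < w) (hwx : w < x + P.perimeter) :
    ¬ G.Rel z w := by
  intro hzw
  have hxy : P.boundaryPoint y ≠ P.boundaryPoint x := fun hxy => by
    have := P.eq_of_boundaryPoint_eq hxy (by rw [abs_lt]; constructor <;> linarith)
    linarith
  have hy := (h.eq_or_eq_of_setoid hR).resolve_left hxy
  -- Half the minimum of all gaps, so that `z` and `w` stay outside both collars and are sent to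
  -- opposite poles.
  let e := min (min t (G.len k - t)) (min (min (z - x) (y - z))
    (min (w - y) (x + P.perimeter - w))) / 2
  have hpos : 0 < min (min t (G.len k - t)) (min (min (z - x) (y - z))
    (min (w - y) (x + P.perimeter - w))) := by
    have := h.1
    have := h.2.1
    refine lt_min (lt_min ?_ ?_) (lt_min (lt_min ?_ ?_) (lt_min ?_ ?_)) <;> linarith
  have he0 : 0 < e := by simp only [e]; linarith
  have hmin : ∀ r, min (min t (G.len k - t)) (min (min (z - x) (y - z))
    (min (w - y) (x + P.perimeter - w))) ≤ r → e < r := fun r hr => by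
      simp only [e]; linarith
  have b1 : e < t := hmin _ (by simp)
  have b2 : e < G.len k - t := hmin _ (by simp)
  have b3 : e < z - x := hmin _ (by simp)
  have b4 : e < y - z := hmin _ (by simp)
  have b5 : e < w - y := hmin _ (by simp)
  have b6 : e < x + P.perimeter - w := hmin _ (by simp)
  obtain ⟨F, hF, h1, h2, h3, -⟩ := collar_map h hy (by linarith) (by linarith) he0 b1 b2
  have h4 := hG.eq_of_setoid hF h1 (P.boundaryPoint_mem_bdry z) hzw
  rw [h2 z (by linarith) (by linarith), h3 w (by linarith) (by linarith)] at h4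
  exact neg_ne_self _ h4

end Gluing
end PolygonFolding
end

/-! ### Zipping, folds, leaves and triples -/

noncomputable section
namespace PolygonFolding
namespace Gluing
variable {n : ℕ} {P : ConvexPolygon n} {G : Gluing P}

variable (G) in
/-- The parameter lies in the interior of some arc. -/
def Interior (x : ℝ) : Prop := ∃ k t, G.InArc k t x

variable (G) in
/-- The parameter is glued to no other boundary point. -/
def Leaf (x : ℝ) : Prop := ∀ y, G.Rel x y → P.boundaryPoint y = P.boundaryPoint x

theorem Interior.not_cross {x y z w : ℝ} (h : G.Interior x) (hG : G.IsAleksandrov)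
    (hR : G.Rel x y) (hxz : x < z) (hzy : z < y) (hyw : y < w) (hwx : w < x + P.perimeter) :
    ¬ G.Rel z w := by
  obtain ⟨k, t, h⟩ := h
  exact h.not_cross hG hR hxz hzy hyw hwx

theorem exists_start_eq {x : ℝ} (h : ¬ G.Interior x) :
    ∃ k, P.boundaryPoint x = P.boundaryPoint (G.start k) := by
  obtain ⟨k, t, h0, h1, h2⟩ := G.exists_arc_right x
  rcases h0.eq_or_lt with rfl | h0
  · exact ⟨k, by simpa using h2⟩
  · exact absurd ⟨k, t, h0, h1, h2⟩ h

theorem Interior.eq_of_rel {x y z : ℝ} (h : G.Interior x) (hy : G.Rel x y) (hz : G.Rel x z)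
    (hyx : P.boundaryPoint y ≠ P.boundaryPoint x) (hzx : P.boundaryPoint z ≠ P.boundaryPoint x) :
    P.boundaryPoint y = P.boundaryPoint z := by
  obtain ⟨k, t, h⟩ := h
  rw [(h.eq_or_eq_of_setoid hy).resolve_left hyx, (h.eq_or_eq_of_setoid hz).resolve_left hzx]

/-- Glued pairs of points do not cross unless all four points are glued together. -/
theorem IsAleksandrov.noncrossing (hG : G.IsAleksandrov) {x z y w : ℝ} (hxz : x < z) (hzy : z < y)
    (hyw : y < w) (hwx : w < x + P.perimeter) (hxy : G.Rel x y) (hzw : G.Rel z w) :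
    G.Rel x z := by
  by_contra hne
  -- If `x` and `z` are not glued, `A` is still a union of classes containing `y` and hence `x`,
  -- which is absurd. A direct identification leaving `A` joins the two sides of the pair `z`, `w`;
  -- it can be nudged into the interior of arcs, where `InArc.not_cross` applies.
  let A : Set Plane := {p | p ∈ P.boundaryPoint '' Set.Ioo z w ∨ G.setoid p (P.boundaryPoint z)}
  have claim : ∀ α β, z < α → α < w → w < β → β < z + P.perimeter → G.Interior α →
      ¬ G.Rel α β := by
    intro α β h1 h2 h3 h4 h5 h6
    exact h5.not_cross hG h6 h2 h3 h4 (by linarith) (hzw.symm.trans (rel_add_perimeter z))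
  have small : ∀ k t, 0 ≤ t → t ≤ G.len k → ∀ b > 0, ∃ e, |e| < b ∧ 0 < t + e ∧ t + e < G.len k := by
    intro k t h0 h1 b hb
    have hk := G.len_pos k
    have hm : 0 < min b (G.len k) := lt_min hb hk
    have hm1 := min_le_left b (G.len k)
    have hm2 := min_le_right b (G.len k)
    by_cases ht : t ≤ G.len k / 2
    · exact ⟨min b (G.len k) / 4, by rw [abs_of_pos (by linarith)]; linarith, by linarith,
        by linarith⟩
    · exact ⟨-(min b (G.len k) / 4), by rw [abs_neg, abs_of_pos (by linarith)]; linarith,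
        by linarith, by linarith⟩
  have step : ∀ k t α β, 0 ≤ t → t ≤ G.len k → w < β → β < z + P.perimeter → z < α → α < w →
      ((P.boundaryPoint α = P.boundaryPoint (G.start k + t) ∧
        P.boundaryPoint β = P.boundaryPoint (G.img k t)) ∨
      (P.boundaryPoint β = P.boundaryPoint (G.start k + t) ∧
        P.boundaryPoint α = P.boundaryPoint (G.img k t))) → False := by
    intro k t α β h0 h1 h2 h3 h4 h5 h6
    obtain ⟨e, he, he0, he1⟩ := small k t h0 h1
      (min (min (β - w) (z + P.perimeter - β)) (min (α - z) (w - α)))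
      (lt_min (lt_min (by linarith) (by linarith)) (lt_min (by linarith) (by linarith)))
    simp only [lt_min_iff, abs_lt] at he
    have hin : G.InArc k (t + e) (G.start k + (t + e)) := ⟨he0, he1, rfl⟩
    have himg : G.img k (t + e) = G.img k t - e := by
      simp only [Gluing.img, hG.reversed k, if_true]; ring
    rcases h6 with ⟨h6, h7⟩ | ⟨h6, h7⟩
    · obtain ⟨j, hj⟩ := P.boundaryPoint_eq_iff.1 h6
      obtain ⟨i, hi⟩ := P.boundaryPoint_eq_iff.1 h7
      have e1 : P.boundaryPoint (α + e) = P.boundaryPoint (G.start k + (t + e)) :=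
        P.boundaryPoint_eq_iff.2 ⟨j, by linarith⟩
      have e2 : P.boundaryPoint (β - e) = P.boundaryPoint (G.img k (t + e)) :=
        P.boundaryPoint_eq_iff.2 ⟨i, by linarith⟩
      exact claim (α + e) (β - e) (by linarith) (by linarith) (by linarith) (by linarith)
        ⟨k, t + e, hin.congr e1⟩ ((Rel.of_eq e1).trans (hin.rel_img.trans (Rel.of_eq e2.symm)))
    · obtain ⟨j, hj⟩ := P.boundaryPoint_eq_iff.1 h6
      obtain ⟨i, hi⟩ := P.boundaryPoint_eq_iff.1 h7
      have e1 : P.boundaryPoint (β + e) = P.boundaryPoint (G.start k + (t + e)) :=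
        P.boundaryPoint_eq_iff.2 ⟨j, by linarith⟩
      have e2 : P.boundaryPoint (α - e) = P.boundaryPoint (G.img k (t + e)) :=
        P.boundaryPoint_eq_iff.2 ⟨i, by linarith⟩
      exact claim (α - e) (β + e) (by linarith) (by linarith) (by linarith) (by linarith)
        ⟨_, _, hin.img.congr e2⟩
        ((Rel.of_eq e2).trans (hin.rel_img.symm.trans (Rel.of_eq e1.symm)))
  have locate : ∀ p ∈ P.bdry, ¬ G.setoid p (P.boundaryPoint z) → p ∉ P.boundaryPoint '' Set.Ioo z w →
      ∃ β, w < β ∧ β < z + P.perimeter ∧ p = P.boundaryPoint β := by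
    intro p hp h1 h2
    obtain ⟨β, hb1, hb2, rfl⟩ := P.exists_boundaryPoint_eq hp z
    refine ⟨β, ?_, hb2, rfl⟩
    by_contra hlt
    push Not at hlt
    rcases hb1.eq_or_lt with rfl | hb1
    · exact h1 (G.setoid.refl _)
    rcases hlt.eq_or_lt with rfl | hlt
    · exact h1 hzw.symm
    · exact h2 ⟨β, ⟨hb1, hlt⟩, rfl⟩
  have inv : ∀ a b, G.Glued a b → (a ∈ A ↔ b ∈ A) := by
    rintro a b ⟨k, t, ⟨h0, h1⟩, rfl, rfl⟩
    have hab : G.setoid (P.boundaryPoint (G.start k + t)) (P.boundaryPoint (G.img k t)) :=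
      Rel.of_glued h0 h1
    change _ ↔ P.boundaryPoint (G.img k t) ∈ A
    by_cases hz : G.setoid (P.boundaryPoint (G.start k + t)) (P.boundaryPoint z)
    · exact iff_of_true (Or.inr hz) (Or.inr (G.setoid.trans (G.setoid.symm hab) hz))
    have hz' : ¬ G.setoid (P.boundaryPoint (G.img k t)) (P.boundaryPoint z) :=
      fun h => hz (G.setoid.trans hab h)
    constructor
    · rintro (⟨α, hα, hα'⟩ | h)
      · by_contra hb
        obtain ⟨β, hb1, hb2, hb3⟩ := locate _ (P.boundaryPoint_mem_bdry _) hz'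
          (fun h => hb (Or.inl h))
        exact step k t α β h0 h1 hb1 hb2 hα.1 hα.2 (Or.inl ⟨hα', hb3.symm⟩)
      · exact absurd h hz
    · rintro (⟨α, hα, hα'⟩ | h)
      · by_contra hb
        obtain ⟨β, hb1, hb2, hb3⟩ := locate _ (P.boundaryPoint_mem_bdry _) hz
          (fun h => hb (Or.inl h))
        exact step k t α β h0 h1 hb1 hb2 hα.1 hα.2 (Or.inr ⟨hb3.symm, hα'⟩)
      · exact absurd h hz'
  rcases (setoid_invariant inv hxy).2 (Or.inl ⟨y, ⟨hzy, hyw⟩, rfl⟩) with ⟨s, hs, hs'⟩ | h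
  · have := P.eq_of_boundaryPoint_eq hs' (by rw [abs_lt]; constructor <;> linarith [hs.1, hs.2])
    linarith [hs.1]
  · exact hne h

/-- To the right of each parameter the boundary is zipped with the boundary to the left of some
parameter, up to an end of an arc. -/
theorem IsAleksandrov.exists_zip (hG : G.IsAleksandrov) (a : ℝ) :
    ∃ δ > 0, ∃ a', a < a' ∧ a' ≤ a + P.perimeter ∧
      (∀ s, 0 ≤ s → s ≤ δ → G.Rel (a + s) (a' - s)) ∧ ¬ G.Interior (a + δ) ∧
      ∀ s, 0 < s → s < δ → G.Interior (a + s) ∧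
        P.boundaryPoint (a + s) ≠ P.boundaryPoint (a' - s) := by
  obtain ⟨k, t, h0, h1, h2⟩ := G.exists_arc_right a
  -- Reducing the negative puts the lift `a'` in `(a, a + perimeter]` instead of the other half-open
  -- interval, so a fold at `a` itself appears as `a' = a + perimeter`.
  obtain ⟨j, hj1, hj2⟩ := P.exists_add_int_mul_mem (-(a + P.perimeter)) (-(G.img k t))
  obtain ⟨i, hi⟩ := P.boundaryPoint_eq_iff.1 h2
  have hstart : ∀ s, P.boundaryPoint (a + s) = P.boundaryPoint (G.start k + (t + s)) := fun s =>
    P.boundaryPoint_eq_iff.2 ⟨i, by linarith⟩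
  have himg : ∀ s, P.boundaryPoint (G.img k t - j * P.perimeter - s) =
      P.boundaryPoint (G.img k (t + s)) := fun s =>
    P.boundaryPoint_eq_iff.2 ⟨j, by
      simp only [Gluing.img, hG.reversed k, if_true]; ring⟩
  refine ⟨G.len k - t, by linarith, G.img k t - j * P.perimeter, by linarith, by linarith, ?_, ?_,
    ?_⟩
  · intro s hs0 hs1
    exact (Rel.of_eq (hstart s)).trans
      ((Rel.of_glued (by linarith) (by linarith)).trans (Rel.of_eq (himg s).symm))
  · rintro ⟨l, r, hr⟩
    obtain ⟨rfl, h4⟩ := hr.unique_closed (l := k) (t := G.len k) (G.len_pos k).le le_rfl (by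
      rw [hstart]; congr 1; ring)
    exact hr.2.1.ne h4
  · intro s hs0 hs1
    have hin : G.InArc k (t + s) (a + s) := ⟨by linarith, by linarith, hstart s⟩
    refine ⟨⟨k, t + s, hin⟩, fun heq => hin.not_overlap (e := 0) (heq.trans (himg s)) ?_ ?_ ?_⟩
    · rw [abs_zero]; exact hin.1
    · rw [abs_zero]; linarith
    · ring

theorem finite_ends (a b : ℝ) (hab : b ≤ a + P.perimeter) :
    {x ∈ Set.Ioo a b | ¬ G.Interior x}.Finite := by
  refine Set.Finite.of_finite_image (f := P.boundaryPoint) ?_ ?_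
  · refine (Set.finite_range fun k => P.boundaryPoint (G.start k)).subset ?_
    rintro _ ⟨x, ⟨-, hx⟩, rfl⟩
    obtain ⟨k, hk⟩ := exists_start_eq hx
    exact ⟨k, hk.symm⟩
  · intro x hx y hy hxy
    exact P.eq_of_boundaryPoint_eq hxy (by
      rw [abs_lt]; constructor <;> linarith [hx.1.1, hx.1.2, hy.1.1, hy.1.2])

/-- The number of arc ends strictly inside an interval is the induction measure below; it drops when
a subinterval no longer has the end `e` in its interior. -/
theorem ncard_ends_lt {a b c d e : ℝ} (hab : b ≤ a + P.perimeter) (hac : a ≤ c) (hdb : d ≤ b)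
    (he : ¬ G.Interior e) (hae : a < e) (heb : e < b) (hcde : e ≤ c ∨ d ≤ e) :
    {x ∈ Set.Ioo c d | ¬ G.Interior x}.ncard < {x ∈ Set.Ioo a b | ¬ G.Interior x}.ncard := by
  refine Set.ncard_lt_ncard ⟨?_, fun h => ?_⟩ (finite_ends a b hab)
  · rintro x ⟨⟨h1, h2⟩, h3⟩
    exact ⟨⟨by linarith, by linarith⟩, h3⟩
  · have := h (show e ∈ _ from ⟨⟨hae, heb⟩, he⟩)
    rcases hcde with h1 | h1
    · linarith [this.1.1]
    · linarith [this.1.2]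

/-- An arc with glued ends is folded at its midpoint unless it contains three points which are
glued together. -/
theorem IsAleksandrov.fold_or_triple (hG : G.IsAleksandrov) {a b : ℝ} (hab : a < b)
    (hba : b < a + P.perimeter) (hR : G.Rel a b) :
    (∀ s, 0 ≤ s → s ≤ b - a → G.Rel (a + s) (b - s)) ∨
    ∃ x y z, a ≤ x ∧ x < y ∧ y < z ∧ z ≤ b ∧ G.Rel x y ∧ G.Rel y z := by
  induction hN : {x ∈ Set.Ioo a b | ¬ G.Interior x}.ncard using Nat.strong_induction_on
    generalizing a b with
  | _ N ih =>
  subst hN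
  obtain ⟨δ, hδ, a', ha1, ha2, hzip, hend, hgerm⟩ := hG.exists_zip a
  have hRa : G.Rel a a' := by simpa using hzip 0 le_rfl hδ.le
  rcases lt_trichotomy b a' with h | h | h
  -- If the zipper at `a` leads beyond `b`, one of its pairs close to `a` crosses the pair `b`, `a +
  -- perimeter`.
  · exfalso
    let m := min (min δ (b - a)) (a' - b)
    have hm : 0 < m := lt_min (lt_min hδ (by linarith)) (by linarith)
    have h1 : m ≤ δ := (min_le_left _ _).trans (min_le_left _ _)
    have h2 : m ≤ b - a := (min_le_left _ _).trans (min_le_right _ _)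
    have h3 : m ≤ a' - b := min_le_right _ _
    exact (hgerm (m / 2) (by linarith) (by linarith)).1.not_cross hG
      (hzip (m / 2) (by linarith) (by linarith)) (z := b) (w := a + P.perimeter) (by linarith)
      (by linarith) (by linarith) (by linarith) (hR.symm.trans (rel_add_perimeter a))
  · subst h
    -- The two ends are zipped together up to `δ`: either an inner arc remains for induction, or the
    -- zipper closes exactly at the midpoint. Overshooting would glue an interior point of an arc to
    -- itself.
    rcases lt_trichotomy (a + δ) (b - δ) with h1 | h1 | h1
    · rcases ih _ (ncard_ends_lt (a := a) (b := b) (c := a + δ) (d := b - δ) hba.le (by linarith)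
        (by linarith) hend (by linarith) (by linarith) (Or.inl le_rfl)) h1 (by linarith)
        (hzip δ hδ.le le_rfl) rfl with h2 | ⟨x, y, z, h2, h3, h4, h5, h6⟩
      · left
        intro s hs0 hs1
        by_cases c1 : s ≤ δ
        · exact hzip s hs0 c1
        by_cases c2 : s ≤ b - a - δ
        · have := h2 (s - δ) (by linarith) (by linarith)
          rwa [show a + δ + (s - δ) = a + s by ring, show b - δ - (s - δ) = b - s by ring] at this
        · have := (hzip (b - a - s) (by linarith) (by linarith)).symm
          rwa [show b - (b - a - s) = a + s by ring, show a + (b - a - s) = b - s by ring] at this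
      · right
        exact ⟨x, y, z, by linarith, h3, h4, by linarith, h6⟩
    · left
      intro s hs0 hs1
      by_cases c1 : s ≤ δ
      · exact hzip s hs0 c1
      · have := (hzip (b - a - s) (by linarith) (by linarith)).symm
        rwa [show b - (b - a - s) = a + s by ring, show a + (b - a - s) = b - s by ring] at this
    · exfalso
      refine (hgerm ((b - a) / 2) (by linarith) (by linarith)).2 ?_
      congr 1
      ring
  · right
    exact ⟨a, a', b, le_rfl, ha1, h, le_rfl, hRa, hRa.symm.trans hR⟩

/-- Close to the fold, `m + r / 2` is glued to `m - r / 2`; this pair separates `m` from every other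
point `v` of the boundary, so `v` cannot be glued to `m`. -/
theorem IsAleksandrov.leaf_of_fold (hG : G.IsAleksandrov) {a b : ℝ} (hab : a < b)
    (hR : ∀ s, 0 ≤ s → s ≤ b - a → G.Rel (a + s) (b - s)) : G.Leaf ((a + b) / 2) := by
  intro w hw
  set m := (a + b) / 2 with hm
  obtain ⟨j, hj1, hj2⟩ := P.exists_add_int_mul_mem m w
  rw [← P.boundaryPoint_add_int_mul w j]
  have hw' : G.Rel m (w + j * P.perimeter) := hw.trans (Rel.of_eq (P.boundaryPoint_add_int_mul w j).symm)
  generalize w + j * P.perimeter = v at *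
  rcases hj1.eq_or_lt with h | h
  · rw [h]
  exfalso
  obtain ⟨δ, hδ, _, -, -, -, -, hgerm⟩ := hG.exists_zip m
  let r := min (min δ (b - a)) (min (v - m) (m + P.perimeter - v))
  have hr : 0 < r := lt_min (lt_min hδ (by linarith)) (lt_min (by linarith) (by linarith))
  have h1 : r ≤ δ := (min_le_left _ _).trans (min_le_left _ _)
  have h2 : r ≤ b - a := (min_le_left _ _).trans (min_le_right _ _)
  have h3 : r ≤ v - m := (min_le_right _ _).trans (min_le_left _ _)
  have h4 : r ≤ m + P.perimeter - v := (min_le_right _ _).trans (min_le_right _ _)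
  have h5 : G.Rel (m + r / 2) (m - r / 2 + P.perimeter) := by
    have := (hR ((b - a) / 2 - r / 2) (by linarith) (by linarith)).symm
    rw [show b - ((b - a) / 2 - r / 2) = m + r / 2 by rw [hm]; ring,
      show a + ((b - a) / 2 - r / 2) = m - r / 2 by rw [hm]; ring] at this
    exact this.trans (rel_add_perimeter _)
  exact (hgerm (r / 2) (by linarith) (by linarith)).1.not_cross hG h5 (z := v)
    (w := m + P.perimeter) (by linarith) (by linarith) (by linarith) (by linarith)
    (hw'.symm.trans (rel_add_perimeter m))

/-- The interior point of an arc has a single partner. The middle point of a triple is thus an arc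
end, which makes the induction in `exists_leaf` decrease. -/
theorem Interior.not_triple {x y z : ℝ} (h : G.Interior y) (hxy : x < y) (hyz : y < z)
    (hzx : z < x + P.perimeter) (h1 : G.Rel x y) (h2 : G.Rel y z) : False := by
  have ne : ∀ {u v : ℝ}, u < v → v < u + P.perimeter → P.boundaryPoint u ≠ P.boundaryPoint v := by
    intro u v huv hvu heq
    have := P.eq_of_boundaryPoint_eq heq (by rw [abs_lt]; constructor <;> linarith)
    linarith
  exact ne (u := x) (v := z) (by linarith) hzx (h.eq_of_rel h1.symm h2 (ne hxy (by linarith))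
    (ne hyz (by linarith)).symm)

/-- An open arc with glued ends contains a leaf. -/
theorem IsAleksandrov.exists_leaf (hG : G.IsAleksandrov) {a b : ℝ} (hab : a < b)
    (hba : b < a + P.perimeter) (hR : G.Rel a b) : ∃ x, a < x ∧ x < b ∧ G.Leaf x := by
  induction hN : {x ∈ Set.Ioo a b | ¬ G.Interior x}.ncard using Nat.strong_induction_on
    generalizing a b with
  | _ N ih =>
  subst hN
  rcases hG.fold_or_triple hab hba hR with h | ⟨x, y, z, h1, h2, h3, h4, h5, h6⟩
  · exact ⟨(a + b) / 2, by linarith, by linarith, hG.leaf_of_fold hab h⟩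
  · obtain ⟨u, hu1, hu2, hu3⟩ := ih _ (ncard_ends_lt (a := a) (b := b) (c := x) (d := y) (e := y)
      hba.le h1 (by linarith) (fun h => h.not_triple h2 h3 (by linarith) h5 h6) (by linarith)
      (by linarith) (Or.inr le_rfl)) h2 (by linarith) h5 rfl
    exact ⟨u, by linarith, by linarith, hu3⟩

end Gluing
end PolygonFolding
end

/-! ### Folding along one arc or three arcs -/

noncomputable section
namespace PolygonFolding

namespace ConvexPolygon
variable {n : ℕ} (P : ConvexPolygon n)

/-- The lifts of a single boundary point. -/
def pathSeq (m : ℝ) (j : ℤ) : ℝ := m + j * P.perimeter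

/-- The lifts of three boundary points. -/
def triSeq (p q r : ℝ) (j : ℤ) : ℝ :=
  (if j % 3 = 0 then p else if j % 3 = 1 then q else r) + (j / 3 : ℤ) * P.perimeter

theorem triSeq_zero (p q r : ℝ) (i : ℤ) : P.triSeq p q r (3 * i) = p + i * P.perimeter := by
  rw [triSeq, if_pos (by omega), show 3 * i / 3 = i by omega]

theorem triSeq_one (p q r : ℝ) (i : ℤ) : P.triSeq p q r (3 * i + 1) = q + i * P.perimeter := by
  rw [triSeq, if_neg (by omega), if_pos (by omega), show (3 * i + 1) / 3 = i by omega]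

theorem triSeq_two (p q r : ℝ) (i : ℤ) : P.triSeq p q r (3 * i + 2) = r + i * P.perimeter := by
  rw [triSeq, if_neg (by omega), if_neg (by omega), show (3 * i + 2) / 3 = i by omega]

theorem triSeq_three (p q r : ℝ) (i : ℤ) :
    P.triSeq p q r (3 * i + 2 + 1) = p + P.perimeter + i * P.perimeter := by
  rw [show 3 * i + 2 + 1 = 3 * (i + 1) by ring, triSeq_zero]
  push_cast; ring

theorem exists_eq_three_mul (j : ℤ) : ∃ i : ℤ, j = 3 * i ∨ j = 3 * i + 1 ∨ j = 3 * i + 2 :=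
  ⟨j / 3, by omega⟩

end ConvexPolygon

namespace Gluing
variable {n : ℕ} {P : ConvexPolygon n} {G : Gluing P}

variable (G) in
/-- The gluing folds each arc between successive members of the sequence at its midpoint and
identifies all members of the sequence. -/
def FoldedBy (p : ℤ → ℝ) : Prop := ∀ x y, G.Rel x y ↔
  (∃ i : ℤ, y = x + i * P.perimeter) ∨
  (∃ i i' j : ℤ, p j ≤ x + i * P.perimeter ∧ x + i * P.perimeter ≤ p (j + 1) ∧
    (x + i * P.perimeter) + (y + i' * P.perimeter) = p j + p (j + 1)) ∨
  ∃ j l, x = p j ∧ y = p l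

variable (G) in
/-- An arc with glued ends which is folded at its midpoint, and nothing else is glued to
its interior. -/
structure FoldedArc (a b : ℝ) : Prop where
  lt : a < b
  fold : ∀ s, 0 ≤ s → s ≤ b - a → G.Rel (a + s) (b - s)
  only : ∀ x y, a < x → x < b → G.Rel x y →
    P.boundaryPoint y = P.boundaryPoint x ∨ P.boundaryPoint y = P.boundaryPoint (a + b - x)

theorem FoldedArc.rel {a b : ℝ} (h : G.FoldedArc a b) : G.Rel a b := by
  simpa using h.fold 0 le_rfl (by linarith [h.lt])

theorem FoldedArc.shift {a b : ℝ} (h : G.FoldedArc a b) (i : ℤ) :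
    G.FoldedArc (a + i * P.perimeter) (b + i * P.perimeter) := by
  refine ⟨by linarith [h.lt], ?_, ?_⟩
  · intro s h0 h1
    have := (h.fold s h0 (by linarith)).shift i i
    rwa [show a + s + i * P.perimeter = a + i * P.perimeter + s by ring,
      show b - s + i * P.perimeter = b + i * P.perimeter - s by ring] at this
  · intro x y h0 h1 h2
    have e1 : P.boundaryPoint (x + (-i : ℤ) * P.perimeter) = P.boundaryPoint x :=
      P.boundaryPoint_add_int_mul x (-i)
    have e2 := P.boundaryPoint_add_int_mul (a + b - (x + (-i : ℤ) * P.perimeter)) i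
    have h3 := h.only (x + (-i : ℤ) * P.perimeter) y (by push_cast; linarith)
      (by push_cast; linarith) ((Rel.of_eq e1).trans h2)
    rw [e1, ← e2] at h3
    convert h3 using 3
    push_cast; ring

variable (G) in
/-- The boundary is partitioned into folded arcs by the members of the sequence. -/
structure FoldsAlong (p : ℤ → ℝ) : Prop where
  arc : ∀ j, G.FoldedArc (p j) (p (j + 1))
  cover : ∀ x, ∃ j, p j ≤ x ∧ x < p (j + 1)

/-- Consecutive cuts are glued, hence all of them by chaining; any other point is glued only to its
translates and to mirror images in its own arc. The gluing relation becomes an explicit function of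
the sequence. -/
theorem FoldsAlong.foldedBy {p : ℤ → ℝ} (hp : G.FoldsAlong p) : G.FoldedBy p := by
  obtain ⟨h, hcov⟩ := hp
  have hnat : ∀ (j : ℤ) (k : ℕ), G.Rel (p j) (p (j + k)) := by
    intro j k
    induction k with
    | zero => simpa using Rel.refl _
    | succ k ih =>
      push_cast
      rw [← add_assoc]
      exact ih.trans (h _).rel
  have hall : ∀ j l, G.Rel (p j) (p l) := by
    intro j l
    rcases le_total j l with hjl | hjl
    · have := hnat j (l - j).toNat
      rwa [Int.toNat_of_nonneg (by omega), add_sub_cancel] at this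
    · have := hnat l (j - l).toNat
      rw [Int.toNat_of_nonneg (by omega), add_sub_cancel] at this
      exact this.symm
  intro x y
  constructor
  · intro hR
    obtain ⟨j, hj0, hj1⟩ := hcov x
    rcases hj0.eq_or_lt with hj0 | hj0
    · obtain ⟨l, hl0, hl1⟩ := hcov y
      rcases hl0.eq_or_lt with hl0 | hl0
      · exact Or.inr (Or.inr ⟨j, l, hj0.symm, hl0.symm⟩)
      · rcases (h l).only y x hl0 hl1 hR.symm with h1 | h1
        · exact Or.inl (P.boundaryPoint_eq_iff.1 h1)
        · obtain ⟨i, hi⟩ := P.boundaryPoint_eq_iff.1 h1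
          exact Or.inr (Or.inl ⟨i, 0, l, by linarith, by linarith, by
            push_cast; linarith⟩)
    · rcases (h j).only x y hj0 hj1 hR with h1 | h1
      · exact Or.inl (P.boundaryPoint_eq_iff.1 h1.symm)
      · obtain ⟨i, hi⟩ := P.boundaryPoint_eq_iff.1 h1
        exact Or.inr (Or.inl ⟨0, i, j, by push_cast; linarith, by push_cast; linarith, by
          push_cast; linarith⟩)
  · rintro (⟨i, rfl⟩ | ⟨i, i', j, h0, h1, h2⟩ | ⟨j, l, rfl, rfl⟩)
    · exact Rel.of_eq (P.boundaryPoint_add_int_mul x i).symm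
    · have h3 := (h j).fold (x + i * P.perimeter - p j) (by linarith) (by linarith)
      rw [add_sub_cancel, show p (j + 1) - (x + i * P.perimeter - p j) = y + i' * P.perimeter by
        linarith] at h3
      exact (Rel.of_eq (P.boundaryPoint_add_int_mul x i).symm).trans
        (h3.trans (Rel.of_eq (P.boundaryPoint_add_int_mul y i')))
    · exact hall j l

theorem exists_triple {x y z : ℝ} (h1 : G.Rel x y) (h2 : G.Rel x z)
    (hxy : P.boundaryPoint y ≠ P.boundaryPoint x) (hxz : P.boundaryPoint z ≠ P.boundaryPoint x)
    (hyz : P.boundaryPoint y ≠ P.boundaryPoint z) :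
    ∃ u v w, u < v ∧ v < w ∧ w < u + P.perimeter ∧ G.Rel u v ∧ G.Rel v w := by
  obtain ⟨i, hi0, hi1⟩ := P.exists_add_int_mul_mem x y
  obtain ⟨j, hj0, hj1⟩ := P.exists_add_int_mul_mem x z
  rw [← P.boundaryPoint_add_int_mul y i, ← P.boundaryPoint_add_int_mul z j] at hyz
  rw [← P.boundaryPoint_add_int_mul y i] at hxy
  rw [← P.boundaryPoint_add_int_mul z j] at hxz
  replace h1 : G.Rel x (y + i * P.perimeter) := by
    simpa using h1.shift 0 i
  replace h2 : G.Rel x (z + j * P.perimeter) := by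
    simpa using h2.shift 0 j
  generalize y + i * P.perimeter = y' at *
  generalize z + j * P.perimeter = z' at *
  have hi0' : x < y' := lt_of_le_of_ne hi0 fun h => hxy (by rw [h])
  have hj0' : x < z' := lt_of_le_of_ne hj0 fun h => hxz (by rw [h])
  rcases lt_trichotomy y' z' with h | h | h
  · exact ⟨x, y', z', hi0', h, hj1, h1, h1.symm.trans h2⟩
  · exact absurd (by rw [h]) hyz
  · exact ⟨x, z', y', hj0', h, hi1, h2, h2.symm.trans h1⟩

variable (G) in
/-- There are no four leaves. -/
def AtMostThreeLeaves : Prop := ∀ a b c d, a < b → b < c → c < d → d < a + P.perimeter →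
  G.Leaf a → G.Leaf b → G.Leaf c → G.Leaf d → False

/-- Each arc with glued ends contains a leaf. A triple inside `[p, q]` would give two leaves there,
and the arcs `q r` and `r p` give two more; so `[p, q]` is folded. A further partner of an interior
point would form a triple inside, directly or, if it lies outside `[p, q]`, by non-crossing with the
pair `p`, `q`. -/
theorem IsAleksandrov.foldedArc_of_triple (hG : G.IsAleksandrov) (hl : G.AtMostThreeLeaves)
    {p q r : ℝ} (hpq : p < q) (hqr : q < r) (hrp : r < p + P.perimeter) (h1 : G.Rel p q)
    (h2 : G.Rel q r) : G.FoldedArc p q := by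
  have hNT : ∀ x y z, p ≤ x → x < y → y < z → z ≤ q → G.Rel x y → G.Rel y z → False := by
    intro x y z h3 h4 h5 h6 h7 h8
    obtain ⟨a, ha1, ha2, ha3⟩ := hG.exists_leaf h4 (by linarith) h7
    obtain ⟨b, hb1, hb2, hb3⟩ := hG.exists_leaf h5 (by linarith) h8
    obtain ⟨c, hc1, hc2, hc3⟩ := hG.exists_leaf hqr (by linarith) h2
    obtain ⟨d, hd1, hd2, hd3⟩ := hG.exists_leaf hrp (by linarith)
      ((h1.trans h2).symm.trans (rel_add_perimeter p))
    exact hl a b c d (by linarith) (by linarith) (by linarith) (by linarith) ha3 hb3 hc3 hd3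
  have hfold := (hG.fold_or_triple hpq (by linarith) h1).resolve_right
    (by rintro ⟨x, y, z, h3, h4, h5, h6, h7, h8⟩; exact hNT x y z h3 h4 h5 h6 h7 h8)
  refine ⟨hpq, hfold, fun x y hx0 hx1 hR => ?_⟩
  by_contra hne
  push Not at hne
  have hxx : G.Rel x (p + q - x) := by
    have := hfold (x - p) (by linarith) (by linarith)
    rwa [add_sub_cancel, show q - (x - p) = p + q - x by ring] at this
  by_cases hmid : x = p + q - x
  · have := hG.leaf_of_fold hpq hfold
    rw [show (p + q) / 2 = x by linarith] at this
    exact hne.1 (this y hR)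
  obtain ⟨i, hi0, hi1⟩ := P.exists_add_int_mul_mem p y
  rw [← P.boundaryPoint_add_int_mul y i] at hne
  replace hR : G.Rel x (y + i * P.perimeter) := by simpa using hR.shift 0 i
  generalize y + i * P.perimeter = y' at *
  have hne1 : y' ≠ x := fun h => hne.1 (by rw [h])
  have hne2 : y' ≠ p + q - x := fun h => hne.2 (by rw [h])
  by_cases hy : y' ≤ q
  · have hR' := hxx.symm.trans hR
    rcases lt_or_gt_of_ne hne1 with c1 | c1 <;> rcases lt_or_gt_of_ne hne2 with c2 | c2 <;>
      rcases lt_or_gt_of_ne hmid with c3 | c3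
    · exact hNT y' x (p + q - x) hi0 c1 c3 (by linarith) hR.symm hxx
    · exact hNT y' (p + q - x) x hi0 c2 c3 (by linarith) hR'.symm hxx.symm
    · linarith
    · exact hNT (p + q - x) y' x (by linarith) c2 c1 (by linarith) hR' hR.symm
    · exact hNT x y' (p + q - x) (by linarith) c1 c2 (by linarith) hR hR'.symm
    · linarith
    · exact hNT x (p + q - x) y' (by linarith) c3 c2 (by linarith) hxx hR'
    · exact hNT (p + q - x) x y' (by linarith) c3 c1 (by linarith) hxx.symm hR
  · push Not at hy
    have h3 := hG.noncrossing hx0 hx1 hy hi1 h1 hR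
    exact hNT p x q le_rfl hx0 hx1 le_rfl h3 (h3.symm.trans h1)

theorem IsAleksandrov.foldsAlong_triSeq (hG : G.IsAleksandrov) (hl : G.AtMostThreeLeaves)
    {p q r : ℝ} (hpq : p < q) (hqr : q < r) (hrp : r < p + P.perimeter) (h1 : G.Rel p q)
    (h2 : G.Rel q r) : G.FoldsAlong (P.triSeq p q r) := by
  have h3 : G.Rel r (p + P.perimeter) := (h1.trans h2).symm.trans (rel_add_perimeter p)
  have h4 : G.Rel (p + P.perimeter) (q + P.perimeter) := by simpa using h1.shift 1 1
  have a1 := hG.foldedArc_of_triple hl hpq hqr hrp h1 h2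
  have a2 := hG.foldedArc_of_triple hl hqr hrp (by linarith) h2 h3
  have a3 := hG.foldedArc_of_triple hl hrp (by linarith : p + P.perimeter < q + P.perimeter)
    (by linarith) h3 h4
  refine ⟨fun j => ?_, fun x => ?_⟩
  · obtain ⟨i, rfl | rfl | rfl⟩ := ConvexPolygon.exists_eq_three_mul j
    · rw [P.triSeq_zero, P.triSeq_one]; exact a1.shift i
    · rw [add_assoc, show (1 : ℤ) + 1 = 2 from rfl, P.triSeq_two, P.triSeq_one]; exact a2.shift i
    · rw [P.triSeq_three, P.triSeq_two]; exact a3.shift i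
  · obtain ⟨i, hi0, hi1⟩ := P.exists_add_int_mul_mem p x
    by_cases c1 : x + i * P.perimeter < q
    · exact ⟨3 * (-i), by rw [P.triSeq_zero]; push_cast; linarith, by
        rw [P.triSeq_one]; push_cast; linarith⟩
    by_cases c2 : x + i * P.perimeter < r
    · exact ⟨3 * (-i) + 1, by rw [P.triSeq_one]; push_cast; linarith, by
        rw [add_assoc, show (1 : ℤ) + 1 = 2 from rfl, P.triSeq_two]; push_cast; linarith⟩
    · exact ⟨3 * (-i) + 2, by rw [P.triSeq_two]; push_cast; linarith, by
        rw [P.triSeq_three]; push_cast; linarith⟩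

/-- For any glued pair `u < v`, both complementary arcs are folded at their midpoints, in the
absence of triples. The two folds fit together to one reflection of the whole boundary about the
midpoint `m` of `u` and `v`. -/
theorem IsAleksandrov.exists_foldsAlong_pathSeq (hG : G.IsAleksandrov)
    (hNT : ∀ x y z, x < y → y < z → z < x + P.perimeter → G.Rel x y → G.Rel y z → False) :
    ∃ m, G.FoldsAlong (P.pathSeq m) := by
  obtain ⟨δ, hδ, a', ha1, ha2, hzip, hend, hgerm⟩ := hG.exists_zip 0
  have hne := (hgerm (δ / 2) (by linarith) (by linarith)).2
  have hR := hzip (δ / 2) (by linarith) (by linarith)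
  generalize (0 : ℝ) + δ / 2 = u at *
  obtain ⟨i, hi0, hi1⟩ := P.exists_add_int_mul_mem u (a' - δ / 2)
  rw [← P.boundaryPoint_add_int_mul (a' - δ / 2) i] at hne
  replace hR : G.Rel u (a' - δ / 2 + i * P.perimeter) := by simpa using hR.shift 0 i
  generalize a' - δ / 2 + i * P.perimeter = v at *
  have huv : u < v := lt_of_le_of_ne hi0 fun h => hne (by rw [h])
  have f1 := (hG.fold_or_triple huv hi1 hR).resolve_right (by
    rintro ⟨x, y, z, h3, h4, h5, h6, h7, h8⟩; exact hNT x y z h4 h5 (by linarith) h7 h8)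
  have f2 := (hG.fold_or_triple hi1 (by linarith) (hR.symm.trans (rel_add_perimeter u))).resolve_right
    (by rintro ⟨x, y, z, h3, h4, h5, h6, h7, h8⟩; exact hNT x y z h4 h5 (by linarith) h7 h8)
  obtain ⟨m, hm⟩ : ∃ m, m = (u + v) / 2 := ⟨_, rfl⟩
  have hL := P.perimeter_pos
  have small : ∀ s, 0 ≤ s → s ≤ (v - u) / 2 → G.Rel (m + s) (m + P.perimeter - s) := by
    intro s h0 h1
    have := (f1 ((v - u) / 2 - s) (by linarith) (by linarith)).symm
    rw [show u + ((v - u) / 2 - s) = m - s by rw [hm]; ring,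
      show v - ((v - u) / 2 - s) = m + s by rw [hm]; ring] at this
    rw [show m + P.perimeter - s = m - s + P.perimeter by ring]
    exact this.trans (rel_add_perimeter _)
  have fold : ∀ s, 0 ≤ s → s ≤ P.perimeter → G.Rel (m + s) (m + P.perimeter - s) := by
    intro s h0 h1
    by_cases c1 : s ≤ (v - u) / 2
    · exact small s h0 c1
    by_cases c2 : s ≤ P.perimeter - (v - u) / 2
    · have := f2 (m + s - v) (by linarith) (by linarith)
      rwa [add_sub_cancel, show u + P.perimeter - (m + s - v) = m + P.perimeter - s by
        rw [hm]; ring] at this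
    · have := (small (P.perimeter - s) (by linarith) (by linarith)).symm
      rwa [show m + (P.perimeter - s) = m + P.perimeter - s by ring,
        show m + P.perimeter - (P.perimeter - s) = m + s by ring] at this
  have arc : G.FoldedArc m (m + P.perimeter) := by
    refine ⟨by linarith, fun s h0 h1 => fold s h0 (by linarith), fun x y hx0 hx1 hxy => ?_⟩
    by_contra hne
    push Not at hne
    have hxx := fold (x - m) (by linarith) (by linarith)
    rw [add_sub_cancel, show m + P.perimeter - (x - m) = m + (m + P.perimeter) - x by ring] at hxx
    by_cases hmid : P.boundaryPoint (m + (m + P.perimeter) - x) = P.boundaryPoint x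
    · have h3 := P.eq_of_boundaryPoint_eq hmid (by rw [abs_lt]; constructor <;> linarith)
      have h4 := hG.leaf_of_fold (a := m) (b := m + P.perimeter) (by linarith)
        (fun s h0 h1 => fold s h0 (by linarith))
      rw [show (m + (m + P.perimeter)) / 2 = x by linarith] at h4
      exact hne.1 (h4 y hxy)
    · obtain ⟨a, b, c, h3, h4, h5, h6, h7⟩ := exists_triple hxy hxx hne.1 hmid hne.2
      exact hNT a b c h3 h4 h5 h6 h7
  refine ⟨m, fun j => ?_, fun x => ?_⟩
  · have := arc.shift j
    unfold ConvexPolygon.pathSeq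
    rwa [show m + P.perimeter + j * P.perimeter = m + (j + 1 : ℤ) * P.perimeter by
      push_cast; ring] at this
  · obtain ⟨i, hi0, hi1⟩ := P.exists_add_int_mul_mem m x
    exact ⟨-i, by unfold ConvexPolygon.pathSeq; push_cast; linarith,
      by unfold ConvexPolygon.pathSeq; push_cast; linarith⟩

/-- Without three points glued together, the boundary is folded along a single arc. -/
theorem IsAleksandrov.exists_foldsAlong_or_triple (hG : G.IsAleksandrov) :
    (∃ m, G.FoldsAlong (P.pathSeq m)) ∨
    ∃ p q r, p < q ∧ q < r ∧ r < p + P.perimeter ∧ G.Rel p q ∧ G.Rel q r := by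
  by_cases h : ∃ p q r, p < q ∧ q < r ∧ r < p + P.perimeter ∧ G.Rel p q ∧ G.Rel q r
  · exact Or.inr h
  · push Not at h
    exact Or.inl (hG.exists_foldsAlong_pathSeq fun x y z h1 h2 h3 h4 h5 => h x y z h1 h2 h3 h4 h5)

end Gluing
end PolygonFolding
end

/-! ### Angles of a convex polygon -/

noncomputable section
namespace PolygonFolding
open EuclideanGeometry

theorem inner_plane (x y : Plane) : inner ℝ x y = x 0 * y 0 + x 1 * y 1 := by
  simp [PiLp.inner_apply, Fin.sum_univ_two]; ring

theorem norm_sq_plane (x : Plane) : ‖x‖ ^ 2 = x 0 ^ 2 + x 1 ^ 2 := by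
  rw [← real_inner_self_eq_norm_sq, inner_plane]; ring

theorem signedArea_rotate (a b c : Plane) : signedArea a b c = signedArea b c a := by
  simp only [signedArea]; ring

/-- The sine of an angle, by the signed area. -/
theorem norm_mul_norm_mul_sin_angle {o a b : Plane} (h : 0 < signedArea o a b) :
    ‖a - o‖ * ‖b - o‖ * Real.sin (∠ a o b) = signedArea o a b := by
  have h1 := InnerProductGeometry.sin_angle_mul_norm_mul_norm (a - o) (b - o)
  have h2 : inner ℝ (a - o) (a - o) * inner ℝ (b - o) (b - o) - inner ℝ (a - o) (b - o) *
      inner ℝ (a - o) (b - o) = signedArea o a b ^ 2 := by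
    simp only [inner_plane, signedArea, PiLp.sub_apply]; ring
  rw [h2, Real.sqrt_sq h.le] at h1
  rw [← h1, EuclideanGeometry.angle, vsub_eq_sub, vsub_eq_sub]
  ring

theorem ne_of_signedArea_pos {o a b : Plane} (h : 0 < signedArea o a b) : a ≠ o ∧ b ≠ o := by
  constructor <;> rintro rfl <;> simp [signedArea] at h

theorem sin_angle_pos {o a b : Plane} (h : 0 < signedArea o a b) : 0 < Real.sin (∠ a o b) := by
  have h1 := norm_mul_norm_mul_sin_angle h
  obtain ⟨h2, h3⟩ := ne_of_signedArea_pos h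
  have h4 : 0 < ‖a - o‖ * ‖b - o‖ :=
    mul_pos (norm_pos_iff.2 (sub_ne_zero.2 h2)) (norm_pos_iff.2 (sub_ne_zero.2 h3))
  by_contra h5
  push Not at h5
  nlinarith

theorem angle_pos_of_signedArea_pos {o a b : Plane} (h : 0 < signedArea o a b) : 0 < ∠ a o b := by
  refine lt_of_le_of_ne (EuclideanGeometry.angle_nonneg _ _ _) fun h1 => ?_
  have := sin_angle_pos h
  rw [← h1, Real.sin_zero] at this
  exact lt_irrefl _ this

theorem angle_lt_pi_of_signedArea_pos {o a b : Plane} (h : 0 < signedArea o a b) :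
    ∠ a o b < Real.pi := by
  refine lt_of_le_of_ne (EuclideanGeometry.angle_le_pi _ _ _) fun h1 => ?_
  have := sin_angle_pos h
  rw [h1, Real.sin_pi] at this
  exact lt_irrefl _ this

/-- Additivity of angles within a half-plane. -/
theorem angle_add_angle_of_signedArea_pos {o a b c : Plane} (hab : 0 < signedArea o a b)
    (hbc : 0 < signedArea o b c) (hac : 0 < signedArea o a c) : ∠ a o c = ∠ a o b + ∠ b o c := by
  have sab := norm_mul_norm_mul_sin_angle hab
  have sbc := norm_mul_norm_mul_sin_angle hbc
  have cab := InnerProductGeometry.cos_angle_mul_norm_mul_norm (a - o) (b - o)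
  have cbc := InnerProductGeometry.cos_angle_mul_norm_mul_norm (b - o) (c - o)
  have cac := InnerProductGeometry.cos_angle_mul_norm_mul_norm (a - o) (c - o)
  change Real.cos (∠ a o b) * _ = _ at cab
  change Real.cos (∠ b o c) * _ = _ at cbc
  change Real.cos (∠ a o c) * _ = _ at cac
  have ha := norm_pos_iff.2 (sub_ne_zero.2 (ne_of_signedArea_pos hab).1)
  have hb := norm_pos_iff.2 (sub_ne_zero.2 (ne_of_signedArea_pos hab).2)
  have hc := norm_pos_iff.2 (sub_ne_zero.2 (ne_of_signedArea_pos hbc).2)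
  have hb2 := norm_sq_plane (b - o)
  simp only [inner_plane, PiLp.sub_apply] at cab cbc cac hb2
  simp only [signedArea] at sab sbc hac
  have hcos : Real.cos (∠ a o b + ∠ b o c) = Real.cos (∠ a o c) := by
    have hne : ‖b - o‖ ^ 2 * (‖a - o‖ * ‖c - o‖) ≠ 0 := by positivity
    apply mul_right_cancel₀ hne
    rw [Real.cos_add]
    calc _ = (Real.cos (∠ a o b) * (‖a - o‖ * ‖b - o‖)) *
          (Real.cos (∠ b o c) * (‖b - o‖ * ‖c - o‖)) -
          (‖a - o‖ * ‖b - o‖ * Real.sin (∠ a o b)) *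
          (‖b - o‖ * ‖c - o‖ * Real.sin (∠ b o c)) := by ring
      _ = ‖b - o‖ ^ 2 * (Real.cos (∠ a o c) * (‖a - o‖ * ‖c - o‖)) := by
        rw [cab, cbc, sab, sbc, cac, hb2]; ring
      _ = _ := by ring
  -- Equal cosines do not suffice: the positive sine keeps the sum below π, where the cosine is
  -- injective.
  have hsin : 0 < Real.sin (∠ a o b + ∠ b o c) := by
    have h1 : 0 < ‖b - o‖ ^ 2 * (‖a - o‖ * ‖c - o‖) := by positivity
    refine pos_of_mul_pos_left (a := Real.sin (∠ a o b + ∠ b o c)) (b := ‖b - o‖ ^ 2 * (‖a - o‖ * ‖c - o‖)) ?_ h1.le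
    rw [Real.sin_add]
    calc 0 < ‖b - o‖ ^ 2 * ((a 0 - o 0) * (c 1 - o 1) - (a 1 - o 1) * (c 0 - o 0)) := by positivity
      _ = (‖a - o‖ * ‖b - o‖ * Real.sin (∠ a o b)) *
          (Real.cos (∠ b o c) * (‖b - o‖ * ‖c - o‖)) +
          (Real.cos (∠ a o b) * (‖a - o‖ * ‖b - o‖)) *
          (‖b - o‖ * ‖c - o‖ * Real.sin (∠ b o c)) := by
        rw [cab, cbc, sab, sbc, hb2]; ring
      _ = _ := by ring
  have p1 := angle_pos_of_signedArea_pos hab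
  have p2 := angle_pos_of_signedArea_pos hbc
  have l1 := angle_lt_pi_of_signedArea_pos hab
  have l2 := angle_lt_pi_of_signedArea_pos hbc
  have hlt : ∠ a o b + ∠ b o c < Real.pi := by
    by_contra h
    push Not at h
    have := Real.sin_nonpos_of_nonpos_of_neg_pi_le (x := ∠ a o b + ∠ b o c - 2 * Real.pi)
      (by linarith) (by linarith)
    rw [Real.sin_sub_two_pi] at this
    linarith
  exact (Real.injOn_cos ⟨by linarith, hlt.le⟩ ⟨EuclideanGeometry.angle_nonneg _ _ _,
    EuclideanGeometry.angle_le_pi _ _ _⟩ hcos).symm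

namespace ConvexPolygon
variable {n : ℕ} (P : ConvexPolygon n)

theorem faceAngle_vertex (i : Fin n) : P.faceAngle (P.vertices i) =
    ∠ (P.vertices ((finRotate n).symm i)) (P.vertices i) (P.vertices (finRotate n i)) := by
  have h : ∃ j, P.vertices j = P.vertices i := ⟨i, rfl⟩
  rw [faceAngle, dif_pos h, P.vertices_injective h.choose_spec]

theorem faceAngle_of_not_vertex {x : Plane} (h : ∀ i, P.vertices i ≠ x) :
    P.faceAngle x = Real.pi :=
  dif_neg (by rintro ⟨i, hi⟩; exact h i hi)

theorem signedArea_corner (i : Fin n) : 0 < signedArea (P.vertices i)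
    (P.vertices (finRotate n i)) (P.vertices ((finRotate n).symm i)) := by
  refine P.convex i _ (fun h => ?_) (fun h => ?_)
  · exact P.finRotate_ne i (by conv_lhs => rw [← h, Equiv.apply_symm_apply])
  · refine P.finRotate_finRotate_ne i ?_
    rw [← h, Equiv.apply_symm_apply]

theorem faceAngle_vertex_pos (i : Fin n) : 0 < P.faceAngle (P.vertices i) := by
  rw [faceAngle_vertex, EuclideanGeometry.angle_comm]
  exact angle_pos_of_signedArea_pos (P.signedArea_corner i)

theorem faceAngle_vertex_lt_pi (i : Fin n) : P.faceAngle (P.vertices i) < Real.pi := by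
  rw [faceAngle_vertex, EuclideanGeometry.angle_comm]
  exact angle_lt_pi_of_signedArea_pos (P.signedArea_corner i)

theorem faceAngle_pos (x : Plane) : 0 < P.faceAngle x := by
  by_cases h : ∃ i, P.vertices i = x
  · obtain ⟨i, rfl⟩ := h; exact P.faceAngle_vertex_pos i
  · push Not at h
    rw [P.faceAngle_of_not_vertex h]; exact Real.pi_pos

theorem faceAngle_le_pi (x : Plane) : P.faceAngle x ≤ Real.pi := by
  by_cases h : ∃ i, P.vertices i = x
  · obtain ⟨i, rfl⟩ := h; exact (P.faceAngle_vertex_lt_pi i).le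
  · push Not at h
    rw [P.faceAngle_of_not_vertex h]

/-- The interior angles of a convex polygon sum to `(n - 2) π`. -/
theorem sum_faceAngle : ∑ i, P.faceAngle (P.vertices i) = ((n : ℝ) - 2) * Real.pi := by
  have hn := P.three_le
  let V : ℕ → Plane := fun j => if h : j < n then P.vertices ⟨j, h⟩ else P.vertices ⟨0, P.pos⟩
  have hV : ∀ i : Fin n, V i = P.vertices i := fun i => by simp [V]
  have hrot : ∀ i (h : i + 1 < n), finRotate n ⟨i, by omega⟩ = ⟨i + 1, h⟩ := fun i h => by
    rw [Fin.ext_iff, val_finRotate, if_neg (by simp; omega)]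
  have hrot' : finRotate n ⟨n - 1, by omega⟩ = ⟨0, P.pos⟩ :=
    P.finRotate_last _ (by simp; omega)
  have hA : ∀ i j, i + 1 < n → j < n → j ≠ i → j ≠ i + 1 →
      0 < signedArea (V i) (V (i + 1)) (V j) := by
    intro i j h1 h2 h3 h4
    have := P.convex ⟨i, by omega⟩ ⟨j, h2⟩ (by simpa using h3) (by rw [hrot i h1]; simpa using h4)
    rw [hrot i h1] at this
    simpa [V, h1, h2, show i < n by omega] using this
  have hang : ∀ j, j + 2 < n → P.faceAngle (V (j + 1)) = ∠ (V j) (V (j + 1)) (V (j + 2)) := by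
    intro j hj
    have e1 := hV ⟨j + 1, by omega⟩
    have e2 := hV ⟨j + 2, hj⟩
    have e3 := hV ⟨j, by omega⟩
    simp only at e1 e2 e3
    have e4 : (finRotate n).symm ⟨j + 1, by omega⟩ = ⟨j, by omega⟩ := by
      rw [Equiv.symm_apply_eq, hrot j (by omega)]
    rw [e1, e2, e3, faceAngle_vertex, hrot (j + 1) (by omega), e4]
  have tri : ∀ j, 0 < j → j + 1 < n →
      ∠ (V j) (V 0) (V (j + 1)) + ∠ (V 0) (V j) (V (j + 1)) + ∠ (V 0) (V (j + 1)) (V j) =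
        Real.pi := by
    intro j h0 hj
    have h1 := hA j 0 hj (by omega) (by omega) (by omega)
    rw [signedArea_rotate, signedArea_rotate] at h1
    obtain ⟨h2, h3⟩ := ne_of_signedArea_pos h1
    have h4 := EuclideanGeometry.angle_add_angle_add_angle_eq_pi (p₁ := V 0) (p₂ := V j)
      (V (j + 1)) h2
    rw [EuclideanGeometry.angle_comm (V (j + 1)) (V 0) (V j),
      EuclideanGeometry.angle_comm (V j) (V (j + 1)) (V 0)] at h4
    linarith
  -- Fan triangulation from vertex 0: the polygon on vertices 0, …, `k + 2` has angle sum `(k + 1)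
  -- π`, and each further triangle adds π.
  have key : ∀ k, k + 2 < n → ∑ j ∈ Finset.range (k + 1), P.faceAngle (V (j + 1)) +
      ∠ (V 0) (V (k + 2)) (V (k + 1)) + ∠ (V 1) (V 0) (V (k + 2)) = ((k : ℝ) + 1) * Real.pi := by
    intro k
    induction k with
    | zero =>
      intro hk
      have := tri 1 (by omega) (by omega)
      rw [Finset.sum_range_one, hang 0 (by omega)]
      simp only [zero_add, Nat.cast_zero, one_mul]
      simp only [show (1 : ℕ) + 1 = 2 from rfl] at this
      linarith
    | succ k ih =>
      intro hk
      have h1 := ih (by omega)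
      have h2 := tri (k + 2) (by omega) (by omega)
      rw [Finset.sum_range_succ, hang (k + 1) (by omega)]
      have h3 : ∠ (V (k + 1)) (V (k + 2)) (V (k + 3)) =
          ∠ (V 0) (V (k + 2)) (V (k + 1)) + ∠ (V 0) (V (k + 2)) (V (k + 3)) := by
        rw [EuclideanGeometry.angle_comm (V (k + 1)), angle_add_angle_of_signedArea_pos
          (b := V 0), EuclideanGeometry.angle_comm (V (k + 3)), add_comm]
        · exact hA (k + 2) 0 (by omega) (by omega) (by omega) (by omega)
        · rw [signedArea_rotate, signedArea_rotate]
          exact hA (k + 1) 0 (by omega) (by omega) (by omega) (by omega)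
        · exact hA (k + 2) (k + 1) (by omega) (by omega) (by omega) (by omega)
      have h4 : ∠ (V 1) (V 0) (V (k + 3)) =
          ∠ (V 1) (V 0) (V (k + 2)) + ∠ (V (k + 2)) (V 0) (V (k + 3)) := by
        refine angle_add_angle_of_signedArea_pos ?_ ?_ ?_
        · exact hA 0 (k + 2) (by omega) (by omega) (by omega) (by omega)
        · rw [signedArea_rotate]
          exact hA (k + 2) 0 (by omega) (by omega) (by omega) (by omega)
        · exact hA 0 (k + 3) (by omega) (by omega) (by omega) (by omega)
      simp only [show k + 1 + 1 = k + 2 from rfl, show k + 1 + 2 = k + 3 from rfl] at h2 ⊢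
      push_cast
      linarith
  obtain ⟨k, rfl⟩ : ∃ k, n = k + 3 := ⟨n - 3, by omega⟩
  have hk := key k (by omega)
  have hlast : P.faceAngle (V (k + 2)) = ∠ (V 0) (V (k + 2)) (V (k + 1)) := by
    have e1 := hV ⟨k + 2, by omega⟩
    have e2 := hV ⟨0, by omega⟩
    have e3 := hV ⟨k + 1, by omega⟩
    simp only at e1 e2 e3
    have e4 : (finRotate (k + 3)).symm ⟨k + 2, by omega⟩ = ⟨k + 1, by omega⟩ := by
      rw [Equiv.symm_apply_eq, hrot (k + 1) (by omega)]
    have e5 : finRotate (k + 3) ⟨k + 2, by omega⟩ = ⟨0, by omega⟩ := hrot'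
    rw [e1, e2, e3, faceAngle_vertex, e4, e5, EuclideanGeometry.angle_comm]
  have hfirst : P.faceAngle (V 0) = ∠ (V 1) (V 0) (V (k + 2)) := by
    have e1 := hV ⟨0, by omega⟩
    have e2 := hV ⟨1, by omega⟩
    have e3 := hV ⟨k + 2, by omega⟩
    simp only at e1 e2 e3
    have e4 : (finRotate (k + 3)).symm ⟨0, by omega⟩ = ⟨k + 2, by omega⟩ := by
      rw [Equiv.symm_apply_eq]; exact hrot'.symm
    rw [e1, e2, e3, faceAngle_vertex, hrot 0 (by omega), e4, EuclideanGeometry.angle_comm]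
  rw [← Finset.sum_congr rfl fun i _ => congrArg P.faceAngle (hV i),
    Fin.sum_univ_eq_sum_range (fun j => P.faceAngle (V j)), Finset.sum_range_succ,
    Finset.sum_range_succ', hlast, hfirst]
  push_cast
  linarith

/-- The turning angle at a vertex. -/
def turn (i : Fin n) : ℝ := Real.pi - P.faceAngle (P.vertices i)

theorem turn_pos (i : Fin n) : 0 < P.turn i := sub_pos.2 (P.faceAngle_vertex_lt_pi i)

theorem sum_turn : ∑ i, P.turn i = 2 * Real.pi := by
  simp only [turn, Finset.sum_sub_distrib, P.sum_faceAngle, Finset.sum_const, Finset.card_univ,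
    Fintype.card_fin, nsmul_eq_mul]
  ring

end ConvexPolygon
end PolygonFolding
end

/-! ### Curvature and the number of leaves -/

noncomputable section
namespace PolygonFolding
namespace ConvexPolygon
variable {n : ℕ} (P : ConvexPolygon n)

theorem isConnected_bdry : IsConnected P.bdry := by
  rw [← P.range_boundaryPoint]
  exact isConnected_range P.continuous_boundaryPoint

theorem exists_vertices_eq_of_faceAngle_ne {x : Plane} (h : P.faceAngle x ≠ Real.pi) :
    ∃ i, P.vertices i = x := by
  by_contra hne
  push Not at hne
  exact h (P.faceAngle_of_not_vertex hne)

end ConvexPolygon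

namespace Gluing
/-- The point where an arc starts. -/
def startPt {n : ℕ} {P : ConvexPolygon n} (G : Gluing P) (k : Fin G.m) : Plane :=
  P.boundaryPoint (G.start k)

variable {n : ℕ} {P : ConvexPolygon n} {G : Gluing P}

theorem startPt_injective : Function.Injective G.startPt := by
  intro k l h
  obtain ⟨j, hj⟩ := P.boundaryPoint_eq_iff.1 h
  have hk := G.len_pos k
  have hl := G.len_pos l
  have hm : 0 < min (G.len k) (G.len l) := lt_min hk hl
  have h1 := min_le_left (G.len k) (G.len l)
  have h2 := min_le_right (G.len k) (G.len l)
  set e := min (G.len k) (G.len l) / 2 with he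
  have a1 : G.InArc k e (G.start k + e) := ⟨by linarith, by linarith, rfl⟩
  have a2 : G.InArc l e (G.start k + e) :=
    ⟨by linarith, by linarith, P.boundaryPoint_eq_iff.2 ⟨j, by linarith⟩⟩
  exact (a1.unique a2).1

theorem not_interior_end (k : Fin G.m) : ¬ G.Interior (G.start k + G.len k) := by
  rintro ⟨l, t, h⟩
  obtain ⟨rfl, h2⟩ := h.unique_closed (G.len_pos k).le le_rfl rfl
  exact h.2.1.ne h2

variable (G)

/-- The arc starting where a given arc ends. -/
def next (k : Fin G.m) : Fin G.m := (exists_start_eq (G.not_interior_end k)).choose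

theorem startPt_next (k : Fin G.m) :
    G.startPt (G.next k) = P.boundaryPoint (G.start k + G.len k) :=
  (exists_start_eq (G.not_interior_end k)).choose_spec.symm

/-- The classes of glued endpoints of arcs. -/
abbrev EndClass : Type := Quotient (Setoid.comap G.startPt G.setoid)

/-- The class of the start of an arc. -/
def cls (k : Fin G.m) : G.EndClass := Quotient.mk _ k

instance : Finite G.EndClass := Quotient.finite _

instance : Fintype G.EndClass := Fintype.ofFinite _

variable {G}

theorem cls_eq_iff {k l : Fin G.m} : G.cls k = G.cls l ↔ G.Rel (G.start k) (G.start l) :=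
  Quotient.eq

variable (G)

/-- The pair of classes of endpoints of an arc. -/
def endPair (k : Fin G.m) : Sym2 G.EndClass := s(G.cls k, G.cls (G.next k))

/-- The graph formed by the arcs after gluing. -/
def arcGraph : SimpleGraph G.EndClass := SimpleGraph.fromEdgeSet (Set.range G.endPair)

theorem reachable_next (k : Fin G.m) : G.arcGraph.Reachable (G.cls k) (G.cls (G.next k)) := by
  by_cases h : G.cls k = G.cls (G.next k)
  · rw [h]
  · exact SimpleGraph.Adj.reachable ((SimpleGraph.fromEdgeSet_adj _).2 ⟨⟨k, rfl⟩, h⟩)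

/-- The closed arcs whose start is reachable and the remaining ones are two closed sets covering the
connected boundary, so they meet. A point on two different arcs is an end of both, and the graph
joins the two ends of an arc. -/
theorem arcGraph_connected : G.arcGraph.Connected := by
  obtain ⟨k0, -⟩ := G.exists_arc_right 0
  have hne : Nonempty G.EndClass := ⟨G.cls k0⟩
  refine ⟨fun q r => ?_⟩
  induction q using Quotient.inductionOn with | _ a
  induction r using Quotient.inductionOn with | _ b
  change G.arcGraph.Reachable (G.cls a) (G.cls b)
  by_contra hab
  let arc : Fin G.m → Set Plane := fun k =>
    P.boundaryPoint '' Set.Icc (G.start k) (G.start k + G.len k)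
  let A : Set (Fin G.m) := {k | G.arcGraph.Reachable (G.cls a) (G.cls k)}
  have hclosed : ∀ B : Set (Fin G.m), IsClosed (⋃ k ∈ B, arc k) := fun B =>
    B.toFinite.isClosed_biUnion fun k _ => (P.isClosed_bdry_image _ _).isClosed
  have hstart : ∀ k, G.startPt k ∈ arc k := fun k =>
    ⟨G.start k, ⟨le_rfl, by linarith [G.len_pos k]⟩, rfl⟩
  have hmem : ∀ k, k ∈ A ↔ G.next k ∈ A := fun k =>
    ⟨fun h => h.trans (G.reachable_next k), fun h => h.trans (G.reachable_next k).symm⟩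
  have ends : ∀ k l x, k ≠ l → x ∈ arc k → x ∈ arc l →
      x = G.startPt k ∨ x = G.startPt (G.next k) := by
    rintro k l x hkl ⟨u, ⟨hu0, hu1⟩, rfl⟩ ⟨v, ⟨hv0, hv1⟩, hv⟩
    rcases hu0.eq_or_lt with rfl | hu0
    · exact Or.inl rfl
    rcases hu1.eq_or_lt with rfl | hu1
    · exact Or.inr (G.startPt_next k).symm
    · have h : G.InArc k (u - G.start k) u := ⟨by linarith, by linarith, by rw [add_sub_cancel]⟩
      exact absurd (h.unique_closed (l := l) (t := v - G.start l) (by linarith) (by linarith)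
        (by rw [add_sub_cancel]; exact hv.symm)).1 hkl
  have hcov : P.bdry ⊆ (⋃ k ∈ A, arc k) ∪ ⋃ k ∈ Aᶜ, arc k := by
    intro x hx
    obtain ⟨k, hk⟩ := Set.mem_iUnion.1 (G.cover hx)
    by_cases hkA : k ∈ A
    · exact Or.inl (Set.mem_biUnion hkA hk)
    · exact Or.inr (Set.mem_biUnion hkA hk)
  obtain ⟨x, -, hx1, hx2⟩ := isPreconnected_closed_iff.1 P.isConnected_bdry.isPreconnected _ _
    (hclosed A) (hclosed Aᶜ) hcov
    ⟨_, P.boundaryPoint_mem_bdry (G.start a), Set.mem_biUnion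
      (show a ∈ A from SimpleGraph.Reachable.refl _) (hstart a)⟩
    ⟨_, P.boundaryPoint_mem_bdry (G.start b), Set.mem_biUnion (show b ∈ Aᶜ from hab) (hstart b)⟩
  simp only [Set.mem_iUnion] at hx1 hx2
  obtain ⟨k, hk, hxk⟩ := hx1
  obtain ⟨l, hl, hxl⟩ := hx2
  have hkl : k ≠ l := fun h => hl (h ▸ hk)
  obtain ⟨u, hu, hxu⟩ : ∃ u, u ∈ A ∧ x = G.startPt u := by
    rcases ends k l x hkl hxk hxl with h | h
    · exact ⟨k, hk, h⟩
    · exact ⟨_, (hmem k).1 hk, h⟩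
  obtain ⟨v, hv, hxv⟩ : ∃ v, v ∉ A ∧ x = G.startPt v := by
    rcases ends l k x hkl.symm hxl hxk with h | h
    · exact ⟨l, hl, h⟩
    · exact ⟨_, fun h' => hl ((hmem l).2 h'), h⟩
  rw [startPt_injective (hxv.symm.trans hxu)] at hv
  exact hv hu

variable {G}

/-- Reversed gluing sends the start of an arc to the end of its partner, so partners span the same
edge and the graph has at most `m / 2` edges. -/
theorem IsAleksandrov.endPair_partner (hG : G.IsAleksandrov) (k : Fin G.m) :
    G.endPair (G.partner k) = G.endPair k := by
  have key : ∀ k, G.cls k = G.cls (G.next (G.partner k)) := by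
    intro k
    rw [cls_eq_iff]
    have h1 : G.Rel (G.start k) (G.img k 0) := by
      simpa using Rel.of_glued (G := G) le_rfl (G.len_pos k).le
    refine h1.trans (Rel.of_eq ?_)
    rw [← startPt, startPt_next, Gluing.img, hG.reversed k, if_pos rfl, sub_zero, G.len_partner]
  have h2 := key (G.partner k)
  rw [G.partner_partner] at h2
  rw [endPair, endPair, ← key k, h2, Sym2.eq_swap]

/-- Since the glued arcs form a connected graph, there are few classes of endpoints. -/
theorem IsAleksandrov.two_mul_card_endClass_le (hG : G.IsAleksandrov) :
    2 * Fintype.card G.EndClass ≤ G.m + 2 := by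
  classical
  have h1 := G.arcGraph_connected.card_vert_le_card_edgeSet_add_one
  rw [Nat.card_eq_fintype_card (α := G.EndClass)] at h1
  have h2 : Nat.card G.arcGraph.edgeSet ≤ (Finset.univ.image G.endPair).card := by
    have hsub : G.arcGraph.edgeSet ⊆ ↑(Finset.univ.image G.endPair) := by
      intro e he
      rw [arcGraph, SimpleGraph.edgeSet_fromEdgeSet] at he
      obtain ⟨k, hk⟩ := he.1
      simp only [Finset.coe_image, Finset.coe_univ, Set.image_univ]
      exact ⟨k, hk⟩
    have := Set.ncard_le_ncard hsub (Finset.finite_toSet _)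
    rwa [Set.ncard_coe_finset] at this
  have h3 : 2 * (Finset.univ.image G.endPair).card ≤ (Finset.univ : Finset (Fin G.m)).card := by
    refine Finset.mul_card_image_le_card _ 2 fun e he => ?_
    obtain ⟨k, -, rfl⟩ := Finset.mem_image.1 he
    have : ({k, G.partner k} : Finset (Fin G.m)) ⊆
        {l ∈ (Finset.univ : Finset (Fin G.m)) | G.endPair l = G.endPair k} := by
      intro l hl
      simp only [Finset.mem_insert, Finset.mem_singleton] at hl
      rcases hl with rfl | rfl
      · simp
      · simp [hG.endPair_partner]
    rw [← Finset.card_pair (G.partner_ne k).symm]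
    exact Finset.card_le_card this
  rw [Finset.card_univ, Fintype.card_fin] at h3
  omega

open Classical in
variable (G) in
/-- The endpoints of arcs in a given class. -/
def fiber (q : G.EndClass) : Finset (Fin G.m) := {k | G.cls k = q}

open Classical in
variable (G) in
/-- The curvature at a class of endpoints. -/
def curvature (q : G.EndClass) : ℝ := 2 * Real.pi - ∑ k ∈ G.fiber q, P.faceAngle (G.startPt k)

open Classical in
variable (G) in
/-- The classes consisting of one endpoint. -/
def leafClasses : Finset G.EndClass := {q | (G.fiber q).card = 1}

theorem mem_fiber {q : G.EndClass} {k : Fin G.m} : k ∈ G.fiber q ↔ G.cls k = q := by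
  simp [fiber]

theorem fiber_card_pos (q : G.EndClass) : 0 < (G.fiber q).card := by
  induction q using Quotient.inductionOn with | _ a
  exact Finset.card_pos.2 ⟨a, mem_fiber.2 rfl⟩

theorem IsAleksandrov.curvature_nonneg (hG : G.IsAleksandrov) (q : G.EndClass) :
    0 ≤ G.curvature q := by
  classical
  have h := hG.angle_le ((G.fiber q).image G.startPt) (by
    intro x hx
    obtain ⟨k, -, rfl⟩ := Finset.mem_image.1 hx
    exact P.boundaryPoint_mem_bdry _) (by
    intro x hx y hy
    obtain ⟨k, hk, rfl⟩ := Finset.mem_image.1 hx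
    obtain ⟨l, hl, rfl⟩ := Finset.mem_image.1 hy
    exact cls_eq_iff.1 ((mem_fiber.1 hk).trans (mem_fiber.1 hl).symm))
  rw [Finset.sum_image (fun k _ l _ h => startPt_injective h)] at h
  exact sub_nonneg.2 h

/-- Combinatorial Gauss–Bonnet: the fibres partition the arc starts, and writing each face angle as
π minus its turning separates the Euler count from the turning. -/
theorem sum_curvature : ∑ q, G.curvature q = 2 * Real.pi * Fintype.card G.EndClass -
    Real.pi * G.m + ∑ k, (Real.pi - P.faceAngle (G.startPt k)) := by
  classical
  simp only [curvature, Finset.sum_sub_distrib, Finset.sum_const, Finset.card_univ, nsmul_eq_mul,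
    Fintype.card_fin]
  have : ∑ q, ∑ k ∈ G.fiber q, P.faceAngle (G.startPt k) = ∑ k, P.faceAngle (G.startPt k) := by
    simp only [fiber]
    exact Finset.sum_fiberwise _ _ _
  rw [this]
  ring

theorem sum_fiber_card : ∑ q, (G.fiber q).card = G.m := by
  classical
  have := Finset.card_eq_sum_card_fiberwise (s := (Finset.univ : Finset (Fin G.m)))
    (t := Finset.univ) (f := G.cls) (by simp)
  rw [Finset.card_univ, Fintype.card_fin] at this
  exact this.symm

/-- Only polygon vertices turn, and distinct arcs have distinct starts, so this is a partial sum of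
the total turning 2π. All turning angles are positive, so the full value is reached only if no
vertex is missed. -/
theorem sum_turn_start :
    ∑ k, (Real.pi - P.faceAngle (G.startPt k)) ≤ 2 * Real.pi ∧
    (2 * Real.pi ≤ ∑ k, (Real.pi - P.faceAngle (G.startPt k)) →
      ∀ i, ∃ k, G.startPt k = P.vertices i) := by
  classical
  set A := Finset.univ.image G.startPt
  set B := Finset.univ.image P.vertices
  have hA : ∑ k, (Real.pi - P.faceAngle (G.startPt k)) = ∑ x ∈ A ∩ B, (Real.pi - P.faceAngle x) := by
    rw [← Finset.sum_image (s := Finset.univ) (g := G.startPt) (f := fun x => Real.pi - P.faceAngle x)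
      (fun k _ l _ h => startPt_injective h)]
    refine (Finset.sum_subset Finset.inter_subset_left fun x hx hx' => ?_).symm
    rw [sub_eq_zero]
    by_contra h
    obtain ⟨i, hi⟩ := P.exists_vertices_eq_of_faceAngle_ne (Ne.symm h)
    exact hx' (Finset.mem_inter.2 ⟨hx, Finset.mem_image.2 ⟨i, Finset.mem_univ _, hi⟩⟩)
  have hB : ∑ x ∈ B, (Real.pi - P.faceAngle x) = 2 * Real.pi := by
    rw [Finset.sum_image (fun i _ j _ h => P.vertices_injective h)]
    exact P.sum_turn
  rw [hA, ← hB]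
  have hpos : ∀ x ∈ B, 0 < Real.pi - P.faceAngle x := by
    intro x hx
    obtain ⟨i, -, rfl⟩ := Finset.mem_image.1 hx
    exact P.turn_pos i
  refine ⟨Finset.sum_le_sum_of_subset_of_nonneg Finset.inter_subset_right
    fun x hx _ => (hpos x hx).le, fun hle i => ?_⟩
  by_contra hi
  have hiB : P.vertices i ∈ B := Finset.mem_image.2 ⟨i, Finset.mem_univ _, rfl⟩
  refine absurd hle (not_le.2 (Finset.sum_lt_sum_of_subset Finset.inter_subset_right hiB ?_
    (hpos _ hiB) fun x hx _ => (hpos x hx).le))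
  intro h
  obtain ⟨k, -, hk⟩ := Finset.mem_image.1 (Finset.mem_inter.1 h).1
  exact hi ⟨k, hk⟩

theorem curvature_of_leaf {q : G.EndClass} (hq : q ∈ G.leafClasses) :
    ∃ k, G.cls k = q ∧ G.curvature q = 2 * Real.pi - P.faceAngle (G.startPt k) := by
  classical
  simp only [leafClasses, Finset.mem_filter] at hq
  obtain ⟨k, hk⟩ := Finset.card_eq_one.1 hq.2
  refine ⟨k, mem_fiber.1 (by rw [hk]; simp), ?_⟩
  rw [curvature, hk, Finset.sum_singleton]

/-- The graph count contributes at most 2π, and the turning at most another 2π. -/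
theorem IsAleksandrov.sum_curvature_le (hG : G.IsAleksandrov) :
    ∑ q, G.curvature q ≤ 4 * Real.pi := by
  have h1 : (2 : ℝ) * Fintype.card G.EndClass ≤ G.m + 2 := by
    exact_mod_cast hG.two_mul_card_endClass_le
  rw [sum_curvature]
  nlinarith [(sum_turn_start (G := G)).1, Real.pi_pos]

theorem IsAleksandrov.sum_leaf_curvature_le (hG : G.IsAleksandrov) :
    ∑ q ∈ G.leafClasses, G.curvature q ≤ ∑ q, G.curvature q :=
  Finset.sum_le_sum_of_subset_of_nonneg (Finset.subset_univ _)
    fun q _ _ => hG.curvature_nonneg q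

theorem pi_le_curvature_of_leaf {q : G.EndClass} (hq : q ∈ G.leafClasses) :
    Real.pi ≤ G.curvature q := by
  obtain ⟨k, -, hk⟩ := curvature_of_leaf hq
  rw [hk]
  linarith [P.faceAngle_le_pi (G.startPt k)]

/-- An Aleksandrov gluing has at most four leaves. -/
theorem IsAleksandrov.card_leafClasses_le (hG : G.IsAleksandrov) : G.leafClasses.card ≤ 4 := by
  have h1 := Finset.card_nsmul_le_sum G.leafClasses G.curvature Real.pi
    fun q hq => pi_le_curvature_of_leaf hq
  have h2 := hG.sum_leaf_curvature_le
  have h3 := hG.sum_curvature_le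
  rw [nsmul_eq_mul] at h1
  have h4 : (G.leafClasses.card : ℝ) ≤ 4 := by
    by_contra h
    push Not at h
    nlinarith [Real.pi_pos]
  exact_mod_cast h4

/-- With four leaves, every vertex is glued at a flat branch point, so there are few vertices. -/
theorem IsAleksandrov.le_six_of_four_leaves (hG : G.IsAleksandrov)
    (hl : 4 ≤ G.leafClasses.card) : n ≤ 6 := by
  classical
  have hpi := Real.pi_pos
  have hcard : G.leafClasses.card = 4 := le_antisymm hG.card_leafClasses_le hl
  have h2 := hG.sum_leaf_curvature_le
  have h3 := hG.sum_curvature_le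
  have hsum4 : 4 * Real.pi ≤ ∑ q ∈ G.leafClasses, G.curvature q := by
    have h1 := Finset.card_nsmul_le_sum G.leafClasses G.curvature Real.pi
      fun q hq => pi_le_curvature_of_leaf hq
    rw [nsmul_eq_mul, hcard] at h1
    exact_mod_cast h1
  have h5 : (2 : ℝ) * Fintype.card G.EndClass ≤ G.m + 2 := by
    exact_mod_cast hG.two_mul_card_endClass_le
  have h6 := (sum_turn_start (G := G)).1
  have h7 := sum_curvature (G := G)
  -- Four leaves already carry curvature 4π, so all inequalities so far are equalities: every vertex
  -- is an arc start, the graph count is sharp, leaves have curvature exactly π and all other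
  -- classes are flat.
  have hturn : 2 * Real.pi ≤ ∑ k, (Real.pi - P.faceAngle (G.startPt k)) := by nlinarith
  have hvert := (sum_turn_start (G := G)).2 hturn
  have hQ : 2 * Fintype.card G.EndClass = G.m + 2 := by
    have : (2 : ℝ) * Fintype.card G.EndClass = G.m + 2 := by
      apply le_antisymm h5
      by_contra h
      push Not at h
      nlinarith
    exact_mod_cast this
  have hflat : ∀ q ∉ G.leafClasses, G.curvature q = 0 := by
    have hs : ∑ q ∈ Finset.univ \ G.leafClasses, G.curvature q = 0 := by
      have h8 := Finset.sum_sdiff (Finset.subset_univ G.leafClasses) (f := G.curvature)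
      have h9 : 0 ≤ ∑ q ∈ Finset.univ \ G.leafClasses, G.curvature q :=
        Finset.sum_nonneg fun q _ => hG.curvature_nonneg q
      linarith
    intro q hq
    exact (Finset.sum_eq_zero_iff_of_nonneg fun q _ => hG.curvature_nonneg q).1 hs q (by simp [hq])
  have hleaf : ∀ q ∈ G.leafClasses, G.curvature q = Real.pi := by
    have h8 : ∑ q ∈ G.leafClasses, (G.curvature q - Real.pi) = 0 := by
      rw [Finset.sum_sub_distrib, Finset.sum_const, hcard, nsmul_eq_mul]
      push_cast
      linarith
    intro q hq
    have := (Finset.sum_eq_zero_iff_of_nonneg fun q hq =>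
      sub_nonneg.2 (pi_le_curvature_of_leaf hq)).1 h8 q hq
    linarith
  choose v hv using hvert
  -- A vertex alone in its class has curvature above π, and a class of two points containing a
  -- vertex has positive curvature; both are excluded.
  have hbig : ∀ i, 3 ≤ (G.fiber (G.cls (v i))).card := by
    intro i
    have h1 := fiber_card_pos (G.cls (v i))
    have hmem : v i ∈ G.fiber (G.cls (v i)) := mem_fiber.2 rfl
    have hlt := P.faceAngle_vertex_lt_pi i
    by_contra hcon
    have hne : G.cls (v i) ∉ G.leafClasses := by
      intro h
      have h8 := hleaf _ h
      simp only [leafClasses, Finset.mem_filter, Finset.mem_univ, true_and] at h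
      obtain ⟨k, hk⟩ := Finset.card_eq_one.1 h
      rw [hk, Finset.mem_singleton] at hmem
      rw [curvature, hk, Finset.sum_singleton, ← hmem, hv] at h8
      linarith
    have h8 := hflat _ hne
    have h9 : (G.fiber (G.cls (v i))).card = 2 := by
      have : (G.fiber (G.cls (v i))).card ≠ 1 := fun h => hne (by simp [leafClasses, h])
      omega
    have h10 : ∑ k ∈ G.fiber (G.cls (v i)), P.faceAngle (G.startPt k) <
        ∑ k ∈ G.fiber (G.cls (v i)), Real.pi :=
      Finset.sum_lt_sum (fun k _ => P.faceAngle_le_pi _) ⟨v i, hmem, by rw [hv]; exact hlt⟩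
    rw [Finset.sum_const, h9, nsmul_eq_mul] at h10
    rw [curvature] at h8
    push_cast at h10
    linarith
  have hvinj : Function.Injective v := fun i j h => P.vertices_injective (by
    rw [← hv, ← hv, h])
  let big : Finset G.EndClass := {q | 3 ≤ (G.fiber q).card}
  have hn : n ≤ ∑ q ∈ big, (G.fiber q).card := by
    have h1 : (Finset.univ.image v) ⊆ big.biUnion G.fiber := by
      intro k hk
      obtain ⟨i, -, rfl⟩ := Finset.mem_image.1 hk
      exact Finset.mem_biUnion.2 ⟨_, Finset.mem_filter.2 ⟨Finset.mem_univ _, hbig i⟩,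
        mem_fiber.2 rfl⟩
    have h2 := (Finset.card_le_card h1).trans Finset.card_biUnion_le
    rwa [Finset.card_image_of_injective _ hvinj, Finset.card_univ, Fintype.card_fin] at h2
  -- For class sizes d the sum of d - 2 is `m - 2 * card EndClass = -2`. Since 3 (d - 2) ≥ d for d ≥
  -- 3, summation gives -6 ≥ (points in large classes) - 3 · 4, so at most six points lie in large
  -- classes.
  have hterm : ∀ q, (3 : ℤ) * ((G.fiber q).card - 2) ≥
      (if 3 ≤ (G.fiber q).card then ((G.fiber q).card : ℤ) else 0) -
      (if q ∈ G.leafClasses then 3 else 0) := by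
    intro q
    have h1 := fiber_card_pos q
    by_cases h : (G.fiber q).card = 1
    · have : q ∈ G.leafClasses := by simp [leafClasses, h]
      simp [this, h]
    · have : q ∉ G.leafClasses := by simp [leafClasses, h]
      rw [if_neg this]
      split_ifs <;> omega
  have hs := Finset.sum_le_sum fun q (_ : q ∈ Finset.univ) => hterm q
  rw [← Finset.mul_sum, Finset.sum_sub_distrib, Finset.sum_sub_distrib, ← Finset.sum_filter,
    ← Finset.sum_filter, Finset.sum_const, Finset.sum_const, Finset.card_univ] at hs
  have hf : (∑ q, ((G.fiber q).card : ℤ)) = G.m := by exact_mod_cast sum_fiber_card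
  rw [hf, Finset.filter_mem_eq_inter, Finset.univ_inter, hcard] at hs
  have hn' : (n : ℤ) ≤ ∑ q ∈ big, ((G.fiber q).card : ℤ) := by exact_mod_cast hn
  have hQ' : (2 : ℤ) * Fintype.card G.EndClass = G.m + 2 := by exact_mod_cast hQ
  simp only [nsmul_eq_mul] at hs
  push_cast at hs
  have : (n : ℤ) ≤ 6 := by linarith
  exact_mod_cast this

theorem Leaf.exists_cls {x : ℝ} (h : G.Leaf x) :
    ∃ k, P.boundaryPoint x = G.startPt k ∧ G.cls k ∈ G.leafClasses := by
  classical
  have hx : ¬ G.Interior x := by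
    rintro ⟨k, t, hk⟩
    have := h _ hk.rel_img
    refine hk.not_overlap (e := 0) this.symm ?_ ?_ (by ring)
    · rw [abs_zero]; exact hk.1
    · rw [abs_zero]; linarith [hk.2.1]
  obtain ⟨k, hk⟩ := exists_start_eq hx
  refine ⟨k, hk, ?_⟩
  rw [leafClasses, Finset.mem_filter]
  refine ⟨Finset.mem_univ _, Finset.card_eq_one.2 ⟨k, ?_⟩⟩
  ext l
  rw [mem_fiber, Finset.mem_singleton]
  constructor
  · intro hl
    have h1 := h (G.start l) ((Rel.of_eq hk).trans (cls_eq_iff.1 hl).symm)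
    exact startPt_injective (h1.trans hk)
  · rintro rfl; rfl

theorem IsAleksandrov.atMostThreeLeaves (hG : G.IsAleksandrov) (hn : 6 < n) :
    G.AtMostThreeLeaves := by
  classical
  intro a b c d hab hbc hcd hda ha hb hc hd
  obtain ⟨ka, ha1, ha2⟩ := ha.exists_cls
  obtain ⟨kb, hb1, hb2⟩ := hb.exists_cls
  obtain ⟨kc, hc1, hc2⟩ := hc.exists_cls
  obtain ⟨kd, hd1, hd2⟩ := hd.exists_cls
  have key : ∀ {x y : ℝ} {k l : Fin G.m}, G.Leaf x → x < y → y < x + P.perimeter →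
      P.boundaryPoint x = G.startPt k → P.boundaryPoint y = G.startPt l → G.cls k ≠ G.cls l := by
    intro x y k l hx hxy hyx hk hl h
    have h1 := hx y ((Rel.of_eq hk).trans ((cls_eq_iff.1 h).trans (Rel.of_eq hl).symm))
    have := P.eq_of_boundaryPoint_eq h1 (by rw [abs_lt]; constructor <;> linarith)
    linarith
  have hsub : ({G.cls ka, G.cls kb, G.cls kc, G.cls kd} : Finset G.EndClass) ⊆ G.leafClasses := by
    intro q hq
    simp only [Finset.mem_insert, Finset.mem_singleton] at hq
    rcases hq with rfl | rfl | rfl | rfl <;> assumption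
  have hcard : ({G.cls ka, G.cls kb, G.cls kc, G.cls kd} : Finset G.EndClass).card = 4 := by
    rw [Finset.card_insert_of_notMem, Finset.card_insert_of_notMem, Finset.card_pair]
    · exact key hc hcd (by linarith) hc1 hd1
    · simp only [Finset.mem_insert, Finset.mem_singleton, not_or]
      exact ⟨key hb hbc (by linarith) hb1 hc1, key hb (by linarith) (by linarith) hb1 hd1⟩
    · simp only [Finset.mem_insert, Finset.mem_singleton, not_or]
      exact ⟨key ha hab (by linarith) ha1 hb1, key ha (by linarith) (by linarith) ha1 hc1,
        key ha (by linarith) (by linarith) ha1 hd1⟩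
  have := hG.le_six_of_four_leaves (hcard ▸ Finset.card_le_card hsub)
  omega

end Gluing
end PolygonFolding
end

/-! ### When two gluings have the same tree -/

noncomputable section
namespace PolygonFolding

namespace ConvexPolygon
variable {n : ℕ} (P : ConvexPolygon n)

/-- The parameter is one of a vertex. -/
def IsMark (a : ℝ) : Prop := ∃ (i : Fin n) (k : ℤ), a = P.mark i + k * P.perimeter

variable {P}

theorem IsMark.shift {a : ℝ} (h : P.IsMark a) (j : ℤ) : P.IsMark (a + j * P.perimeter) := by
  obtain ⟨i, k, rfl⟩ := h
  exact ⟨i, k + j, by push_cast; ring⟩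

theorem isMark_mark (i : Fin n) : P.IsMark (P.mark i) := ⟨i, 0, by simp⟩

theorem isMark_edge_end (i : Fin n) : P.IsMark (P.mark i + P.edgeLength i) := by
  by_cases h : i.val + 1 = n
  · refine ⟨⟨0, P.pos⟩, 1, ?_⟩
    rw [P.mark_last i h, P.mark_zero]; simp
  · exact ⟨finRotate n i, 0, by rw [P.mark_finRotate i h]; simp⟩

theorem isMark_iff {a : ℝ} : P.IsMark a ↔ ∃ i, P.boundaryPoint a = P.vertices i := by
  constructor
  · rintro ⟨i, k, rfl⟩
    exact ⟨i, by rw [P.boundaryPoint_add_int_mul, P.boundaryPoint_mark]⟩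
  · rintro ⟨i, hi⟩
    rw [← P.boundaryPoint_mark] at hi
    obtain ⟨k, hk⟩ := P.boundaryPoint_eq_iff.1 hi.symm
    exact ⟨i, k, hk⟩

end ConvexPolygon

namespace Gluing
variable {n : ℕ} {P : ConvexPolygon n}

/-- The set of points glued to the point with a given parameter. -/
def classOf (G : Gluing P) (x : ℝ) : Set Plane := {y | G.setoid (P.boundaryPoint x) y}

/-- The parameter belongs to a node of the gluing tree. -/
def NodeParam (G : Gluing P) (x : ℝ) : Prop := G.IsNode (G.classOf x)

theorem mem_classOf {G : Gluing P} {x y : ℝ} :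
    P.boundaryPoint y ∈ G.classOf x ↔ G.Rel x y := Iff.rfl

theorem classOf_eq_iff {G : Gluing P} {x y : ℝ} : G.classOf x = G.classOf y ↔ G.Rel x y := by
  constructor
  · intro h
    have : P.boundaryPoint y ∈ G.classOf x := by rw [h]; exact Rel.refl y
    exact this
  · intro h
    ext z
    exact ⟨fun hz => G.setoid.trans h.symm hz, fun hz => G.setoid.trans h hz⟩

theorem IsNode.exists_classOf {G : Gluing P} {c : Set Plane} (h : G.IsNode c) :
    ∃ x, c = G.classOf x := by
  obtain ⟨⟨x, hx, rfl⟩, -⟩ := h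
  obtain ⟨t, -, -, rfl⟩ := P.exists_boundaryPoint_eq hx 0
  exact ⟨t, rfl⟩

theorem IsNode.eq_classOf {G : Gluing P} {c : Set Plane} (h : G.IsNode c) {x : ℝ}
    (hx : P.boundaryPoint x ∈ c) : c = G.classOf x := by
  obtain ⟨y, rfl⟩ := h.exists_classOf
  exact classOf_eq_iff.2 hx

/-- A correspondence between the parameters of nodes of two gluings, compatible with the order, the
gluings, and the vertices. -/
structure NodeMatch (G G' : Gluing P) (Γ : ℝ → ℝ → Prop) : Prop where
  dom : ∀ x, G.NodeParam x → ∃ x', Γ x x'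
  cod : ∀ x', G'.NodeParam x' → ∃ x, Γ x x'
  node : ∀ x x', Γ x x' → G.NodeParam x ∧ G'.NodeParam x'
  le_iff : ∀ x x' y y', Γ x x' → Γ y y' → (x ≤ y ↔ x' ≤ y')
  rel_iff : ∀ x x' y y', Γ x x' → Γ y y' → (G.Rel x y ↔ G'.Rel x' y')
  mark : ∀ a, P.IsMark a → Γ a a

variable {G G' : Gluing P} {Γ : ℝ → ℝ → Prop}

theorem NodeMatch.symm (h : NodeMatch G G' Γ) : NodeMatch G' G fun x y => Γ y x where
  dom := h.cod
  cod := h.dom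
  node x x' hx := (h.node x' x hx).symm
  le_iff x x' y y' hx hy := (h.le_iff x' x y' y hx hy).symm
  rel_iff x x' y y' hx hy := (h.rel_iff x' x y' y hx hy).symm
  mark := h.mark

theorem NodeMatch.lt_iff (h : NodeMatch G G' Γ) {x x' y y' : ℝ} (hx : Γ x x') (hy : Γ y y') :
    x < y ↔ x' < y' := by
  rw [← not_le, ← not_le, h.le_iff y y' x x' hy hx]

/-- The correspondence preserves order and reaches every node parameter of the other gluing, so a
node between the images would come from a node between the originals. -/
theorem NodeMatch.adj (h : NodeMatch G G' Γ) {x x' y y' : ℝ} (hx : Γ x x') (hy : Γ y y')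
    (hr : ∃ s t : ℝ, s < t ∧ P.boundaryPoint s ∈ G.classOf x ∧ P.boundaryPoint t ∈ G.classOf y ∧
      ∀ u ∈ Set.Ioo s t, ∀ e, G.IsNode e → P.boundaryPoint u ∉ e) :
    ∃ s t : ℝ, s < t ∧ P.boundaryPoint s ∈ G'.classOf x' ∧ P.boundaryPoint t ∈ G'.classOf y' ∧
      ∀ u ∈ Set.Ioo s t, ∀ e, G'.IsNode e → P.boundaryPoint u ∉ e := by
  obtain ⟨s, t, hst, hs, ht, hu⟩ := hr
  obtain ⟨s', hs'⟩ := h.dom s (by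
    rw [NodeParam, ← classOf_eq_iff.2 (mem_classOf.1 hs)]; exact (h.node _ _ hx).1)
  obtain ⟨t', ht'⟩ := h.dom t (by
    rw [NodeParam, ← classOf_eq_iff.2 (mem_classOf.1 ht)]; exact (h.node _ _ hy).1)
  refine ⟨s', t', (h.lt_iff hs' ht').1 hst, (h.rel_iff _ _ _ _ hx hs').1 hs,
    (h.rel_iff _ _ _ _ hy ht').1 ht, ?_⟩
  intro u' hu' e he hue
  have he' := he.eq_classOf hue
  obtain ⟨u, huu⟩ := h.cod u' (by rw [NodeParam, ← he']; exact he)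
  exact hu u ⟨(h.lt_iff hs' huu).2 hu'.1, (h.lt_iff huu ht').2 hu'.2⟩ _ (h.node _ _ huu).1
    (Rel.refl u)

/-- An edge label says that some parameter of the class lies strictly between two consecutive marks;
marks correspond to themselves and order is preserved. -/
theorem NodeMatch.label (h : NodeMatch G G' Γ) {x x' : ℝ} (hx : Γ x x') {a : Fin n ⊕ Fin n}
    (ha : ∃ z ∈ P.elementSet a, z ∈ G.classOf x) : ∃ z ∈ P.elementSet a, z ∈ G'.classOf x' := by
  obtain ⟨z, hz, hzx⟩ := ha
  have hzb : z ∈ P.bdry := (mem_bdry_iff_of_setoid hzx).1 (P.boundaryPoint_mem_bdry x)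
  obtain ⟨u, -, -, rfl⟩ := P.exists_boundaryPoint_eq hzb 0
  obtain ⟨u', hu'⟩ := h.dom u (by
    rw [NodeParam, ← classOf_eq_iff.2 (mem_classOf.1 hzx)]; exact (h.node _ _ hx).1)
  refine ⟨P.boundaryPoint u', ?_, (h.rel_iff _ _ _ _ hx hu').1 hzx⟩
  cases a with
  | inl i =>
    rw [P.boundaryPoint_mem_inl] at hz ⊢
    obtain ⟨k, hk⟩ := hz
    have hm := h.mark u ⟨i, k, hk⟩
    refine ⟨k, hk ▸ le_antisymm ?_ ?_⟩
    · exact (h.le_iff _ _ _ _ hu' hm).1 le_rfl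
    · exact (h.le_iff _ _ _ _ hm hu').1 le_rfl
  | inr i =>
    rw [P.boundaryPoint_mem_inr] at hz ⊢
    obtain ⟨k, hk1, hk2⟩ := hz
    have h1 := h.mark _ ((ConvexPolygon.isMark_mark i).shift k)
    have h2 := h.mark _ ((ConvexPolygon.isMark_edge_end i).shift k)
    exact ⟨k, (h.lt_iff h1 hu').1 hk1, (h.lt_iff hu' h2).1 hk2⟩

/-- Gluings with matching node parameters have the same gluing tree. -/
theorem NodeMatch.same (h : NodeMatch G G' Γ) :
    LabeledGraph.Same G.gluingTree G'.gluingTree := by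
  have hex : ∀ c : {c : Set Plane // G.IsNode c}, ∃ x x', c.1 = G.classOf x ∧ Γ x x' := by
    rintro ⟨c, hc⟩
    obtain ⟨x, rfl⟩ := hc.exists_classOf
    obtain ⟨x', hx'⟩ := h.dom x hc
    exact ⟨x, x', rfl, hx'⟩
  choose r r' hr hrr using hex
  let f : {c : Set Plane // G.IsNode c} → {c : Set Plane // G'.IsNode c} := fun c =>
    ⟨G'.classOf (r' c), (h.node _ _ (hrr c)).2⟩
  have hf : Function.Bijective f := by
    constructor
    · intro c d hcd
      have h1 := classOf_eq_iff.1 (congrArg Subtype.val hcd)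
      ext1
      rw [hr c, hr d, classOf_eq_iff]
      exact (h.rel_iff _ _ _ _ (hrr c) (hrr d)).2 h1
    · rintro ⟨d, hd⟩
      obtain ⟨y', rfl⟩ := hd.exists_classOf
      obtain ⟨y, hy⟩ := h.cod y' hd
      refine ⟨⟨G.classOf y, (h.node _ _ hy).1⟩, ?_⟩
      ext1
      change G'.classOf (r' _) = _
      rw [classOf_eq_iff, ← h.rel_iff _ _ _ _ (hrr _) hy, ← classOf_eq_iff, ← hr]
  refine ⟨⟨Equiv.ofBijective f hf, ?_⟩, ?_⟩
  · intro (c : {c : Set Plane // G.IsNode c}) (d : {c : Set Plane // G.IsNode c})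
    refine (SimpleGraph.fromRel_adj _ (f c) (f d)).trans
      (Iff.trans ?_ (SimpleGraph.fromRel_adj _ c d).symm)
    refine and_congr hf.1.ne_iff (or_congr ?_ ?_)
    · rw [hr c, hr d]
      exact ⟨h.symm.adj (hrr c) (hrr d), h.adj (hrr c) (hrr d)⟩
    · rw [hr c, hr d]
      exact ⟨h.symm.adj (hrr d) (hrr c), h.adj (hrr d) (hrr c)⟩
  · intro c
    ext a
    change (∃ z ∈ P.elementSet a, z ∈ G'.classOf (r' c)) ↔ ∃ z ∈ P.elementSet a, z ∈ c.1
    rw [hr c]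
    exact ⟨h.symm.label (hrr c), h.label (hrr c)⟩

end Gluing

namespace ConvexPolygon
variable {n : ℕ} (P : ConvexPolygon n)

/-- Two periodic sequences of cut points in the same position relative to the vertices and to the
reflections of the vertices. -/
structure SeqCompat (p p' : ℤ → ℝ) : Prop where
  mono : StrictMono p
  mono' : StrictMono p'
  period : ∃ k : ℤ, 0 < k ∧ ∀ i j : ℤ, p (j + k * i) = p j + i * P.perimeter ∧
    p' (j + k * i) = p' j + i * P.perimeter
  le_iff : ∀ a, P.IsMark a → ∀ j, a ≤ p j ↔ a ≤ p' j
  ge_iff : ∀ a, P.IsMark a → ∀ j, p j ≤ a ↔ p' j ≤ a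
  add_le_iff : ∀ a b, P.IsMark a → P.IsMark b → ∀ j,
    a + b ≤ p j + p (j + 1) ↔ a + b ≤ p' j + p' (j + 1)
  add_ge_iff : ∀ a b, P.IsMark a → P.IsMark b → ∀ j,
    p j + p (j + 1) ≤ a + b ↔ p' j + p' (j + 1) ≤ a + b

/-- The correspondence of vertices, cut points, midpoints, and reflected vertices. -/
inductive SeqMatch (p p' : ℤ → ℝ) : ℝ → ℝ → Prop
  | mark (a : ℝ) (ha : P.IsMark a) : SeqMatch p p' a a
  | cut (j : ℤ) : SeqMatch p p' (p j) (p' j)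
  | mid (j : ℤ) : SeqMatch p p' ((p j + p (j + 1)) / 2) ((p' j + p' (j + 1)) / 2)
  | refl (j : ℤ) (a : ℝ) (ha : P.IsMark a) (h0 : p j ≤ a) (h1 : a ≤ p (j + 1)) :
    SeqMatch p p' (p j + p (j + 1) - a) (p' j + p' (j + 1) - a)

variable {P} {p p' : ℤ → ℝ}

theorem SeqCompat.symm (h : P.SeqCompat p p') : P.SeqCompat p' p where
  mono := h.mono'
  mono' := h.mono
  period := by
    obtain ⟨k, hk, h1⟩ := h.period
    exact ⟨k, hk, fun i j => (h1 i j).symm⟩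
  le_iff a ha j := (h.le_iff a ha j).symm
  ge_iff a ha j := (h.ge_iff a ha j).symm
  add_le_iff a b ha hb j := (h.add_le_iff _ _ ha hb j).symm
  add_ge_iff a b ha hb j := (h.add_ge_iff a b ha hb j).symm

theorem SeqMatch.symm (h : P.SeqCompat p p') {x x' : ℝ} (hx : P.SeqMatch p p' x x') :
    P.SeqMatch p' p x' x := by
  cases hx with
  | mark _ ha => exact .mark _ ha
  | cut j => exact .cut j
  | mid j => exact .mid j
  | refl j a ha h0 h1 => exact .refl j a ha ((h.ge_iff a ha j).1 h0) ((h.le_iff a ha _).1 h1)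

theorem SeqCompat.eq_of_eq (h : P.SeqCompat p p') {a : ℝ} (ha : P.IsMark a) {j : ℤ}
    (hj : a = p j) : a = p' j :=
  le_antisymm ((h.le_iff a ha j).1 hj.le) ((h.ge_iff a ha j).1 hj.ge)

/-- Within one arc, comparing marks, midpoints and mirror images amounts to comparing a sum of two
marks with `p j + p (j + 1)`; comparing with a cut uses the position of marks relative to cuts.
Candidates in different arcs are separated by cuts, except when a reflected mark coincides with a
cut, which `SeqCompat.eq_of_eq` transfers. -/
theorem SeqCompat.le_of_le (h : P.SeqCompat p p') {x x' y y' : ℝ} (hx : P.SeqMatch p p' x x')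
    (hy : P.SeqMatch p p' y y') (hxy : x ≤ y) : x' ≤ y' := by
  have lt1 : ∀ j, p j < p (j + 1) := fun j => h.mono (by omega)
  have lt1' : ∀ j, p' j < p' (j + 1) := fun j => h.mono' (by omega)
  have step : ∀ {i j : ℤ}, i < j → p (i + 1) ≤ p j := fun hij => h.mono.monotone (by omega)
  have step' : ∀ {i j : ℤ}, i < j → p' (i + 1) ≤ p' j := fun hij => h.mono'.monotone (by omega)
  have tight : ∀ {i j : ℤ}, j < i → p i ≤ p (j + 1) → i = j + 1 := by
    intro i j hij hle
    have := h.mono.le_iff_le.1 hle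
    omega
  have refl_mem : ∀ {j : ℤ} {a : ℝ}, P.IsMark a → p j ≤ a → a ≤ p (j + 1) →
      p' j ≤ a ∧ a ≤ p' (j + 1) := fun ha h0 h1 =>
    ⟨(h.ge_iff _ ha _).1 h0, (h.le_iff _ ha _).1 h1⟩
  cases hx with
  | mark _ ha =>
    cases hy with
    | mark _ hb => exact hxy
    | cut j => exact (h.le_iff _ ha j).1 hxy
    | mid j =>
      have := (h.add_le_iff _ _ ha ha j).1 (by linarith)
      linarith
    | refl j b hb h0 h1 =>
      have := (h.add_le_iff _ _ ha hb j).1 (by linarith)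
      linarith
  | cut i =>
    cases hy with
    | mark _ hb => exact (h.ge_iff _ hb i).1 hxy
    | cut j => exact h.mono'.monotone (h.mono.le_iff_le.1 hxy)
    | mid j =>
      have : i < j + 1 := h.mono.lt_iff_lt.1 (by linarith [lt1 j])
      have h2 : p' i ≤ p' j := h.mono'.monotone (by omega)
      linarith [lt1' j]
    | refl j b hb h0 h1 =>
      obtain ⟨h0', h1'⟩ := refl_mem hb h0 h1
      by_cases hij : i ≤ j
      · have h2 : p' i ≤ p' j := h.mono'.monotone hij
        linarith
      · obtain rfl := tight (not_le.1 hij) (by linarith)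
        have := h.eq_of_eq hb (j := j) (by linarith)
        linarith
  | mid i =>
    cases hy with
    | mark _ hb =>
      have := (h.add_ge_iff _ _ hb hb i).1 (by linarith)
      linarith
    | cut j =>
      have : i < j := h.mono.lt_iff_lt.1 (by linarith [lt1 i])
      linarith [step' this, lt1' i]
    | mid j =>
      have : i ≤ j := by
        by_contra hij
        linarith [step (not_le.1 hij), lt1 i, lt1 j]
      rcases this.eq_or_lt with rfl | hij
      · exact le_rfl
      · linarith [step' hij, lt1' i, lt1' j]
    | refl j b hb h0 h1 =>
      obtain ⟨h0', h1'⟩ := refl_mem hb h0 h1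
      rcases lt_trichotomy i j with hij | rfl | hij
      · linarith [step' hij, lt1' i]
      · have := (h.add_le_iff b b hb hb i).1 (by linarith)
        linarith
      · linarith [step hij, lt1 i]
  | refl i a ha h0 h1 =>
    obtain ⟨h0', h1'⟩ := refl_mem ha h0 h1
    cases hy with
    | mark _ hb =>
      have := (h.add_ge_iff _ _ ha hb i).1 (by linarith)
      linarith
    | cut j =>
      by_cases hij : i < j
      · linarith [step' hij]
      · have h2 : p j ≤ p i := h.mono.monotone (by omega)
        have h3 : p i ≤ p j := by linarith
        obtain rfl := h.mono.injective (le_antisymm h2 h3)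
        have := h.eq_of_eq ha (j := j + 1) (by linarith)
        linarith
    | mid j =>
      rcases lt_trichotomy i j with hij | rfl | hij
      · linarith [step' hij, lt1' j]
      · have := (h.add_ge_iff a a ha ha i).1 (by linarith)
        linarith
      · linarith [step hij, lt1 j]
    | refl j b hb k0 k1 =>
      obtain ⟨k0', k1'⟩ := refl_mem hb k0 k1
      rcases lt_trichotomy i j with hij | rfl | hij
      · linarith [step' hij]
      · linarith
      · obtain rfl := tight hij (by linarith)
        have e1 := h.eq_of_eq ha (j := j + 1 + 1) (by linarith)
        have e2 := h.eq_of_eq hb (j := j) (by linarith)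
        linarith

theorem SeqMatch.shift (h : P.SeqCompat p p') {x x' : ℝ} (hx : P.SeqMatch p p' x x') (i : ℤ) :
    P.SeqMatch p p' (x + i * P.perimeter) (x' + i * P.perimeter) := by
  obtain ⟨k, hk, hper⟩ := h.period
  cases hx with
  | mark _ ha => exact .mark _ (ha.shift i)
  | cut j => rw [← (hper i j).1, ← (hper i j).2]; exact .cut _
  | mid j =>
    have h1 := SeqMatch.mid (P := P) (p := p) (p' := p') (j + k * i)
    rw [show j + k * i + 1 = j + 1 + k * i by ring, (hper i j).1, (hper i j).2, (hper i (j + 1)).1,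
      (hper i (j + 1)).2] at h1
    convert h1 using 1 <;> ring
  | refl j a ha h0 h1 =>
    have e : j + k * i + 1 = j + 1 + k * i := by ring
    have h2 := SeqMatch.refl (P := P) (p := p) (p' := p') (j + k * i) _ (ha.shift i)
      (by rw [(hper i j).1]; linarith) (by rw [e, (hper i (j + 1)).1]; linarith)
    rw [e, (hper i j).1, (hper i j).2, (hper i (j + 1)).1, (hper i (j + 1)).2] at h2
    convert h2 using 1 <;> ring

/-- Folding an arc swaps its cuts, fixes its midpoint and exchanges marks with their mirror images,
so the correspondence is stable. A mirror image taken in a neighbouring arc can only be the common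
cut. -/
theorem SeqMatch.reflect (h : P.SeqCompat p p') {x x' : ℝ} (hx : P.SeqMatch p p' x x') {l : ℤ}
    (hl0 : p l ≤ x) (hl1 : x ≤ p (l + 1)) :
    P.SeqMatch p p' (p l + p (l + 1) - x) (p' l + p' (l + 1) - x') := by
  have lt1 : ∀ j, p j < p (j + 1) := fun j => h.mono (by omega)
  have fst : P.SeqMatch p p' (p l + p (l + 1) - p (l + 1)) (p' l + p' (l + 1) - p' (l + 1)) := by
    simpa using SeqMatch.cut l
  have snd : P.SeqMatch p p' (p l + p (l + 1) - p l) (p' l + p' (l + 1) - p' l) := by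
    simpa using SeqMatch.cut (l + 1)
  cases hx with
  | mark _ ha => exact .refl l _ ha hl0 hl1
  | cut j =>
    have h1 := h.mono.le_iff_le.1 hl0
    have h2 := h.mono.le_iff_le.1 hl1
    rcases h1.eq_or_lt with rfl | h1
    · exact snd
    · obtain rfl : j = l + 1 := by omega
      exact fst
  | mid j =>
    have h1 : l < j + 1 := h.mono.lt_iff_lt.1 (by linarith [lt1 j])
    have h2 : j < l + 1 := h.mono.lt_iff_lt.1 (by linarith [lt1 j])
    obtain rfl : j = l := by omega
    convert SeqMatch.mid (P := P) (p := p) (p' := p') j using 1 <;> ring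
  | refl j a ha h0 h1 =>
    rcases lt_trichotomy j l with hjl | rfl | hjl
    · have h2 : p (j + 1) ≤ p l := h.mono.monotone (by omega)
      have h3 : a = p j := by linarith
      have h4 := h.eq_of_eq ha h3
      obtain rfl : j + 1 = l := h.mono.injective (by linarith)
      rw [h3, add_sub_cancel_left, show p' j + p' (j + 1) - p j = p' (j + 1) by linarith]
      exact snd
    · convert SeqMatch.mark (P := P) (p := p) (p' := p') a ha using 1 <;> ring
    · have h2 : p (l + 1) ≤ p j := h.mono.monotone (by omega)
      have h3 : a = p (j + 1) := by linarith
      have h4 := h.eq_of_eq ha h3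
      obtain rfl : l + 1 = j := h.mono.injective (by linarith)
      rw [h3, add_sub_cancel_right, show p' (l + 1) + p' (l + 1 + 1) - p (l + 1 + 1) = p' (l + 1) by
        linarith]
      exact fst

end ConvexPolygon

namespace Gluing
open ConvexPolygon
variable {n : ℕ} {P : ConvexPolygon n} {G G' : Gluing P} {p p' : ℤ → ℝ}

/-- The description in `FoldedBy` uses only order, translation, reflection and the cuts, all of
which the correspondence preserves. -/
theorem FoldedBy.rel_of_rel (hp : G.FoldedBy p) (hp' : G'.FoldedBy p') (h : P.SeqCompat p p')
    {x x' y y' : ℝ} (hx : P.SeqMatch p p' x x') (hy : P.SeqMatch p p' y y') (hxy : G.Rel x y) :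
    G'.Rel x' y' := by
  have eq_of_eq : ∀ {u u' v v' : ℝ}, P.SeqMatch p p' u u' → P.SeqMatch p p' v v' → u = v → u' = v' :=
    fun hu hv huv => le_antisymm (h.le_of_le hu hv huv.le) (h.le_of_le hv hu huv.ge)
  rw [hp' x' y']
  rcases (hp x y).1 hxy with ⟨i, hi⟩ | ⟨i, i', j, h0, h1, h2⟩ | ⟨j, l, h0, h1⟩
  · exact Or.inl ⟨i, eq_of_eq hy (hx.shift h i) hi⟩
  · refine Or.inr (Or.inl ⟨i, i', j, h.le_of_le (.cut j) (hx.shift h i) h0,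
      h.le_of_le (hx.shift h i) (.cut (j + 1)) h1, ?_⟩)
    have := eq_of_eq (hy.shift h i') ((hx.shift h i).reflect h h0 h1) (by linarith)
    linarith
  · exact Or.inr (Or.inr ⟨j, l, eq_of_eq hx (.cut j) h0, eq_of_eq hy (.cut l) h1⟩)

theorem nodeParam_of_ncard {x : ℝ} (h : (G.classOf x).ncard ≠ 2) : G.NodeParam x :=
  ⟨⟨_, P.boundaryPoint_mem_bdry x, rfl⟩, Or.inl h⟩

theorem nodeParam_of_rel_mark {x a : ℝ} (ha : P.IsMark a) (h : G.Rel x a) : G.NodeParam x := by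
  obtain ⟨i, hi⟩ := isMark_iff.1 ha
  refine ⟨⟨_, P.boundaryPoint_mem_bdry x, rfl⟩, Or.inr ⟨i, ?_⟩⟩
  rw [← hi]
  exact h

theorem Leaf.nodeParam {x : ℝ} (h : G.Leaf x) : G.NodeParam x := by
  apply nodeParam_of_ncard
  have : G.classOf x = {P.boundaryPoint x} := by
    ext y
    constructor
    · intro hy
      have hyb := (mem_bdry_iff_of_setoid hy).1 (P.boundaryPoint_mem_bdry x)
      obtain ⟨t, -, -, rfl⟩ := P.exists_boundaryPoint_eq hyb 0
      exact h t hy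
    · rintro rfl
      exact Rel.refl x
  rw [this, Set.ncard_singleton]
  norm_num

theorem FoldsAlong.seqMatch_node (hG : G.IsAleksandrov) (hp : G.FoldsAlong p)
    (hcut : ∀ j, G.NodeParam (p j)) {x x' : ℝ} (hx : P.SeqMatch p p' x x') : G.NodeParam x := by
  cases hx with
  | mark _ ha => exact nodeParam_of_rel_mark ha (Rel.refl _)
  | cut j => exact hcut j
  | mid j => exact (hG.leaf_of_fold (hp.arc j).lt (hp.arc j).fold).nodeParam
  | refl j a ha h0 h1 =>
    refine nodeParam_of_rel_mark ha ?_
    have := (hp.arc j).fold (a - p j) (by linarith) (by linarith)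
    rw [add_sub_cancel, show p (j + 1) - (a - p j) = p j + p (j + 1) - a by ring] at this
    exact this.symm

/-- Strictly inside a folded arc and off its midpoint, a class has exactly two points, a point and
its mirror image. It is a node only through a vertex, so the parameter is a mark or a reflected
mark. -/
theorem FoldsAlong.exists_seqMatch (hp : G.FoldsAlong p) (h : P.SeqCompat p p') {x : ℝ}
    (hx : G.NodeParam x) : ∃ x', P.SeqMatch p p' x x' := by
  obtain ⟨j, hj0, hj1⟩ := hp.cover x
  rcases hj0.eq_or_lt with rfl | hj0
  · exact ⟨_, .cut j⟩
  by_contra hno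
  have hmid : x ≠ p j + p (j + 1) - x := fun hmid => hno ⟨_, by
    have := SeqMatch.mid (P := P) (p := p) (p' := p') j
    rwa [show (p j + p (j + 1)) / 2 = x by linarith] at this⟩
  have hlen : p (j + 1) - p j ≤ P.perimeter := by
    obtain ⟨k, hk, hper⟩ := h.period
    have h1 := (hper 1 j).1
    have h2 : p (j + 1) ≤ p (j + k * 1) := h.mono.monotone (by omega)
    push_cast at h1
    linarith
  have hne : P.boundaryPoint x ≠ P.boundaryPoint (p j + p (j + 1) - x) := fun heq =>
    hmid (P.eq_of_boundaryPoint_eq heq (by rw [abs_lt]; constructor <;> linarith))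
  have hR : G.Rel x (p j + p (j + 1) - x) := by
    have := (hp.arc j).fold (x - p j) (by linarith) (by linarith)
    rwa [add_sub_cancel, show p (j + 1) - (x - p j) = p j + p (j + 1) - x by ring] at this
  have hclass : G.classOf x = {P.boundaryPoint x, P.boundaryPoint (p j + p (j + 1) - x)} := by
    ext y
    simp only [Set.mem_insert_iff, Set.mem_singleton_iff]
    constructor
    · intro hy
      have hyb := (mem_bdry_iff_of_setoid hy).1 (P.boundaryPoint_mem_bdry x)
      obtain ⟨t, -, -, rfl⟩ := P.exists_boundaryPoint_eq hyb 0
      exact (hp.arc j).only x t hj0 hj1 hy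
    · rintro (rfl | rfl)
      · exact Rel.refl x
      · exact hR
  rcases hx.2 with h1 | ⟨i, hi⟩
  · rw [hclass, Set.ncard_pair hne] at h1
    exact h1 rfl
  · rw [hclass] at hi
    rcases hi with hi | hi
    · exact hno ⟨x, .mark x (isMark_iff.2 ⟨i, hi.symm⟩)⟩
    · have ha : P.IsMark (p j + p (j + 1) - x) := isMark_iff.2 ⟨i, hi.symm⟩
      have h2 := SeqMatch.refl (P := P) (p := p) (p' := p') j _ ha (by linarith) (by linarith)
      rw [sub_sub_cancel] at h2
      exact hno ⟨_, h2⟩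

/-- Gluings folding the boundary along compatible sequences have the same gluing tree. -/
theorem FoldsAlong.same (hG : G.IsAleksandrov) (hG' : G'.IsAleksandrov) (hp : G.FoldsAlong p)
    (hp' : G'.FoldsAlong p') (hcut : ∀ j, G.NodeParam (p j)) (hcut' : ∀ j, G'.NodeParam (p' j))
    (h : P.SeqCompat p p') : LabeledGraph.Same G.gluingTree G'.gluingTree := by
  refine NodeMatch.same (Γ := P.SeqMatch p p') ⟨?_, ?_, ?_, ?_, ?_, ?_⟩
  · exact fun x hx => hp.exists_seqMatch h hx
  · intro x' hx'
    obtain ⟨x, hx⟩ := hp'.exists_seqMatch h.symm hx'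
    exact ⟨x, hx.symm h.symm⟩
  · exact fun x x' hx => ⟨hp.seqMatch_node hG hcut hx, hp'.seqMatch_node hG' hcut' (hx.symm h)⟩
  · exact fun x x' y y' hx hy => ⟨h.le_of_le hx hy, h.symm.le_of_le (hx.symm h) (hy.symm h)⟩
  · exact fun x x' y y' hx hy => ⟨hp.foldedBy.rel_of_rel hp'.foldedBy h hx hy,
      hp'.foldedBy.rel_of_rel hp.foldedBy h.symm (hx.symm h) (hy.symm h)⟩
  · exact fun a ha => .mark a ha

end Gluing
end PolygonFolding
end

/-! ### Counting positions relative to finitely many values -/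

noncomputable section
namespace PolygonFolding

theorem finite_ncard_le_of_code {α β : Type*} {S : Set α} (K : Finset β) (Q : α → β → Prop)
    (h1 : ∀ a ∈ S, ∃ b ∈ K, Q a b) (h2 : ∀ a ∈ S, ∀ a' ∈ S, ∀ b, Q a b → Q a' b → a = a') :
    S.Finite ∧ S.ncard ≤ K.card := by
  classical
  rcases S.eq_empty_or_nonempty with rfl | ⟨a0, ha0⟩
  · simp
  obtain ⟨b0, -, -⟩ := h1 a0 ha0
  have h3 : ∀ a, ∃ b, a ∈ S → b ∈ K ∧ Q a b := fun a => by
    by_cases ha : a ∈ S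
    · obtain ⟨b, hb⟩ := h1 a ha
      exact ⟨b, fun _ => hb⟩
    · exact ⟨b0, fun h => absurd h ha⟩
  choose f hf using h3
  have hmaps : Set.MapsTo f S ↑K := fun a ha => (hf a ha).1
  have hinj : Set.InjOn f S := fun a ha a' ha' h =>
    h2 a ha a' ha' (f a) (hf a ha).2 (h ▸ (hf a' ha').2)
  refine ⟨Set.Finite.of_injOn hmaps hinj K.finite_toSet, ?_⟩
  have := Set.ncard_le_ncard_of_injOn f hmaps hinj K.finite_toSet
  rwa [Set.ncard_coe_finset] at this

theorem finite_ncard_le_of_subset_iUnion {α ι : Type*} {S : Set α} (I : Finset ι) (U : ι → Set α)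
    {B : ℕ} (hS : S ⊆ ⋃ i ∈ I, U i) (hU : ∀ i, (U i).Finite ∧ (U i).ncard ≤ B) :
    S.Finite ∧ S.ncard ≤ I.card * B := by
  have hfin : (⋃ i ∈ I, U i).Finite := I.finite_toSet.biUnion fun i _ => (hU i).1
  refine ⟨hfin.subset hS, (Set.ncard_le_ncard hS hfin).trans ?_⟩
  clear hS hfin
  classical
  induction I using Finset.induction_on with
  | empty => simp
  | insert i I hi ih =>
    rw [Finset.set_biUnion_insert, Finset.card_insert_of_notMem hi]
    refine (Set.ncard_union_le _ _).trans ?_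
    have := (hU i).2
    linarith

theorem finite_ncard_le_union {α : Type*} {S T : Set α} {a b : ℕ} (hS : S.Finite ∧ S.ncard ≤ a)
    (hT : T.Finite ∧ T.ncard ≤ b) : (S ∪ T).Finite ∧ (S ∪ T).ncard ≤ a + b :=
  ⟨hS.1.union hT.1, (Set.ncard_union_le _ _).trans (add_le_add hS.2 hT.2)⟩

/-- Two reals have the same position relative to a third. -/
def SameSide (s s' σ : ℝ) : Prop := (σ ≤ s ↔ σ ≤ s') ∧ (s ≤ σ ↔ s' ≤ σ)

theorem SameSide.refl (s σ : ℝ) : SameSide s s σ := ⟨Iff.rfl, Iff.rfl⟩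

theorem SameSide.of_sub_eq {x x' u y y' z : ℝ} (hs : SameSide x x' u) (e : y - z = x - u)
    (e' : y' - z = x' - u) : SameSide y y' z := by
  obtain rfl : y = x + (z - u) := by linarith
  obtain rfl : y' = x' + (z - u) := by linarith
  obtain ⟨⟨h1, h2⟩, h3, h4⟩ := hs
  refine ⟨⟨fun h => ?_, fun h => ?_⟩, fun h => ?_, fun h => ?_⟩
  · linarith [h1 (by linarith)]
  · linarith [h2 (by linarith)]
  · linarith [h3 (by linarith)]
  · linarith [h4 (by linarith)]

/-- A code for the position of a real number relative to finitely many others. -/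
def posCode (A : Finset ℝ) (s : ℝ) : ℕ := (A.filter (· < s)).card + (A.filter (· ≤ s)).card

theorem posCode_le (A : Finset ℝ) (s : ℝ) : posCode A s ≤ 2 * A.card := by
  have h1 := Finset.card_filter_le A (· < s)
  have h2 := Finset.card_filter_le A (· ≤ s)
  unfold posCode
  omega

/-- Both filtered sets grow with `s`, so equality of the sum of their sizes forces equality of each.
Counting `<` and `≤` together also detects `s = σ`. -/
theorem sameSide_of_posCode_eq {A : Finset ℝ} {s s' : ℝ} (h : posCode A s = posCode A s') {σ : ℝ}
    (hσ : σ ∈ A) : SameSide s s' σ := by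
  wlog hs : s ≤ s' generalizing s s'
  · have := this h.symm (le_of_not_ge hs)
    exact ⟨this.1.symm, this.2.symm⟩
  have s1 : A.filter (· < s) ⊆ A.filter (· < s') := fun x hx => by
    rw [Finset.mem_filter] at hx ⊢
    exact ⟨hx.1, hx.2.trans_le hs⟩
  have s2 : A.filter (· ≤ s) ⊆ A.filter (· ≤ s') := fun x hx => by
    rw [Finset.mem_filter] at hx ⊢
    exact ⟨hx.1, hx.2.trans hs⟩
  have c1 := Finset.card_le_card s1
  have c2 := Finset.card_le_card s2
  unfold posCode at h
  have e1 := Finset.eq_of_subset_of_card_le s1 (by omega)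
  have e2 := Finset.eq_of_subset_of_card_le s2 (by omega)
  have m1 := Finset.ext_iff.1 e1 σ
  have m2 := Finset.ext_iff.1 e2 σ
  simp only [Finset.mem_filter, hσ, true_and] at m1 m2
  exact ⟨m2, by rw [← not_lt, ← not_lt, m1]⟩

theorem finite_ncard_le_of_sameSide {α : Type*} {S : Set α} (A : Finset ℝ) (R : α → ℝ → Prop)
    (h1 : ∀ a ∈ S, ∃ s, R a s)
    (h2 : ∀ a a' s s', R a s → R a' s' → (∀ σ ∈ A, SameSide s s' σ) → a = a') :
    S.Finite ∧ S.ncard ≤ 2 * A.card + 1 := by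
  have := finite_ncard_le_of_code (S := S) (Finset.range (2 * A.card + 1))
    (fun a c => ∃ s, R a s ∧ posCode A s = c) (fun a ha => ?_) (fun a _ a' _ b hb hb' => ?_)
  · rwa [Finset.card_range] at this
  · obtain ⟨s, hs⟩ := h1 a ha
    exact ⟨posCode A s, Finset.mem_range.2 (by have := posCode_le A s; omega), s, hs, rfl⟩
  · obtain ⟨s, hs, hc⟩ := hb
    obtain ⟨s', hs', hc'⟩ := hb'
    exact h2 a a' s s' hs hs' fun σ hσ => sameSide_of_posCode_eq (hc.trans hc'.symm) hσ

namespace ConvexPolygon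
variable {n : ℕ} (P : ConvexPolygon n)

/-- Sufficiently many translates by multiples of the perimeter. -/
def translates (D : Finset ℝ) : Finset ℝ :=
  (D ×ˢ Finset.Icc (-4 : ℤ) 4).image fun x => x.1 + x.2 * P.perimeter

theorem card_translates_le (D : Finset ℝ) : (P.translates D).card ≤ 9 * D.card := by
  refine Finset.card_image_le.trans ?_
  rw [Finset.card_product, mul_comm]
  exact le_of_eq (by congr 1)

variable {P}

/-- With `s`, `s'` in `[0, 2L]` and `|d| ≤ 2L`, where `L` is the perimeter, a translate of `d` by at
least `5L` in either direction falls outside `[0, 2L]` and compares trivially. Only the nine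
translates from -4 to 4 matter. -/
theorem sameSide_translate {D : Finset ℝ} {s s' d : ℝ} (hd : d ∈ D)
    (h : ∀ σ ∈ P.translates D, SameSide s s' σ)
    (hd0 : -(2 * P.perimeter) ≤ d) (hd1 : d ≤ 2 * P.perimeter) (hs0 : 0 ≤ s) (hs1 : s ≤ 2 * P.perimeter)
    (hs0' : 0 ≤ s') (hs1' : s' ≤ 2 * P.perimeter) (c : ℤ) : SameSide s s' (d + c * P.perimeter) := by
  have hL := P.perimeter_pos
  by_cases hc : c < -4
  · have : (c : ℝ) ≤ -5 := by exact_mod_cast (by omega : c ≤ -5)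
    have : d + c * P.perimeter < 0 := by nlinarith
    exact ⟨iff_of_true (by linarith) (by linarith), iff_of_false (by linarith) (by linarith)⟩
  by_cases hc' : 4 < c
  · have : (5 : ℝ) ≤ c := by exact_mod_cast (by omega : 5 ≤ c)
    have : 2 * P.perimeter < d + c * P.perimeter := by nlinarith
    exact ⟨iff_of_false (by linarith) (by linarith), iff_of_true (by linarith) (by linarith)⟩
  exact h _ (Finset.mem_image.2 ⟨(d, c), Finset.mem_product.2 ⟨hd, Finset.mem_Icc.2
    ⟨by omega, by omega⟩⟩, rfl⟩)

variable (P)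

/-- The sums of two vertex parameters, shifted by a constant. -/
def markSums (u : ℝ) : Finset ℝ :=
  (Finset.univ : Finset (Fin n × Fin n)).image fun x => P.mark x.1 + P.mark x.2 - u

theorem card_markSums_le (u : ℝ) : (P.markSums u).card ≤ n ^ 2 := by
  refine Finset.card_image_le.trans ?_
  simp [Finset.card_univ, sq]

theorem mem_markSums (u : ℝ) (i j : Fin n) : P.mark i + P.mark j - u ∈ P.markSums u :=
  Finset.mem_image.2 ⟨(i, j), Finset.mem_univ _, rfl⟩

theorem pathSeq_shift (m : ℝ) (k : ℤ) :
    P.pathSeq (m + k * P.perimeter) = fun j => P.pathSeq m (j + k) := by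
  funext j
  unfold pathSeq
  push_cast
  ring

theorem triSeq_shift (p q r : ℝ) (k : ℤ) :
    P.triSeq (p + k * P.perimeter) (q + k * P.perimeter) (r + k * P.perimeter) =
      fun j => P.triSeq p q r (j + 3 * k) := by
  funext j
  obtain ⟨i, rfl | rfl | rfl⟩ := exists_eq_three_mul j
  · rw [triSeq_zero, show 3 * i + 3 * k = 3 * (i + k) by ring, triSeq_zero]; push_cast; ring
  · rw [triSeq_one, show 3 * i + 1 + 3 * k = 3 * (i + k) + 1 by ring, triSeq_one]; push_cast; ring
  · rw [triSeq_two, show 3 * i + 2 + 3 * k = 3 * (i + k) + 2 by ring, triSeq_two]; push_cast; ring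

variable {P}

theorem triSeq_strictMono {p q r : ℝ} (h1 : p < q) (h2 : q < r) (h3 : r < p + P.perimeter) :
    StrictMono (P.triSeq p q r) := by
  refine strictMono_int_of_lt_succ fun j => ?_
  obtain ⟨i, rfl | rfl | rfl⟩ := exists_eq_three_mul j
  · rw [triSeq_zero, triSeq_one]; linarith
  · rw [triSeq_one, show 3 * i + 1 + 1 = 3 * i + 2 by ring, triSeq_two]; linarith
  · rw [triSeq_two, triSeq_three]; linarith

theorem pathSeq_strictMono (m : ℝ) : StrictMono (P.pathSeq m) := by
  refine strictMono_int_of_lt_succ fun j => ?_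
  unfold pathSeq
  push_cast
  linarith [P.perimeter_pos]

theorem triSeq_period (p q r : ℝ) (i j : ℤ) :
    P.triSeq p q r (j + 3 * i) = P.triSeq p q r j + i * P.perimeter := by
  rw [← congrFun (P.triSeq_shift p q r i) j]
  unfold triSeq
  split_ifs <;> ring

/-- All conditions of `SeqCompat` compare `2 m`, up to translation by multiples of the perimeter,
with a sum of two marks; comparisons with a single mark `a` are doubled to use `a + a`. -/
theorem seqCompat_pathSeq {m m' : ℝ} (h0 : 0 ≤ m) (h1 : m ≤ P.perimeter) (h0' : 0 ≤ m')
    (h1' : m' ≤ P.perimeter)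
    (h : ∀ σ ∈ P.translates (P.markSums 0), SameSide (2 * m) (2 * m') σ) :
    P.SeqCompat (P.pathSeq m) (P.pathSeq m') := by
  have key : ∀ (i l : Fin n) (c : ℤ),
      SameSide (2 * m) (2 * m') (P.mark i + P.mark l + c * P.perimeter) := by
    intro i l c
    have := sameSide_translate (P.mem_markSums 0 i l) h
      (by linarith [P.mark_nonneg i, P.mark_nonneg l, P.perimeter_pos])
      (by linarith [P.mark_lt_perimeter i, P.mark_lt_perimeter l]) (by linarith) (by linarith)
      (by linarith) (by linarith) c
    rwa [sub_zero] at this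
  have one : ∀ a, P.IsMark a → ∀ j, SameSide (2 * P.pathSeq m j) (2 * P.pathSeq m' j) (2 * a) := by
    rintro a ⟨i, k, rfl⟩ j
    refine (key i i (2 * k - 2 * j)).of_sub_eq ?_ ?_ <;> unfold pathSeq <;> push_cast <;> ring
  have two : ∀ a b, P.IsMark a → P.IsMark b → ∀ j,
      SameSide (P.pathSeq m j + P.pathSeq m (j + 1)) (P.pathSeq m' j + P.pathSeq m' (j + 1))
        (a + b) := by
    rintro a b ⟨i, k, rfl⟩ ⟨l, k', rfl⟩ j
    refine (key i l (k + k' - 2 * j - 1)).of_sub_eq ?_ ?_ <;> unfold pathSeq <;> push_cast <;> ring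
  refine ⟨pathSeq_strictMono m, pathSeq_strictMono m', ⟨1, one_pos, fun i j => ⟨?_, ?_⟩⟩, ?_, ?_,
    fun a b ha hb j => (two a b ha hb j).1, fun a b ha hb j => (two a b ha hb j).2⟩
  · unfold pathSeq; push_cast; ring
  · unfold pathSeq; push_cast; ring
  · exact fun a ha j => by simpa using (one a ha j).1
  · exact fun a ha j => by simpa using (one a ha j).2

variable (P)

/-- The values at which a branch point with two given vertices changes its combinatorial type. -/
def branchValues (p q : ℝ) : Finset ℝ :=
  Finset.univ.image P.mark ∪ (P.markSums p ∪ P.markSums q)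

theorem card_branchValues_le (p q : ℝ) : (P.branchValues p q).card ≤ 3 * n ^ 2 := by
  refine (Finset.card_union_le _ _).trans ?_
  have h1 := Finset.card_union_le (P.markSums p) (P.markSums q)
  have h2 := P.card_markSums_le p
  have h3 := P.card_markSums_le q
  have h4 : (Finset.univ.image P.mark).card ≤ n := Finset.card_image_le.trans (by simp)
  have h5 : n ≤ n ^ 2 := Nat.le_self_pow two_ne_zero n
  omega

variable {P}

/-- Only `r` varies: it is compared with marks, and the sums `q + r` and `r + p` with sums of two
marks, which explains the three sets in `branchValues`. -/
theorem seqCompat_triSeq {p q r r' : ℝ} (hp0 : 0 ≤ p) (hp1 : p < P.perimeter) (hpq : p < q)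
    (hqr : q < r) (hr : r < p + P.perimeter) (hqr' : q < r') (hr' : r' < p + P.perimeter)
    (h : ∀ σ ∈ P.translates (P.branchValues p q), SameSide r r' σ) :
    P.SeqCompat (P.triSeq p q r) (P.triSeq p q r') := by
  have key : ∀ d ∈ P.branchValues p q, -(2 * P.perimeter) ≤ d → d ≤ 2 * P.perimeter →
      ∀ c : ℤ, SameSide r r' (d + c * P.perimeter) := fun d hd h0 h1 c =>
    sameSide_translate hd h h0 h1 (by linarith) (by linarith) (by linarith) (by linarith) c
  have hmark : ∀ (i : Fin n) (c : ℤ), SameSide r r' (P.mark i + c * P.perimeter) := fun i c =>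
    key _ (Finset.mem_union_left _ (Finset.mem_image.2 ⟨i, Finset.mem_univ _, rfl⟩))
      (by linarith [P.mark_nonneg i]) (by linarith [P.mark_lt_perimeter i]) c
  have hsum : ∀ u, (u = p ∨ u = q) → ∀ (i l : Fin n) (c : ℤ),
      SameSide r r' (P.mark i + P.mark l - u + c * P.perimeter) := by
    intro u hu i l c
    have h1 := P.mark_nonneg i
    have h2 := P.mark_nonneg l
    have h3 := P.mark_lt_perimeter i
    have h4 := P.mark_lt_perimeter l
    have hu0 : 0 ≤ u ∧ u ≤ 2 * P.perimeter := by
      rcases hu with rfl | rfl <;> constructor <;> linarith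
    refine key _ (Finset.mem_union_right _ ?_) (by linarith) (by linarith) c
    rcases hu with rfl | rfl
    · exact Finset.mem_union_left _ (P.mem_markSums _ i l)
    · exact Finset.mem_union_right _ (P.mem_markSums _ i l)
  have one : ∀ a, P.IsMark a → ∀ j, SameSide (P.triSeq p q r j) (P.triSeq p q r' j) a := by
    rintro a ⟨i, k, rfl⟩ j
    obtain ⟨l, rfl | rfl | rfl⟩ := exists_eq_three_mul j
    · rw [triSeq_zero, triSeq_zero]; exact .refl _ _
    · rw [triSeq_one, triSeq_one]; exact .refl _ _
    · rw [triSeq_two, triSeq_two]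
      refine (hmark i (k - l)).of_sub_eq ?_ ?_ <;> push_cast <;> ring
  have two : ∀ a b, P.IsMark a → P.IsMark b → ∀ j, SameSide (P.triSeq p q r j + P.triSeq p q r (j + 1))
      (P.triSeq p q r' j + P.triSeq p q r' (j + 1)) (a + b) := by
    rintro a b ⟨i, k, rfl⟩ ⟨i', k', rfl⟩ j
    obtain ⟨l, rfl | rfl | rfl⟩ := exists_eq_three_mul j
    · rw [triSeq_zero, triSeq_zero, triSeq_one, triSeq_one]; exact .refl _ _
    · rw [triSeq_one, triSeq_one, show 3 * l + 1 + 1 = 3 * l + 2 by ring, triSeq_two, triSeq_two]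
      refine (hsum q (Or.inr rfl) i i' (k + k' - 2 * l)).of_sub_eq ?_ ?_ <;> push_cast <;> ring
    · rw [triSeq_two, triSeq_two, triSeq_three, triSeq_three]
      refine (hsum p (Or.inl rfl) i i' (k + k' - 2 * l - 1)).of_sub_eq ?_ ?_ <;> push_cast <;> ring
  exact ⟨triSeq_strictMono hpq hqr hr, triSeq_strictMono hpq hqr' hr',
    ⟨3, by norm_num, fun i j => ⟨triSeq_period .., triSeq_period ..⟩⟩,
    fun a ha j => (one a ha j).1, fun a ha j => (one a ha j).2,
    fun a b ha hb j => (two a b ha hb j).1, fun a b ha hb j => (two a b ha hb j).2⟩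

end ConvexPolygon
end PolygonFolding
end

/-! ### The cubic bound for more than six vertices -/

noncomputable section
namespace PolygonFolding

namespace Gluing
open ConvexPolygon
variable {n : ℕ} {P : ConvexPolygon n} {G G' : Gluing P}

theorem FoldsAlong.comp_add {p : ℤ → ℝ} (h : G.FoldsAlong p) (k : ℤ) :
    G.FoldsAlong fun j => p (j + k) := by
  refine ⟨fun j => ?_, fun x => ?_⟩
  · have := h.arc (j + k)
    rwa [show j + k + 1 = j + 1 + k by ring] at this
  · obtain ⟨j, h0, h1⟩ := h.cover x
    exact ⟨j - k, by rwa [sub_add_cancel], by rwa [show j - k + 1 + k = j + 1 by ring]⟩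

theorem FoldsAlong.leaf_pathSeq {m : ℝ} (h : G.FoldsAlong (P.pathSeq m)) (j : ℤ) :
    G.Leaf (P.pathSeq m j) := by
  intro y hy
  rw [eq_comm, P.boundaryPoint_eq_iff]
  rcases (h.foldedBy _ _).1 hy with ⟨i, rfl⟩ | ⟨i, i', l, h0, h1, h2⟩ | ⟨i, l, h0, h1⟩
  · exact ⟨i, rfl⟩
  · refine ⟨2 * l + 1 - i - i' - 2 * j, ?_⟩
    unfold pathSeq at h2 ⊢
    push_cast at h2 ⊢
    linarith
  · refine ⟨l - j, ?_⟩
    rw [h1]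
    unfold pathSeq
    push_cast
    ring

theorem nodeParam_of_triple {p q r x : ℝ} (hpq : p < q) (hqr : q < r) (hr : r < p + P.perimeter)
    (h1 : G.Rel x p) (h2 : G.Rel x q) (h3 : G.Rel x r) : G.NodeParam x := by
  refine nodeParam_of_ncard fun h => ?_
  obtain ⟨a, b, -, hab⟩ := Set.ncard_eq_two.1 h
  have e : ∀ {u v}, u < v → v < u + P.perimeter → P.boundaryPoint u ≠ P.boundaryPoint v :=
    fun h0 h1 h2 => h0.ne (P.eq_of_boundaryPoint_eq h2 (by rw [abs_lt]; constructor <;> linarith))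
  have mem : ∀ {u}, G.Rel x u → P.boundaryPoint u = a ∨ P.boundaryPoint u = b := fun hu => by
    have := mem_classOf.2 hu
    rwa [hab] at this
  have n1 := e hpq (by linarith)
  have n2 := e hqr (by linarith)
  have n3 := e (hpq.trans hqr) hr
  rcases mem h1 with e1 | e1 <;> rcases mem h2 with e2 | e2 <;> rcases mem h3 with e3 | e3 <;>
    simp_all

theorem nodeParam_triSeq {p q r : ℝ} (hpq : p < q) (hqr : q < r) (hr : r < p + P.perimeter)
    (h1 : G.Rel p q) (h2 : G.Rel q r) (j : ℤ) : G.NodeParam (P.triSeq p q r j) := by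
  have key : ∀ (u : ℝ) (i : ℤ), G.Rel u p → G.NodeParam (u + i * P.perimeter) := fun u i hu => by
    have hu' : G.Rel (u + i * P.perimeter) p := by simpa using hu.shift i 0
    exact nodeParam_of_triple hpq hqr hr hu' (hu'.trans h1) ((hu'.trans h1).trans h2)
  obtain ⟨i, rfl | rfl | rfl⟩ := exists_eq_three_mul j
  · rw [triSeq_zero]; exact key _ _ (Rel.refl p)
  · rw [triSeq_one]; exact key _ _ h1.symm
  · rw [triSeq_two]; exact key _ _ (h1.trans h2).symm

theorem IsAleksandrov.faceAngle_triple_le (hG : G.IsAleksandrov) {p q r : ℝ} (hpq : p < q)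
    (hqr : q < r) (hr : r < p + P.perimeter) (h1 : G.Rel p q) (h2 : G.Rel q r) :
    P.faceAngle (P.boundaryPoint p) + P.faceAngle (P.boundaryPoint q) +
      P.faceAngle (P.boundaryPoint r) ≤ 2 * Real.pi := by
  classical
  have e : ∀ {u v}, u < v → v < u + P.perimeter → P.boundaryPoint u ≠ P.boundaryPoint v :=
    fun h0 h1 h2 => h0.ne (P.eq_of_boundaryPoint_eq h2 (by rw [abs_lt]; constructor <;> linarith))
  have n1 := e hpq (by linarith)
  have n2 := e hqr (by linarith)
  have n3 := e (hpq.trans hqr) hr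
  have hmem : ∀ x ∈ ({P.boundaryPoint p, P.boundaryPoint q, P.boundaryPoint r} : Finset Plane),
      x ∈ P.bdry ∧ G.setoid (P.boundaryPoint p) x := by
    intro x hx
    simp only [Finset.mem_insert, Finset.mem_singleton] at hx
    rcases hx with rfl | rfl | rfl
    · exact ⟨P.boundaryPoint_mem_bdry _, Rel.refl p⟩
    · exact ⟨P.boundaryPoint_mem_bdry _, h1⟩
    · exact ⟨P.boundaryPoint_mem_bdry _, h1.trans h2⟩
  have := hG.angle_le _ (fun x hx => (hmem x hx).1) fun x hx y hy =>
    G.setoid.trans (G.setoid.symm (hmem x hx).2) (hmem y hy).2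
  rw [Finset.sum_insert (by simp [n1, n3]), Finset.sum_pair n2] at this
  linarith

theorem exists_rotate_shift {p q r : ℝ} (hpq : p < q) (hqr : q < r)
    (hr : r < p + P.perimeter) (h1 : G.Rel p q) (h2 : G.Rel q r) (hp : P.IsMark p) :
    ∃ (i : Fin n) (k : ℤ), P.mark i < q + k * P.perimeter ∧
      q + k * P.perimeter < r + k * P.perimeter ∧ r + k * P.perimeter < P.mark i + P.perimeter ∧
      G.Rel (P.mark i) (q + k * P.perimeter) ∧
      G.Rel (q + k * P.perimeter) (r + k * P.perimeter) ∧
      P.boundaryPoint p = P.vertices i := by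
  obtain ⟨i, k, rfl⟩ := hp
  refine ⟨i, -k, by push_cast; linarith, by linarith, by push_cast; linarith, ?_, h2.shift _ _, ?_⟩
  · have := h1.shift (-k) (-k)
    rwa [show P.mark i + k * P.perimeter + ((-k : ℤ) : ℝ) * P.perimeter = P.mark i by
      push_cast; ring] at this
  · rw [P.boundaryPoint_add_int_mul, P.boundaryPoint_mark]

/-- At a branch point, at least two of three glued points are vertices, and if the third is not,
then the turning angles at the two vertices add up to at least `π`. -/
theorem IsAleksandrov.exists_normalized_triple (hG : G.IsAleksandrov) {p q r : ℝ} (hpq : p < q)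
    (hqr : q < r) (hr : r < p + P.perimeter) (h1 : G.Rel p q) (h2 : G.Rel q r) :
    ∃ (i j : Fin n) (q r : ℝ), P.mark i < q ∧ q < r ∧ r < P.mark i + P.perimeter ∧
      G.Rel (P.mark i) q ∧ G.Rel q r ∧ P.boundaryPoint q = P.vertices j ∧
      ((∃ l, P.boundaryPoint r = P.vertices l) ∨ Real.pi ≤ P.turn i + P.turn j) := by
  have key : ∀ {p q r : ℝ}, p < q → q < r → r < p + P.perimeter → G.Rel p q → G.Rel q r →
      P.IsMark p → P.IsMark q → ∃ (i j : Fin n) (q r : ℝ), P.mark i < q ∧ q < r ∧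
      r < P.mark i + P.perimeter ∧
      G.Rel (P.mark i) q ∧ G.Rel q r ∧ P.boundaryPoint q = P.vertices j ∧
      ((∃ l, P.boundaryPoint r = P.vertices l) ∨ Real.pi ≤ P.turn i + P.turn j) := by
    intro p q r hpq hqr hr h1 h2 hp hq
    obtain ⟨j, hj⟩ := isMark_iff.1 hq
    obtain ⟨i, k, a1, a2, a3, a4, a5, a6⟩ := exists_rotate_shift hpq hqr hr h1 h2 hp
    refine ⟨i, j, _, _, a1, a2, a3, a4, a5, by rw [P.boundaryPoint_add_int_mul, hj], ?_⟩
    rw [P.boundaryPoint_add_int_mul]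
    by_cases hm : ∃ l, P.boundaryPoint r = P.vertices l
    · exact Or.inl hm
    · right
      push Not at hm
      have := hG.faceAngle_triple_le hpq hqr hr h1 h2
      rw [P.faceAngle_of_not_vertex (x := P.boundaryPoint r) fun l h => hm l h.symm, a6, hj] at this
      unfold turn
      linarith
  have h3 : G.Rel r (p + P.perimeter) := (h1.trans h2).symm.trans (rel_add_perimeter p)
  have h4 : G.Rel (p + P.perimeter) (q + P.perimeter) := by simpa using h1.shift 1 1
  have hsum := hG.faceAngle_triple_le hpq hqr hr h1 h2
  have flat : ∀ {u}, ¬ P.IsMark u → P.faceAngle (P.boundaryPoint u) = Real.pi := fun hu =>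
    P.faceAngle_of_not_vertex fun i hi => hu (isMark_iff.2 ⟨i, hi.symm⟩)
  have hp0 := P.faceAngle_pos (P.boundaryPoint p)
  have hq0 := P.faceAngle_pos (P.boundaryPoint q)
  have hr0 := P.faceAngle_pos (P.boundaryPoint r)
  have hshift : P.IsMark p → P.IsMark (p + P.perimeter) := fun h => by simpa using h.shift 1
  by_cases mp : P.IsMark p
  -- Two flat points among three already use up the angle 2π while the third angle is positive, so
  -- at least two points are vertices. Rotating the triple puts two vertices in the first two
  -- positions.
  · by_cases mq : P.IsMark q
    · exact key hpq hqr hr h1 h2 mp mq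
    · by_cases mr : P.IsMark r
      · exact key hr (by linarith) (by linarith) h3 h4 mr (hshift mp)
      · rw [flat mq, flat mr] at hsum
        linarith
  · by_cases mq : P.IsMark q
    · by_cases mr : P.IsMark r
      · exact key hqr hr (by linarith) h2 h3 mq mr
      · rw [flat mp, flat mr] at hsum
        linarith
    · rw [flat mp, flat mq] at hsum
      linarith

end Gluing

namespace ConvexPolygon
open Gluing
variable {n : ℕ} (P : ConvexPolygon n)

/-- The trees of gluings folding the boundary along a single arc. -/
def pathTrees : Set (Quotient (LabeledGraph.isoSetoid (Fin n ⊕ Fin n))) :=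
  {T | ∃ (G : Gluing P) (m : ℝ), G.IsAleksandrov ∧ G.FoldsAlong (P.pathSeq m) ∧
    T = Quotient.mk _ G.gluingTree}

/-- The trees of gluings with a branch point containing three given points and folding the
boundary along the arcs between them. -/
def branchTrees (p q r : ℝ) : Set (Quotient (LabeledGraph.isoSetoid (Fin n ⊕ Fin n))) :=
  {T | ∃ G : Gluing P, G.IsAleksandrov ∧ p < q ∧ q < r ∧ r < p + P.perimeter ∧ G.Rel p q ∧
    G.Rel q r ∧ G.FoldsAlong (P.triSeq p q r) ∧ T = Quotient.mk _ G.gluingTree}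

/-- At most n² mark sums, nine translates each, and `2 * card + 1` positions relative to them. -/
theorem pathTrees_finite : P.pathTrees.Finite ∧ P.pathTrees.ncard ≤ 18 * n ^ 2 + 1 := by
  have h := finite_ncard_le_of_sameSide (S := P.pathTrees) (P.translates (P.markSums 0))
    (fun T s => ∃ (G : Gluing P) (m : ℝ), G.IsAleksandrov ∧ G.FoldsAlong (P.pathSeq m) ∧
      0 ≤ m ∧ m ≤ P.perimeter ∧ s = 2 * m ∧ T = Quotient.mk _ G.gluingTree) ?_ ?_
  · refine ⟨h.1, h.2.trans ?_⟩
    have h1 := P.card_translates_le (P.markSums 0)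
    have h2 := P.card_markSums_le 0
    omega
  · rintro T ⟨G, m, hG, hm, rfl⟩
    obtain ⟨k, h0, h1⟩ := P.exists_add_int_mul_mem 0 m
    refine ⟨_, G, m + k * P.perimeter, hG, ?_, h0, by linarith, rfl, rfl⟩
    rw [pathSeq_shift]
    exact hm.comp_add k
  · rintro T T' s s' ⟨G, m, hG, hm, h0, h1, rfl, rfl⟩ ⟨G', m', hG', hm', h0', h1', rfl, rfl⟩ hs
    exact Quotient.sound (hm.same hG hG' hm' (fun j => (hm.leaf_pathSeq j).nodeParam)
      (fun j => (hm'.leaf_pathSeq j).nodeParam) (seqCompat_pathSeq h0 h1 h0' h1' hs))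

/-- The count is that of `pathTrees_finite` with at most 3 n² critical values instead of n²; the
third point `r` is arbitrary. -/
theorem iUnion_branchTrees_finite {p q : ℝ} (hp0 : 0 ≤ p) (hp1 : p < P.perimeter) :
    (⋃ r, P.branchTrees p q r).Finite ∧ (⋃ r, P.branchTrees p q r).ncard ≤ 54 * n ^ 2 + 1 := by
  have h := finite_ncard_le_of_sameSide (S := ⋃ r, P.branchTrees p q r)
    (P.translates (P.branchValues p q)) (fun T r => T ∈ P.branchTrees p q r) ?_ ?_
  · refine ⟨h.1, h.2.trans ?_⟩
    have h1 := P.card_translates_le (P.branchValues p q)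
    have h2 := P.card_branchValues_le p q
    omega
  · exact fun T hT => Set.mem_iUnion.1 hT
  · rintro T T' r r' ⟨G, hG, hpq, hqr, hr, h1, h2, hf, rfl⟩
      ⟨G', hG', -, hqr', hr', h1', h2', hf', rfl⟩ hs
    exact Quotient.sound (hf.same hG hG' hf' (nodeParam_triSeq hpq hqr hr h1 h2)
      (nodeParam_triSeq hpq hqr' hr' h1' h2') (seqCompat_triSeq hp0 hp1 hpq hqr hr hqr' hr' hs))

theorem branchTrees_finite {p q r : ℝ} (hp0 : 0 ≤ p) (hp1 : p < P.perimeter) :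
    (P.branchTrees p q r).Finite ∧ (P.branchTrees p q r).ncard ≤ 1 := by
  have : (P.branchTrees p q r).Subsingleton := by
    rintro T ⟨G, hG, hpq, hqr, hr, h1, h2, hf, rfl⟩ T' ⟨G', hG', -, -, -, h1', h2', hf', rfl⟩
    exact Quotient.sound (hf.same hG hG' hf' (nodeParam_triSeq hpq hqr hr h1 h2)
      (nodeParam_triSeq hpq hqr hr h1' h2')
      (seqCompat_triSeq hp0 hp1 hpq hqr hr hqr hr fun σ _ => .refl _ _))
  exact ⟨this.finite, (Set.ncard_le_one this.finite).2 fun a ha b hb => this ha hb⟩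

/-- The parameter of the `j`-th vertex following that of the `i`-th vertex. -/
def liftMark (i j : Fin n) : ℝ := if P.mark i < P.mark j then P.mark j else P.mark j + P.perimeter

variable {P}

theorem eq_liftMark {i j : Fin n} {q : ℝ} (h0 : P.mark i < q) (h1 : q < P.mark i + P.perimeter)
    (hq : P.boundaryPoint q = P.vertices j) : q = P.liftMark i j := by
  refine P.eq_of_boundaryPoint_eq ?_ ?_
  · rw [hq, liftMark]
    split_ifs
    · rw [P.boundaryPoint_mark]
    · rw [P.boundaryPoint_add_perimeter, P.boundaryPoint_mark]
  · have h2 := P.mark_lt_perimeter i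
    have h3 := P.mark_nonneg j
    have h4 := P.mark_lt_perimeter j
    have h5 := P.mark_nonneg i
    rw [liftMark, abs_lt]
    split_ifs <;> constructor <;> linarith

variable (P)

open Classical in
/-- The pairs of vertices whose turning angles add up to at least `π`. -/
def sharpPairs : Finset (Fin n × Fin n) := {x | x.1 ≠ x.2 ∧ Real.pi ≤ P.turn x.1 + P.turn x.2}

/-- Two disjoint such pairs would exhaust the total turning 2π and leave nothing for a fifth vertex.
Hence every pair meets a fixed one, and there are at most 2 n ordered pairs with first entry in it
and 2 n with second. -/
theorem card_sharpPairs_le (hn : 5 ≤ n) : P.sharpPairs.card ≤ 4 * n := by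
  classical
  rcases P.sharpPairs.eq_empty_or_nonempty with h | ⟨⟨a, b⟩, hab⟩
  · rw [h]; simp
  simp only [sharpPairs, Finset.mem_filter, Finset.mem_univ, true_and] at hab
  have meet : ∀ x ∈ P.sharpPairs, x.1 = a ∨ x.1 = b ∨ x.2 = a ∨ x.2 = b := by
    rintro ⟨c, d⟩ hcd
    simp only [sharpPairs, Finset.mem_filter, Finset.mem_univ, true_and] at hcd
    by_contra hne
    simp only [not_or] at hne
    obtain ⟨hca, hcb, hda, hdb⟩ := hne
    obtain ⟨e, he⟩ : ∃ e, e ∉ ({a, b, c, d} : Finset (Fin n)) := by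
      by_contra hall
      push Not at hall
      have := Finset.card_le_card (fun e _ => hall e : Finset.univ ⊆ ({a, b, c, d} : Finset (Fin n)))
      rw [Finset.card_univ, Fintype.card_fin] at this
      have := Finset.card_le_four (a := a) (b := b) (c := c) (d := d)
      omega
    have h1 := Finset.sum_le_sum_of_subset_of_nonneg (f := P.turn)
      (Finset.subset_univ (insert e {a, b, c, d})) fun i _ _ => (P.turn_pos i).le
    rw [P.sum_turn, Finset.sum_insert he, Finset.sum_insert (by simp [hab.1, Ne.symm hca, Ne.symm hda]),
      Finset.sum_insert (by simp [Ne.symm hcb, Ne.symm hdb]), Finset.sum_pair hcd.1] at h1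
    linarith [P.turn_pos e, hab.2, hcd.2]
  have hsub : P.sharpPairs ⊆ (({a, b} : Finset (Fin n)) ×ˢ Finset.univ) ∪
      (Finset.univ ×ˢ ({a, b} : Finset (Fin n))) := by
    intro x hx
    have := meet x hx
    simp only [Finset.mem_union, Finset.mem_product, Finset.mem_insert, Finset.mem_singleton,
      Finset.mem_univ, and_true, true_and]
    tauto
  refine (Finset.card_le_card hsub).trans ((Finset.card_union_le _ _).trans ?_)
  rw [Finset.card_product, Finset.card_product, Finset.card_pair hab.1, Finset.card_univ,
    Fintype.card_fin]
  omega

/-- A convex polygon with more than six vertices has at most cubically many gluing trees. -/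
theorem gluingTrees_finite_of_six_lt (hn : 6 < n) :
    P.gluingTrees.Finite ∧ P.gluingTrees.ncard ≤ 240 * n ^ 3 := by
  have hsub : P.gluingTrees ⊆ P.pathTrees ∪
      ((⋃ x ∈ (Finset.univ : Finset (Fin n × Fin n × Fin n)),
        P.branchTrees (P.mark x.1) (P.liftMark x.1 x.2.1) (P.liftMark x.1 x.2.2)) ∪
      ⋃ x ∈ P.sharpPairs, ⋃ r, P.branchTrees (P.mark x.1) (P.liftMark x.1 x.2) r) := by
    rintro T ⟨G, hG, rfl⟩
    rcases hG.exists_foldsAlong_or_triple with ⟨m, hm⟩ | ⟨p, q, r, hpq, hqr, hr, h1, h2⟩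
    · exact Or.inl ⟨G, m, hG, hm, rfl⟩
    right
    obtain ⟨i, j, q, r, hpq, hqr, hr, h1, h2, hj, hd⟩ :=
      hG.exists_normalized_triple hpq hqr hr h1 h2
    have hf := hG.foldsAlong_triSeq (hG.atMostThreeLeaves hn) hpq hqr hr h1 h2
    have hT : Quotient.mk _ G.gluingTree ∈ P.branchTrees (P.mark i) q r :=
      ⟨G, hG, hpq, hqr, hr, h1, h2, hf, rfl⟩
    obtain rfl := eq_liftMark hpq (by linarith) hj
    rcases hd with ⟨l, hl⟩ | hd
    · obtain rfl := eq_liftMark (hpq.trans hqr) hr hl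
      exact Or.inl (Set.mem_biUnion (Finset.mem_coe.2 (Finset.mem_univ (i, j, l))) hT)
    · refine Or.inr (Set.mem_biUnion (x := (i, j)) ?_ (Set.mem_iUnion.2 ⟨r, hT⟩))
      refine Finset.mem_coe.2 (Finset.mem_filter.2 ⟨Finset.mem_univ _, ?_, hd⟩)
      -- For equal vertices the second cut would be a full perimeter after the first, leaving no
      -- room for `r`.
      rintro (rfl : i = j)
      rw [liftMark, if_neg (lt_irrefl _)] at hqr
      linarith
  have h1 := finite_ncard_le_of_subset_iUnion (Finset.univ : Finset (Fin n × Fin n × Fin n)) _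
    subset_rfl fun x => P.branchTrees_finite (q := P.liftMark x.1 x.2.1) (r := P.liftMark x.1 x.2.2)
      (P.mark_nonneg x.1) (P.mark_lt_perimeter x.1)
  have h2 := finite_ncard_le_of_subset_iUnion P.sharpPairs _ subset_rfl fun x =>
    P.iUnion_branchTrees_finite (q := P.liftMark x.1 x.2) (P.mark_nonneg x.1)
      (P.mark_lt_perimeter x.1)
  have h := finite_ncard_le_union P.pathTrees_finite (finite_ncard_le_union h1 h2)
  refine ⟨h.1.subset hsub, (Set.ncard_le_ncard hsub h.1).trans (h.2.trans ?_)⟩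
  have h3 := P.card_sharpPairs_le (by omega)
  have h4 : P.sharpPairs.card * (54 * n ^ 2 + 1) ≤ 4 * n * (54 * n ^ 2 + 1) :=
    Nat.mul_le_mul_right _ h3
  simp only [Finset.card_univ, Fintype.card_prod, Fintype.card_fin]
  have h5 : 1 ≤ n := by omega
  have h6 : n ^ 2 ≤ n ^ 3 := Nat.pow_le_pow_right h5 (by norm_num)
  have h7 : n ≤ n ^ 3 := Nat.le_self_pow (by norm_num) n
  -- The total is 18 n² + 1 + n³ + 4 n (54 n² + 1) = 217 n³ + 18 n² + 4 n + 1, at most 240 n³.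
  nlinarith

end ConvexPolygon
end PolygonFolding
end

/-! ### Few vertices: a crude count of labelled graphs -/

noncomputable section
namespace PolygonFolding

namespace Gluing
variable {n : ℕ} {P : ConvexPolygon n} {G : Gluing P}

/-- A node of the gluing tree without vertices consists of a leaf. -/
theorem IsAleksandrov.exists_leaf_of_isNode (hG : G.IsAleksandrov) {c : Set Plane} (hc : G.IsNode c)
    (hv : ∀ i, P.vertices i ∉ c) : ∃ k, G.startPt k ∈ c ∧ G.cls k ∈ G.leafClasses := by
  classical
  obtain ⟨x, rfl⟩ := hc.exists_classOf
  have hcard : (G.classOf x).ncard ≠ 2 := hc.2.resolve_right fun ⟨i, hi⟩ => hv i hi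
  have hb : ∀ y ∈ G.classOf x, y ∈ P.bdry := fun y hy =>
    (mem_bdry_iff_of_setoid hy).1 (P.boundaryPoint_mem_bdry x)
  -- Without vertices every point contributes π, so at most two points are glued together; as a node
  -- does not have exactly two, it is a single point.
  have hle : ∀ s : Finset Plane, (↑s : Set Plane) ⊆ G.classOf x → s.card ≤ 2 := by
    intro s hs
    have h1 := hG.angle_le s (fun y hy => hb y (hs hy)) fun y hy z hz =>
      G.setoid.trans (G.setoid.symm (hs hy)) (hs hz)
    rw [Finset.sum_congr rfl fun y hy => P.faceAngle_of_not_vertex (x := y) fun i hi =>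
      hv i (hi ▸ hs hy), Finset.sum_const, nsmul_eq_mul] at h1
    have h2 : (s.card : ℝ) ≤ 2 := le_of_mul_le_mul_right h1 Real.pi_pos
    exact_mod_cast h2
  have hleaf : G.Leaf x := by
    intro y hy
    by_contra hne
    apply hcard
    have hsub : ({P.boundaryPoint y, P.boundaryPoint x} : Set Plane) ⊆ G.classOf x := by
      rintro z (rfl | rfl)
      · exact hy
      · exact Rel.refl x
    have hsup : G.classOf x ⊆ {P.boundaryPoint y, P.boundaryPoint x} := by
      intro z hz
      by_contra hz'
      simp only [Set.mem_insert_iff, Set.mem_singleton_iff, not_or] at hz'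
      have := hle {z, P.boundaryPoint y, P.boundaryPoint x} (by
        intro w hw
        simp only [Finset.coe_insert, Finset.coe_singleton, Set.mem_insert_iff,
          Set.mem_singleton_iff] at hw
        rcases hw with rfl | hw
        · exact hz
        · exact hsub hw)
      rw [Finset.card_insert_of_notMem (by simp [hz'.1, hz'.2]), Finset.card_pair hne] at this
      omega
    rw [hsup.antisymm hsub, Set.ncard_pair hne]
  obtain ⟨k, hk, hk'⟩ := hleaf.exists_cls
  exact ⟨k, hk ▸ Rel.refl x, hk'⟩

/-- Every node contains one of the n vertices or is one of at most four leaves, and distinct nodes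
are disjoint. -/
theorem IsAleksandrov.card_node_le (hG : G.IsAleksandrov) :
    Finite G.gluingTree.Node ∧ Nat.card G.gluingTree.Node ≤ n + 4 := by
  classical
  let Q : {c : Set Plane // G.IsNode c} → Fin n ⊕ G.leafClasses → Prop := fun c b =>
    match b with
    | Sum.inl i => P.vertices i ∈ c.1
    | Sum.inr q => ∃ k, G.startPt k ∈ c.1 ∧ G.cls k = q.1
  have huniq : ∀ {c d : {c : Set Plane // G.IsNode c}} {x y : Plane}, x ∈ c.1 → y ∈ d.1 →
      G.setoid x y → c = d := by
    rintro ⟨c, hc⟩ ⟨d, hd⟩ x y hx hy hxy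
    obtain ⟨u, rfl⟩ := hc.exists_classOf
    obtain ⟨v, rfl⟩ := hd.exists_classOf
    exact Subtype.ext (classOf_eq_iff.2 (G.setoid.trans (G.setoid.trans hx hxy)
      (G.setoid.symm hy)))
  have h := finite_ncard_le_of_code (S := (Set.univ : Set {c : Set Plane // G.IsNode c}))
    Finset.univ Q (fun c _ => ?_) (fun c _ d _ b hc hd => ?_)
  · refine ⟨Set.finite_univ_iff.1 h.1, ?_⟩
    have h1 := h.2
    rw [Set.ncard_univ, Finset.card_univ, Fintype.card_sum, Fintype.card_fin,
      Fintype.card_coe] at h1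
    exact h1.trans (Nat.add_le_add_left hG.card_leafClasses_le n)
  · by_cases hv : ∃ i, P.vertices i ∈ c.1
    · obtain ⟨i, hi⟩ := hv
      exact ⟨Sum.inl i, Finset.mem_univ _, hi⟩
    · push Not at hv
      obtain ⟨k, hk, hk'⟩ := hG.exists_leaf_of_isNode c.2 hv
      exact ⟨Sum.inr ⟨_, hk'⟩, Finset.mem_univ _, k, hk, rfl⟩
  · cases b with
    | inl i => exact huniq hc hd (G.setoid.refl _)
    | inr q =>
      obtain ⟨k, hk, hkq⟩ := hc
      obtain ⟨l, hl, hlq⟩ := hd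
      exact huniq hk hl (cls_eq_iff.1 (hkq.trans hlq.symm))

end Gluing

/-- The labelled graphs on an initial segment of the natural numbers. -/
abbrev GraphCode (α : Type) (N : ℕ) : Type :=
  Σ k : Fin N, SimpleGraph (Fin k) × (Fin k → Set α)

theorem LabeledGraph.exists_code {α : Type} (S : LabeledGraph α) {N : ℕ} [Finite S.Node]
    (h : Nat.card S.Node < N) :
    ∃ c : GraphCode α N, LabeledGraph.Same S ⟨Fin c.1, c.2.1, c.2.2⟩ := by
  let e := Finite.equivFin S.Node
  refine ⟨⟨⟨Nat.card S.Node, h⟩, S.graph.map e.toEmbedding, S.label ∘ e.symm⟩,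
    SimpleGraph.Iso.map e S.graph, fun a => ?_⟩
  change S.label (e.symm (e a)) = S.label a
  rw [Equiv.symm_apply_apply]

namespace ConvexPolygon
variable {n : ℕ} (P : ConvexPolygon n)

theorem gluingTrees_finite : P.gluingTrees.Finite ∧
    P.gluingTrees.ncard ≤ Nat.card (GraphCode (Fin n ⊕ Fin n) (n + 5)) := by
  classical
  have : Finite (GraphCode (Fin n ⊕ Fin n) (n + 5)) := inferInstance
  have : Fintype (GraphCode (Fin n ⊕ Fin n) (n + 5)) := Fintype.ofFinite _
  have h := finite_ncard_le_of_code (S := P.gluingTrees)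
    (Finset.univ : Finset (GraphCode (Fin n ⊕ Fin n) (n + 5)))
    (fun T c => T = Quotient.mk _ ⟨Fin c.1, c.2.1, c.2.2⟩) ?_
    (fun T _ T' _ c hT hT' => hT.trans hT'.symm)
  · rwa [Finset.card_univ, ← Nat.card_eq_fintype_card] at h
  · rintro T ⟨G, hG, rfl⟩
    obtain ⟨h1, h2⟩ := hG.card_node_le
    obtain ⟨c, hc⟩ := G.gluingTree.exists_code (N := n + 5) (by omega)
    exact ⟨c, Finset.mem_univ _, Quotient.sound hc⟩

/-- Convex polygons have at most cubically many gluing trees. -/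
theorem exists_ncard_gluingTrees_le : ∃ C : ℝ, ∀ (n : ℕ) (P : ConvexPolygon n),
    P.gluingTrees.Finite ∧ (P.gluingTrees.ncard : ℝ) ≤ C * (n : ℝ) ^ 3 := by
  -- Absorbs the finitely many values n ≤ 6, where four leaves may occur.
  let K : ℕ := ∑ n ∈ Finset.range 7, Nat.card (GraphCode (Fin n ⊕ Fin n) (n + 5))
  refine ⟨(240 + K : ℕ), fun n P => ⟨P.gluingTrees_finite.1, ?_⟩⟩
  have key : P.gluingTrees.ncard ≤ (240 + K) * n ^ 3 := by
    by_cases hn : 6 < n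
    · refine (P.gluingTrees_finite_of_six_lt hn).2.trans (Nat.mul_le_mul_right _ (by omega))
    · have h1 : Nat.card (GraphCode (Fin n ⊕ Fin n) (n + 5)) ≤ K :=
        Finset.single_le_sum (f := fun n => Nat.card (GraphCode (Fin n ⊕ Fin n) (n + 5)))
          (fun _ _ => Nat.zero_le _) (Finset.mem_range.2 (by omega))
      have h2 := P.gluingTrees_finite.2
      have h3 : 1 ≤ n ^ 3 := Nat.one_le_pow _ _ P.pos
      nlinarith
  exact_mod_cast key

end ConvexPolygon
end PolygonFolding
end

/-! ### Polar coordinates on the polygonal region -/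

noncomputable section
namespace PolygonFolding

namespace ConvexPolygon
variable {n : ℕ} (P : ConvexPolygon n)

/-- The signed distance to the line through an edge, up to a factor. -/
def height (i : Fin n) (x : Plane) : ℝ :=
  signedArea (P.vertices i) (P.vertices (finRotate n i)) x

theorem height_lineMap (i : Fin n) (x y : Plane) (r : ℝ) :
    P.height i (AffineMap.lineMap x y r) = (1 - r) * P.height i x + r * P.height i y :=
  signedArea_lineMap ..

theorem sum_finRotate_sub (f : Fin n → ℝ) : ∑ i, (f (finRotate n i) - f i) = 0 := by
  rw [Finset.sum_sub_distrib, Equiv.sum_comp, sub_self]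

/-- The sum of the heights is constant. -/
theorem sum_height_eq (x y : Plane) : ∑ i, P.height i x = ∑ i, P.height i y := by
  have h0 := sum_finRotate_sub fun i => P.vertices i 0
  have h1 := sum_finRotate_sub fun i => P.vertices i 1
  rw [← sub_eq_zero, ← Finset.sum_sub_distrib]
  have : ∀ i, P.height i x - P.height i y =
      (P.vertices (finRotate n i) 0 - P.vertices i 0) * (x 1 - y 1) -
        (P.vertices (finRotate n i) 1 - P.vertices i 1) * (x 0 - y 0) := by
    intro i
    simp only [height, signedArea]
    ring
  simp only [this]
  rw [Finset.sum_sub_distrib, ← Finset.sum_mul, ← Finset.sum_mul, h0, h1]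
  ring

theorem height_nonneg_of_mem_region {x : Plane} (hx : x ∈ P.region) (i : Fin n) :
    0 ≤ P.height i x := by
  have hconv : Convex ℝ {x | 0 ≤ P.height i x} := by
    rw [convex_iff_segment_subset]
    intro x hx y hy z hz
    rw [segment_eq_image_lineMap] at hz
    obtain ⟨r, ⟨h0, h1⟩, rfl⟩ := hz
    rw [Set.mem_ofPred_eq] at hx hy ⊢
    rw [height_lineMap]
    have := mul_nonneg (sub_nonneg.2 h1) hx
    have := mul_nonneg h0 hy
    linarith
  refine convexHull_min ?_ hconv hx
  rintro _ ⟨j, rfl⟩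
  exact P.signedArea_nonneg i j

theorem height_finRotate_vertices_pos (i : Fin n) : 0 < P.height (finRotate n i) (P.vertices i) :=
  P.convex _ _ (P.finRotate_ne i).symm (P.finRotate_finRotate_ne i).symm

theorem height_vertices_left (i : Fin n) : P.height i (P.vertices i) = 0 := signedArea_self_left ..

theorem height_vertices_right (i : Fin n) : P.height i (P.vertices (finRotate n i)) = 0 :=
  signedArea_self_right ..

theorem exists_height_eq_zero {x : Plane} (hx : x ∈ P.bdry) : ∃ i, P.height i x = 0 := by
  obtain ⟨i, hi⟩ := Set.mem_iUnion.1 hx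
  obtain ⟨r, -, rfl⟩ := hi
  exact ⟨i, by rw [height_lineMap, height_vertices_left, height_vertices_right]; ring⟩

/-- The point is on the line of edge `i`; the heights over the previous and the next edge bound its
affine coordinate below by 0 and above by 1. -/
theorem mem_bdry_of_height {x : Plane} (h : ∀ j, 0 ≤ P.height j x) {i : Fin n}
    (hi : P.height i x = 0) : x ∈ P.bdry := by
  have hne := P.vertices_finRotate_ne i
  obtain ⟨r, rfl⟩ : ∃ r : ℝ, x = AffineMap.lineMap (P.vertices i) (P.vertices (finRotate n i)) r := by
    simp only [height, signedArea] at hi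
    set a := P.vertices i
    set b := P.vertices (finRotate n i)
    have key : b 0 - a 0 ≠ 0 ∨ b 1 - a 1 ≠ 0 := by
      by_contra hcon
      push Not at hcon
      apply hne
      ext l
      fin_cases l
      · exact sub_eq_zero.1 hcon.1
      · exact sub_eq_zero.1 hcon.2
    rcases key with h0 | h0
    · refine ⟨(x 0 - a 0) / (b 0 - a 0), ?_⟩
      ext l
      fin_cases l <;> simp [AffineMap.lineMap_apply] <;> field_simp <;> linarith
    · refine ⟨(x 1 - a 1) / (b 1 - a 1), ?_⟩
      ext l
      fin_cases l <;> simp [AffineMap.lineMap_apply] <;> field_simp <;> linarith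
  refine Set.mem_iUnion.2 ⟨i, r, ⟨?_, ?_⟩, rfl⟩
  · obtain ⟨j, rfl⟩ := (finRotate n).surjective i
    have h1 := h j
    rw [height_lineMap, height_vertices_right, mul_zero, zero_add] at h1
    refine nonneg_of_mul_nonneg_left h1 (P.convex _ _ (P.finRotate_finRotate_ne j) (P.finRotate_ne _))
  · have h1 := h (finRotate n i)
    rw [height_lineMap, height_vertices_left, mul_zero, add_zero] at h1
    exact sub_nonneg.1 (nonneg_of_mul_nonneg_left h1 (P.height_finRotate_vertices_pos i))

/-- The barycentre of the vertices. -/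
def center : Plane := ∑ i, (n : ℝ)⁻¹ • P.vertices i

theorem center_mem_region : P.center ∈ P.region := by
  refine (convex_convexHull ℝ _).sum_mem (fun i _ => by positivity) ?_ fun i _ =>
    subset_convexHull ℝ _ (Set.mem_range_self i)
  rw [Finset.sum_const, Finset.card_univ, Fintype.card_fin, nsmul_eq_mul]
  exact mul_inv_cancel₀ (by exact_mod_cast P.pos.ne')

theorem height_center_pos (i : Fin n) : 0 < P.height i P.center := by
  have hn : (0 : ℝ) < n := by exact_mod_cast P.pos
  have h : P.height i P.center = ∑ j, (n : ℝ)⁻¹ * P.height i (P.vertices j) := by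
    simp only [height, signedArea, center, WithLp.ofLp_sum, Finset.sum_apply, PiLp.smul_apply,
      smul_eq_mul, ← Finset.mul_sum, Finset.sum_sub_distrib, Finset.sum_const, Finset.card_univ,
      Fintype.card_fin, nsmul_eq_mul]
    field_simp
  rw [h]
  refine Finset.sum_pos' (fun j _ => mul_nonneg (by positivity) (P.signedArea_nonneg i j))
    ⟨finRotate n (finRotate n i), Finset.mem_univ _, mul_pos (by positivity)
      (P.convex i _ (P.finRotate_finRotate_ne i) (P.finRotate_ne _))⟩

theorem eq_center_of_height {x : Plane} (h : ∀ i, P.height i x = P.height i P.center) :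
    x = P.center := by
  set i : Fin n := ⟨0, P.pos⟩
  have h1 := h i
  have h2 := h (finRotate n i)
  have h3 := P.convex i _ (P.finRotate_finRotate_ne i) (P.finRotate_ne _)
  simp only [height, signedArea] at h1 h2 h3
  set a := P.vertices i
  set b := P.vertices (finRotate n i)
  set d := P.vertices (finRotate n (finRotate n i))
  have hdet : (b 0 - a 0) * (d 1 - b 1) - (b 1 - a 1) * (d 0 - b 0) ≠ 0 := by
    intro h0; nlinarith
  have e0 : ((b 0 - a 0) * (d 1 - b 1) - (b 1 - a 1) * (d 0 - b 0)) * (x 0 - P.center 0) = 0 := by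
    linear_combination (d 0 - b 0) * h1 - (b 0 - a 0) * h2
  have e1 : ((b 0 - a 0) * (d 1 - b 1) - (b 1 - a 1) * (d 0 - b 0)) * (x 1 - P.center 1) = 0 := by
    linear_combination (d 1 - b 1) * h1 - (b 1 - a 1) * h2
  ext l
  fin_cases l
  · exact sub_eq_zero.1 ((mul_eq_zero.1 e0).resolve_left hdet)
  · exact sub_eq_zero.1 ((mul_eq_zero.1 e1).resolve_left hdet)

/-- Polar coordinates on the region. -/
def cone (r t : ℝ) : Plane := AffineMap.lineMap P.center (P.boundaryPoint t) r

theorem continuous_cone : Continuous fun x : ℝ × ℝ => P.cone x.1 x.2 := by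
  unfold cone
  simp only [AffineMap.lineMap_apply_module]
  have := P.continuous_boundaryPoint
  fun_prop

theorem cone_one (t : ℝ) : P.cone 1 t = P.boundaryPoint t := by simp [cone]

theorem cone_zero (t : ℝ) : P.cone 0 t = P.center := by simp [cone]

theorem cone_mem_region {r t : ℝ} (h0 : 0 ≤ r) (h1 : r ≤ 1) : P.cone r t ∈ P.region :=
  (convex_convexHull ℝ _).lineMap_mem P.center_mem_region
    (P.bdry_subset_region (P.boundaryPoint_mem_bdry t)) ⟨h0, h1⟩

theorem height_cone_pos {r : ℝ} (h0 : 0 ≤ r) (h1 : r < 1) (t : ℝ) (i : Fin n) :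
    0 < P.height i (P.cone r t) := by
  rw [cone, height_lineMap]
  have := mul_pos (sub_pos.2 h1) (P.height_center_pos i)
  have := mul_nonneg h0 (P.height_nonneg_of_mem_region
    (P.bdry_subset_region (P.boundaryPoint_mem_bdry t)) i)
  linarith

theorem cone_mem_bdry {r t : ℝ} (h0 : 0 ≤ r) (h1 : r ≤ 1) (h : P.cone r t ∈ P.bdry) : r = 1 := by
  by_contra hr
  obtain ⟨i, hi⟩ := P.exists_height_eq_zero h
  exact (P.height_cone_pos h0 (lt_of_le_of_ne h1 hr) t i).ne' hi

/-- To compare radii, a height that vanishes at the boundary point of `t` is evaluated: it is `(1 -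
r)` times its value at the centre on one side, and at least `(1 - r')` times that value on the
other. -/
theorem cone_eq_iff {r r' t t' : ℝ} (h0 : 0 ≤ r) (h0' : 0 ≤ r') :
    P.cone r t = P.cone r' t' ↔ r = r' ∧ (r = 0 ∨ P.boundaryPoint t = P.boundaryPoint t') := by
  have hle : ∀ {r r' t t' : ℝ}, 0 ≤ r → 0 ≤ r' → P.cone r t = P.cone r' t' → r ≤ r' := by
    intro r r' t t' h0 h0' h
    obtain ⟨i, hi⟩ := P.exists_height_eq_zero (P.boundaryPoint_mem_bdry t)
    have h1 := congrArg (P.height i) h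
    rw [cone, cone, height_lineMap, height_lineMap, hi] at h1
    have h2 := mul_nonneg h0' (P.height_nonneg_of_mem_region
      (P.bdry_subset_region (P.boundaryPoint_mem_bdry t')) i)
    have h3 := P.height_center_pos i
    by_contra hlt
    nlinarith
  constructor
  · intro h
    have hr : r = r' := le_antisymm (hle h0 h0' h) (hle h0' h0 h.symm)
    refine ⟨hr, ?_⟩
    subst hr
    by_cases hr0 : r = 0
    · exact Or.inl hr0
    · right
      simp only [cone, AffineMap.lineMap_apply_module] at h
      exact smul_right_injective _ hr0 (add_left_cancel h)
  · rintro ⟨rfl, rfl | h⟩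
    · rw [cone_zero, cone_zero]
    · rw [cone, cone, h]

/-- The radius is the gauge of the region about its centre, the largest `1 - height / height at the
centre`. It is nonnegative because the sum of heights is constant; radius 0 makes all heights equal
to those of the centre, and otherwise scaling by `r⁻¹` makes the extremal height vanish. -/
theorem exists_cone_eq {x : Plane} (hx : x ∈ P.region) (c : ℝ) :
    ∃ r t, 0 ≤ r ∧ r ≤ 1 ∧ c ≤ t ∧ t < c + P.perimeter ∧ P.cone r t = x := by
  have hc := P.height_center_pos
  obtain ⟨i, -, hi⟩ := Finset.exists_max_image Finset.univ
    (fun i => 1 - P.height i x / P.height i P.center) ⟨⟨0, P.pos⟩, Finset.mem_univ _⟩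
  set r := 1 - P.height i x / P.height i P.center with hr
  have hge : ∀ j, (1 - r) * P.height j P.center ≤ P.height j x := by
    intro j
    have := hi j (Finset.mem_univ j)
    rw [← le_div_iff₀ (hc j)]
    linarith
  have heq : (1 - r) * P.height i P.center = P.height i x := by
    rw [hr, sub_sub_cancel, div_mul_cancel₀ _ (hc i).ne']
  have hr1 : r ≤ 1 := by
    have := div_nonneg (P.height_nonneg_of_mem_region hx i) (hc i).le
    linarith
  have hsum := Finset.sum_le_sum fun j (_ : j ∈ Finset.univ) => hge j
  rw [← Finset.mul_sum, P.sum_height_eq x P.center] at hsum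
  have hpos : 0 < ∑ j, P.height j P.center := Finset.sum_pos (fun j _ => hc j) ⟨i, Finset.mem_univ i⟩
  have hr0 : 0 ≤ r := by nlinarith
  rcases hr0.eq_or_lt with h0 | h0
  · refine ⟨0, c, le_rfl, zero_le_one, le_rfl, by linarith [P.perimeter_pos], ?_⟩
    rw [cone_zero]
    refine (P.eq_center_of_height fun j => ?_).symm
    rw [← h0] at hge
    have h2 : ∑ j, (P.height j x - P.height j P.center) = 0 := by
      rw [Finset.sum_sub_distrib, P.sum_height_eq x P.center, sub_self]
    have h3 := (Finset.sum_eq_zero_iff_of_nonneg fun j _ => by linarith [hge j]).1 h2 j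
      (Finset.mem_univ j)
    linarith
  · set y : Plane := AffineMap.lineMap P.center x r⁻¹ with hy
    have hxy : AffineMap.lineMap P.center y r = x := by
      rw [hy]
      simp only [AffineMap.lineMap_apply, vsub_eq_sub, vadd_eq_add, add_sub_cancel_right, smul_smul]
      rw [mul_inv_cancel₀ h0.ne', one_smul, sub_add_cancel]
    have hheight : ∀ j, P.height j y = r⁻¹ * (P.height j x - (1 - r) * P.height j P.center) := by
      intro j
      rw [hy, height_lineMap]
      field_simp
      ring
    have hyb : y ∈ P.bdry := by
      refine P.mem_bdry_of_height (fun j => ?_) (i := i) ?_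
      · rw [hheight]
        exact mul_nonneg (inv_nonneg.2 h0.le) (sub_nonneg.2 (hge j))
      · rw [hheight, heq, sub_self, mul_zero]
    obtain ⟨t, ht0, ht1, ht⟩ := P.exists_boundaryPoint_eq hyb c
    exact ⟨r, t, h0.le, hr1, ht0, ht1, by rw [cone, ht, hxy]⟩

end ConvexPolygon
end PolygonFolding
end

/-! ### The map z + 1/z from the disc to the sphere -/

noncomputable section
namespace PolygonFolding
open Complex

theorem normSq_add_normSq_pos {a b : ℂ} (h : a ≠ 0 ∨ b ≠ 0) : 0 < normSq a + normSq b := by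
  rcases h with h | h
  · exact add_pos_of_pos_of_nonneg (normSq_pos.2 h) (normSq_nonneg b)
  · exact add_pos_of_nonneg_of_pos (normSq_nonneg a) (normSq_pos.2 h)

/-- The point of the sphere with given homogeneous complex coordinates. -/
def hopf (a b : ℂ) (h : a ≠ 0 ∨ b ≠ 0) : UnitSphere :=
  ⟨!₂[2 * (a.re * b.re + a.im * b.im) / (normSq a + normSq b),
      2 * (a.im * b.re - a.re * b.im) / (normSq a + normSq b),
      (normSq a - normSq b) / (normSq a + normSq b)], by
    have hN := (normSq_add_normSq_pos h).ne'
    rw [mem_sphere_zero_iff_norm, EuclideanSpace.norm_eq, Real.sqrt_eq_one, Fin.sum_univ_three]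
    simp only [Real.norm_eq_abs, sq_abs]
    change (2 * (a.re * b.re + a.im * b.im) / (normSq a + normSq b)) ^ 2 +
      (2 * (a.im * b.re - a.re * b.im) / (normSq a + normSq b)) ^ 2 +
      ((normSq a - normSq b) / (normSq a + normSq b)) ^ 2 = 1
    rw [div_pow, div_pow, div_pow, ← add_div, ← add_div, div_eq_one_iff_eq (pow_ne_zero 2 hN)]
    simp only [normSq_apply]
    ring⟩

theorem hopf_eq_iff {a b a' b' : ℂ} (h : a ≠ 0 ∨ b ≠ 0) (h' : a' ≠ 0 ∨ b' ≠ 0) :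
    hopf a b h = hopf a' b' h' ↔ a * b' = a' * b := by
  have hN := (normSq_add_normSq_pos h).ne'
  have hN' := (normSq_add_normSq_pos h').ne'
  have expand : hopf a b h = hopf a' b' h' ↔
      (2 * (a.re * b.re + a.im * b.im) * (normSq a' + normSq b') =
        2 * (a'.re * b'.re + a'.im * b'.im) * (normSq a + normSq b)) ∧
      (2 * (a.im * b.re - a.re * b.im) * (normSq a' + normSq b') =
        2 * (a'.im * b'.re - a'.re * b'.im) * (normSq a + normSq b)) ∧
      (normSq a - normSq b) * (normSq a' + normSq b') =
        (normSq a' - normSq b') * (normSq a + normSq b) := by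
    rw [← div_eq_div_iff hN hN', ← div_eq_div_iff hN hN', ← div_eq_div_iff hN hN']
    constructor
    · intro e
      have e' : ∀ i, (hopf a b h).1 i = (hopf a' b' h').1 i := fun i => by rw [e]
      exact ⟨e' 0, e' 1, e' 2⟩
    · rintro ⟨e0, e1, e2⟩
      ext i
      fin_cases i
      · exact e0
      · exact e1
      · exact e2
  rw [expand]
  constructor
  · rintro ⟨e0, e1, e2⟩
    -- The third coordinate alone determines the share of `|b|²`. When `b ≠ 0`, multiplying the
    -- desired identity by this nonzero quantity lets the first two coordinates be substituted.
    have eb : normSq b * (normSq a' + normSq b') = normSq b' * (normSq a + normSq b) := by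
      linear_combination -e2 / 2
    by_cases hb : b = 0
    · have : b' = 0 := by
        rw [hb, map_zero, zero_mul, add_zero] at eb
        have ha : a ≠ 0 := h.resolve_right fun hne => hne hb
        exact normSq_eq_zero.1 ((mul_eq_zero.1 eb.symm).resolve_right (normSq_pos.2 ha).ne')
      rw [hb, this, mul_zero, mul_zero]
    · have hM : normSq b * (normSq a' + normSq b') ≠ 0 := mul_ne_zero (normSq_pos.2 hb).ne' hN'
      apply Complex.ext
      · apply mul_left_cancel₀ hM
        simp only [normSq_apply, mul_re] at eb e0 e1 ⊢
        linear_combination (b.re * b'.re - b.im * b'.im) / 2 * e0 -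
          (b.re * b'.im + b.im * b'.re) / 2 * e1 - (a'.re * b.re - a'.im * b.im) * eb
      · apply mul_left_cancel₀ hM
        simp only [normSq_apply, mul_im] at eb e0 e1 ⊢
        linear_combination (b.re * b'.im + b.im * b'.re) / 2 * e0 +
          (b.re * b'.re - b.im * b'.im) / 2 * e1 - (a'.re * b.im + a'.im * b.re) * eb
  · intro e
    have er := congrArg Complex.re e
    have ei := congrArg Complex.im e
    simp only [mul_re, mul_im] at er ei
    have en := congrArg normSq e
    rw [map_mul, map_mul] at en
    refine ⟨?_, ?_, by linear_combination 2 * en⟩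
    · simp only [normSq_apply]
      linear_combination
        2 * (b.re * b'.re - b.im * b'.im - (a.re * a'.re - a.im * a'.im)) * er +
        2 * (b.re * b'.im + b.im * b'.re - (a.re * a'.im + a.im * a'.re)) * ei
    · simp only [normSq_apply]
      linear_combination
        -2 * (b.re * b'.im + b.im * b'.re + (a.re * a'.im + a.im * a'.re)) * er +
        2 * (b.re * b'.re - b.im * b'.im + (a.re * a'.re - a.im * a'.im)) * ei

theorem exists_hopf_eq (x : UnitSphere) : ∃ a b h, hopf a b h = x := by
  have hx := x.2
  rw [mem_sphere_zero_iff_norm, EuclideanSpace.norm_eq, Real.sqrt_eq_one, Fin.sum_univ_three] at hx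
  simp only [Real.norm_eq_abs, sq_abs] at hx
  by_cases h2 : x.1 2 = 1
  · have h0 : x.1 0 = 0 := by nlinarith [sq_nonneg (x.1 0), sq_nonneg (x.1 1)]
    have h1 : x.1 1 = 0 := by nlinarith [sq_nonneg (x.1 0), sq_nonneg (x.1 1)]
    refine ⟨1, 0, Or.inl one_ne_zero, ?_⟩
    ext i
    fin_cases i
    · simpa [hopf] using h0.symm
    · simpa [hopf] using h1.symm
    · simpa [hopf] using h2.symm
  · have hne : 1 - x.1 2 ≠ 0 := sub_ne_zero.2 (Ne.symm h2)
    have hb : ((1 - x.1 2 : ℝ) : ℂ) ≠ 0 := ofReal_ne_zero.2 hne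
    refine ⟨⟨x.1 0, x.1 1⟩, ((1 - x.1 2 : ℝ) : ℂ), Or.inr hb, ?_⟩
    have hN : normSq ⟨x.1 0, x.1 1⟩ + normSq ((1 - x.1 2 : ℝ) : ℂ) = 2 * (1 - x.1 2) := by
      rw [normSq_mk, normSq_ofReal]
      linear_combination hx
    have hN' : 2 * (1 - x.1 2) ≠ 0 := mul_ne_zero two_ne_zero hne
    ext i
    fin_cases i
    · change 2 * (x.1 0 * (1 - x.1 2) + x.1 1 * 0) / _ = x.1 0
      rw [hN, div_eq_iff hN']
      ring
    · change 2 * (x.1 1 * (1 - x.1 2) - x.1 0 * 0) / _ = x.1 1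
      rw [hN, div_eq_iff hN']
      ring
    · change (normSq ⟨x.1 0, x.1 1⟩ - normSq ((1 - x.1 2 : ℝ) : ℂ)) / _ = x.1 2
      rw [hN, div_eq_iff hN', normSq_mk, normSq_ofReal]
      linear_combination hx

theorem joukowski_ne_zero (z : ℂ) : z ^ 2 + 1 ≠ 0 ∨ z ≠ 0 := by
  by_cases h : z = 0
  · left; simp [h]
  · exact Or.inr h

/-- The map of the unit disc to the sphere which folds the unit circle along the real axis. -/
def joukowski (z : ℂ) : UnitSphere := hopf (z ^ 2 + 1) z (joukowski_ne_zero z)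

theorem continuous_joukowski : Continuous joukowski := by
  unfold joukowski hopf
  refine Continuous.subtype_mk ?_ _
  have hN : ∀ z : ℂ, normSq (z ^ 2 + 1) + normSq z ≠ 0 := fun z =>
    (normSq_add_normSq_pos (joukowski_ne_zero z)).ne'
  have h1 := continuous_normSq
  refine (PiLp.continuous_toLp 2 _).comp (continuous_pi fun i => ?_)
  fin_cases i
  · exact Continuous.div (by fun_prop) (by fun_prop) hN
  · exact Continuous.div (by fun_prop) (by fun_prop) hN
  · exact Continuous.div (by fun_prop) (by fun_prop) hN

/-- The homogeneous coordinate is z + 1/z, and z + 1/z = w + 1/w factors as (z - w)(z w - 1) = 0. On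
the closed disc the second case happens only on the unit circle. -/
theorem joukowski_eq_iff {z w : ℂ} : joukowski z = joukowski w ↔ z = w ∨ z * w = 1 := by
  rw [joukowski, joukowski, hopf_eq_iff]
  constructor
  · intro h
    have : (z - w) * (z * w - 1) = 0 := by linear_combination h
    rcases mul_eq_zero.1 this with h | h
    · exact Or.inl (sub_eq_zero.1 h)
    · exact Or.inr (sub_eq_zero.1 h)
  · rintro (rfl | h)
    · rfl
    · linear_combination (z - w) * h

/-- The two solutions of z² - (a/b) z + 1 = 0 have product 1, so one of them lies in the closed unit
disc. -/
theorem exists_joukowski_eq (x : UnitSphere) : ∃ z : ℂ, ‖z‖ ≤ 1 ∧ joukowski z = x := by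
  obtain ⟨a, b, h, rfl⟩ := exists_hopf_eq x
  by_cases hb : b = 0
  · refine ⟨0, by simp, ?_⟩
    rw [joukowski, hopf_eq_iff, hb]
    ring
  · obtain ⟨d, hd⟩ := IsAlgClosed.exists_pow_nat_eq ((a / b) ^ 2 - 4) (n := 2) (by norm_num)
    have key : ∀ z : ℂ, z ^ 2 + 1 = a / b * z → joukowski z = hopf a b h := by
      intro z hz
      rw [joukowski, hopf_eq_iff, hz]
      field_simp
    have hprod : (a / b + d) / 2 * ((a / b - d) / 2) = 1 := by linear_combination -hd / 4
    by_cases h1 : ‖(a / b + d) / 2‖ ≤ 1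
    · exact ⟨_, h1, key _ (by linear_combination hd / 4)⟩
    · refine ⟨_, ?_, key ((a / b - d) / 2) (by linear_combination hd / 4)⟩
      have := congrArg norm hprod
      rw [norm_mul, norm_one] at this
      nlinarith [norm_nonneg ((a / b - d) / 2)]

end PolygonFolding
end

/-! ### Folding the boundary in half gives a sphere -/

noncomputable section
namespace PolygonFolding

/-- Continuous surjections of a compact space which identify the same points give homeomorphic
quotients. -/
theorem nonempty_quotient_homeomorph {X R Y : Type*} [TopologicalSpace X] [CompactSpace X]
    [TopologicalSpace R] [T2Space R] [TopologicalSpace Y] [T2Space Y] (S : Setoid R) {F : X → R}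
    {H : X → Y} (hF : Continuous F) (hFs : Function.Surjective F) (hH : Continuous H)
    (hHs : Function.Surjective H) (h : ∀ x y, S (F x) (F y) ↔ H x = H y) :
    Nonempty (Quotient S ≃ₜ Y) := by
  let q : C(X, Quotient S) := ⟨fun x => Quotient.mk S (F x), continuous_quot_mk.comp hF⟩
  have hq : Topology.IsQuotientMap q :=
    isQuotientMap_quot_mk.comp (hF.isClosedMap.isQuotientMap hF hFs)
  let g : C(X, Y) := ⟨H, hH⟩
  have hg : Topology.IsQuotientMap g := hH.isClosedMap.isQuotientMap hH hHs
  have hker : Setoid.ker q = Setoid.ker g :=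
    Setoid.ext fun x y => Quotient.eq.trans (h x y)
  have e := hq.homeomorph
  rw [hker] at e
  exact ⟨e.symm.trans hg.homeomorph⟩

namespace ConvexPolygon
open Gluing Topology
variable {n : ℕ} (P : ConvexPolygon n)

/-- The gluing which folds the boundary in half, identifying the parameters `x` and `s - x`. -/
def foldGluing (s : ℝ) : Gluing P where
  m := 2
  start k := s / 2 + k.val * (P.perimeter / 2)
  len _ := P.perimeter / 2
  partner := Fin.rev
  reversed _ := true
  len_pos _ := half_pos P.perimeter_pos
  disjoint := by
    have key : Disjoint (P.boundaryPoint '' Set.Ioo (s / 2) (s / 2 + P.perimeter / 2))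
        (P.boundaryPoint '' Set.Ioo (s / 2 + P.perimeter / 2)
          (s / 2 + P.perimeter / 2 + P.perimeter / 2)) := by
      rw [Set.disjoint_left]
      rintro _ ⟨u, ⟨hu0, hu1⟩, rfl⟩ ⟨v, ⟨hv0, hv1⟩, hv⟩
      have := P.eq_of_boundaryPoint_eq hv (by rw [abs_lt]; constructor <;> linarith)
      linarith
    intro k l hkl
    fin_cases k <;> fin_cases l
    · exact absurd rfl hkl
    · simpa using key
    · simpa using key.symm
    · exact absurd rfl hkl
  cover := by
    intro x hx
    obtain ⟨t, h0, h1, rfl⟩ := P.exists_boundaryPoint_eq hx (s / 2)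
    by_cases ht : t ≤ s / 2 + P.perimeter / 2
    · exact Set.mem_iUnion.2 ⟨0, t, ⟨by simpa using h0, by simpa using ht⟩, rfl⟩
    · refine Set.mem_iUnion.2 ⟨1, t, ⟨?_, ?_⟩, rfl⟩ <;> simp <;> linarith
  partner_partner := Fin.rev_rev
  partner_ne k := by fin_cases k <;> decide
  len_partner _ := rfl
  reversed_partner _ := rfl

/-- Reversed gluing sends `s / 2 + t` to `s / 2 + perimeter - t`, which is `s - (s / 2 + t)` modulo
the perimeter; hence one formula serves both arcs. -/
theorem foldGluing_glued_iff (s : ℝ) {x y : Plane} : (P.foldGluing s).Glued x y ↔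
    ∃ u, x = P.boundaryPoint u ∧ y = P.boundaryPoint (s - u) := by
  change (∃ k : Fin 2, ∃ t ∈ Set.Icc 0 (P.perimeter / 2),
    x = P.boundaryPoint (s / 2 + (k.val : ℝ) * (P.perimeter / 2) + t) ∧
    y = P.boundaryPoint (s / 2 + (k.rev.val : ℝ) * (P.perimeter / 2) + (P.perimeter / 2 - t))) ↔ _
  rw [Fin.exists_fin_two]
  simp only [show (Fin.rev (0 : Fin 2)).val = 1 from rfl, show (Fin.rev (1 : Fin 2)).val = 0 from rfl,
    Fin.val_zero, Fin.val_one, Nat.cast_zero, Nat.cast_one, zero_mul, one_mul, add_zero]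
  constructor
  · rintro (⟨t, -, rfl, rfl⟩ | ⟨t, -, rfl, rfl⟩)
    · exact ⟨_, rfl, P.boundaryPoint_eq_iff.2 ⟨-1, by push_cast; ring⟩⟩
    · exact ⟨_, rfl, P.boundaryPoint_eq_iff.2 ⟨-1, by push_cast; ring⟩⟩
  · rintro ⟨u, rfl, rfl⟩
    obtain ⟨k, h0, h1⟩ := P.exists_add_int_mul_mem (s / 2) u
    by_cases hu : u + k * P.perimeter ≤ s / 2 + P.perimeter / 2
    · exact Or.inl ⟨u + k * P.perimeter - s / 2, ⟨by linarith, by linarith⟩,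
        P.boundaryPoint_eq_iff.2 ⟨k, by ring⟩, P.boundaryPoint_eq_iff.2 ⟨1 - k, by push_cast; ring⟩⟩
    · exact Or.inr ⟨u + k * P.perimeter - s / 2 - P.perimeter / 2, ⟨by linarith, by linarith⟩,
        P.boundaryPoint_eq_iff.2 ⟨k, by ring⟩, P.boundaryPoint_eq_iff.2 ⟨1 - k, by push_cast; ring⟩⟩

theorem foldGluing_setoid_iff (s : ℝ) {x y : Plane} : (P.foldGluing s).setoid x y ↔
    x = y ∨ ∃ u, x = P.boundaryPoint u ∧ y = P.boundaryPoint (s - u) := by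
  constructor
  · intro h
    induction h with
    | rel x y h => exact Or.inr ((P.foldGluing_glued_iff s).1 h)
    | refl x => exact Or.inl rfl
    | symm x y _ ih =>
      rcases ih with rfl | ⟨u, rfl, rfl⟩
      · exact Or.inl rfl
      · exact Or.inr ⟨s - u, rfl, by rw [sub_sub_cancel]⟩
    | trans x y z _ _ ih ih' =>
      rcases ih with rfl | ⟨u, rfl, rfl⟩
      · exact ih'
      rcases ih' with rfl | ⟨v, hv, rfl⟩
      · exact Or.inr ⟨u, rfl, rfl⟩
      · obtain ⟨k, hk⟩ := P.boundaryPoint_eq_iff.1 hv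
        exact Or.inl (P.boundaryPoint_eq_iff.2 ⟨-k, by rw [hk]; push_cast; ring⟩)
  · rintro (rfl | h)
    · exact (P.foldGluing s).setoid.refl x
    · exact Relation.EqvGen.rel _ _ ((P.foldGluing_glued_iff s).2 h)

theorem foldGluing_rel_iff (s : ℝ) {x y : ℝ} : (P.foldGluing s).Rel x y ↔
    P.boundaryPoint y = P.boundaryPoint x ∨ P.boundaryPoint y = P.boundaryPoint (s - x) := by
  rw [Gluing.Rel, foldGluing_setoid_iff, eq_comm]
  refine or_congr Iff.rfl ⟨?_, fun h => ⟨x, rfl, h⟩⟩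
  rintro ⟨u, h, h'⟩
  obtain ⟨k, rfl⟩ := P.boundaryPoint_eq_iff.1 h
  rw [h', P.boundaryPoint_eq_iff]
  exact ⟨k, by ring⟩

theorem foldGluing_angle_le (s : ℝ) (A : Finset Plane) (hA : ∀ x ∈ A, x ∈ P.bdry)
    (hAA : ∀ x ∈ A, ∀ y ∈ A, (P.foldGluing s).setoid x y) :
    ∑ x ∈ A, P.faceAngle x ≤ 2 * Real.pi := by
  classical
  rcases A.eq_empty_or_nonempty with rfl | ⟨x, hx⟩
  · simpa using Real.pi_pos.le
  obtain ⟨t, -, -, rfl⟩ := P.exists_boundaryPoint_eq (hA x hx) 0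
  have hsub : A ⊆ {P.boundaryPoint t, P.boundaryPoint (s - t)} := by
    intro y hy
    obtain ⟨u, -, -, rfl⟩ := P.exists_boundaryPoint_eq (hA y hy) 0
    rw [Finset.mem_insert, Finset.mem_singleton]
    exact (P.foldGluing_rel_iff s).1 (hAA _ hx _ hy)
  refine (Finset.sum_le_card_nsmul _ _ _ fun y _ => P.faceAngle_le_pi y).trans ?_
  rw [nsmul_eq_mul]
  have : (A.card : ℝ) ≤ 2 := by exact_mod_cast (Finset.card_le_card hsub).trans Finset.card_le_two
  exact mul_le_mul_of_nonneg_right this Real.pi_pos.le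

/-- The parameter domain of polar coordinates. -/
abbrev PolarDomain : Type := Set.Icc (0 : ℝ) 1 × Set.Icc (0 : ℝ) P.perimeter

/-- Polar coordinates on the unit disc, with angles measured by the perimeter. -/
def discPoint (r t : ℝ) : ℂ := r * Complex.exp ((2 * Real.pi * t / P.perimeter : ℝ) * Complex.I)

theorem norm_discPoint {r : ℝ} (hr : 0 ≤ r) (t : ℝ) : ‖P.discPoint r t‖ = r := by
  rw [discPoint, norm_mul, Complex.norm_exp_ofReal_mul_I, mul_one, Complex.norm_real,
    Real.norm_of_nonneg hr]

theorem exp_perimeter_eq_one_iff (t : ℝ) :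
    Complex.exp ((2 * Real.pi * t / P.perimeter : ℝ) * Complex.I) = 1 ↔
      ∃ k : ℤ, t = k * P.perimeter := by
  have hL := P.perimeter_pos.ne'
  have hpi := Real.two_pi_pos.ne'
  rw [Complex.exp_eq_one_iff]
  refine exists_congr fun k => ?_
  rw [show (k : ℂ) * (2 * Real.pi * Complex.I) = ((k * (2 * Real.pi) : ℝ) : ℂ) * Complex.I by
    push_cast; ring, mul_left_inj' Complex.I_ne_zero, Complex.ofReal_inj, div_eq_iff hL]
  constructor
  · intro h
    apply mul_left_cancel₀ hpi
    linarith
  · rintro rfl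
    ring

theorem discPoint_eq_iff {r r' t t' : ℝ} (h0 : 0 ≤ r) (h0' : 0 ≤ r') :
    P.discPoint r t = P.discPoint r' t' ↔
      r = r' ∧ (r = 0 ∨ P.boundaryPoint t = P.boundaryPoint t') := by
  have key : Complex.exp ((2 * Real.pi * t / P.perimeter : ℝ) * Complex.I) =
      Complex.exp ((2 * Real.pi * t' / P.perimeter : ℝ) * Complex.I) ↔
      P.boundaryPoint t = P.boundaryPoint t' := by
    rw [eq_comm, ← div_eq_one_iff_eq (Complex.exp_ne_zero _), ← Complex.exp_sub, ← sub_mul,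
      ← Complex.ofReal_sub, ← sub_div, ← mul_sub, exp_perimeter_eq_one_iff, P.boundaryPoint_eq_iff]
    exact exists_congr fun k => sub_eq_iff_eq_add'
  constructor
  · intro h
    obtain rfl : r = r' := by rw [← P.norm_discPoint h0 t, h, P.norm_discPoint h0' t']
    refine ⟨rfl, ?_⟩
    by_cases hr : r = 0
    · exact Or.inl hr
    · exact Or.inr (key.1 (mul_left_cancel₀ (Complex.ofReal_ne_zero.2 hr) h))
  · rintro ⟨rfl, rfl | h⟩
    · simp [discPoint]
    · rw [discPoint, discPoint, key.2 h]

theorem discPoint_mul_eq_one_iff {r r' t t' : ℝ} (h0 : 0 ≤ r) (h1 : r ≤ 1) (h0' : 0 ≤ r')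
    (h1' : r' ≤ 1) : P.discPoint r t * P.discPoint r' t' = 1 ↔
      r = 1 ∧ r' = 1 ∧ ∃ k : ℤ, t + t' = k * P.perimeter := by
  have key : P.discPoint 1 t * P.discPoint 1 t' = 1 ↔ ∃ k : ℤ, t + t' = k * P.perimeter := by
    rw [← exp_perimeter_eq_one_iff, discPoint, discPoint, Complex.ofReal_one, one_mul, one_mul,
      ← Complex.exp_add, ← add_mul, ← Complex.ofReal_add, ← add_div, ← mul_add]
  constructor
  · intro h
    have hn := congrArg norm h
    rw [norm_mul, P.norm_discPoint h0, P.norm_discPoint h0', norm_one] at hn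
    obtain rfl : r = 1 := by nlinarith
    obtain rfl : r' = 1 := by linarith
    exact ⟨rfl, rfl, key.1 h⟩
  · rintro ⟨rfl, rfl, h⟩
    exact key.2 h

theorem exists_discPoint_eq {z : ℂ} (hz : ‖z‖ ≤ 1) :
    ∃ r t, 0 ≤ r ∧ r ≤ 1 ∧ 0 ≤ t ∧ t ≤ P.perimeter ∧ P.discPoint r t = z := by
  have hL := P.perimeter_pos
  obtain ⟨k, h0, h1⟩ := P.exists_add_int_mul_mem 0 (z.arg / (2 * Real.pi) * P.perimeter)
  refine ⟨‖z‖, _, norm_nonneg z, hz, h0, by linarith, ?_⟩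
  have h2 : P.discPoint ‖z‖ (z.arg / (2 * Real.pi) * P.perimeter + k * P.perimeter) =
      P.discPoint ‖z‖ (z.arg / (2 * Real.pi) * P.perimeter) :=
    (P.discPoint_eq_iff (norm_nonneg z) (norm_nonneg z)).2
      ⟨rfl, Or.inr (P.boundaryPoint_add_int_mul _ _)⟩
  rw [h2, discPoint, show 2 * Real.pi * (z.arg / (2 * Real.pi) * P.perimeter) / P.perimeter = z.arg by
    field_simp [Real.pi_ne_zero]]
  exact Complex.norm_mul_exp_arg_mul_I z

/-- Folding the boundary in half corresponds to folding the unit circle along the real axis. -/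
theorem foldGluing_setoid_cone_iff (s : ℝ) {r r' t t' : ℝ} (h0 : 0 ≤ r) (h1 : r ≤ 1)
    (h0' : 0 ≤ r') (h1' : r' ≤ 1) :
    (P.foldGluing s).setoid (P.cone r (s / 2 + t)) (P.cone r' (s / 2 + t')) ↔
      joukowski (P.discPoint r t) = joukowski (P.discPoint r' t') := by
  rw [joukowski_eq_iff, P.discPoint_eq_iff h0 h0', P.discPoint_mul_eq_one_iff h0 h1 h0' h1',
    foldGluing_setoid_iff, P.cone_eq_iff h0 h0']
  have hbp : P.boundaryPoint (s / 2 + t) = P.boundaryPoint (s / 2 + t') ↔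
      P.boundaryPoint t = P.boundaryPoint t' := by
    rw [P.boundaryPoint_eq_iff, P.boundaryPoint_eq_iff]
    exact exists_congr fun k => ⟨fun h => by linarith, fun h => by linarith⟩
  rw [hbp]
  refine or_congr Iff.rfl ⟨?_, ?_⟩
  · rintro ⟨u, hu, hu'⟩
    obtain rfl := P.cone_mem_bdry h0 h1 (hu ▸ P.boundaryPoint_mem_bdry u)
    obtain rfl := P.cone_mem_bdry h0' h1' (hu' ▸ P.boundaryPoint_mem_bdry _)
    rw [cone_one, P.boundaryPoint_eq_iff] at hu hu'
    obtain ⟨k, rfl⟩ := hu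
    obtain ⟨l, hl⟩ := hu'
    exact ⟨rfl, rfl, -k - l, by push_cast; linarith⟩
  · rintro ⟨rfl, rfl, k, hk⟩
    refine ⟨s / 2 + t, P.cone_one _, ?_⟩
    rw [cone_one, P.boundaryPoint_eq_iff]
    exact ⟨-k, by push_cast; linarith⟩

/-- The parametrization of the region by polar coordinates. -/
def regionPoint (s : ℝ) (x : P.PolarDomain) : P.region :=
  ⟨P.cone x.1 (s / 2 + x.2), P.cone_mem_region x.1.2.1 x.1.2.2⟩

theorem continuous_regionPoint (s : ℝ) : Continuous (P.regionPoint s) := by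
  have hc : Continuous fun x : P.PolarDomain => ((x.1 : ℝ), s / 2 + (x.2 : ℝ)) := by fun_prop
  have h := P.continuous_cone.comp hc
  exact h.subtype_mk fun x => P.cone_mem_region x.1.2.1 x.1.2.2

theorem regionPoint_surjective (s : ℝ) : Function.Surjective (P.regionPoint s) := by
  rintro ⟨x, hx⟩
  obtain ⟨r, t, h0, h1, h2, h3, h4⟩ := P.exists_cone_eq hx (s / 2)
  have ht : t - s / 2 ∈ Set.Icc 0 P.perimeter := ⟨by linarith, by linarith⟩
  refine ⟨(⟨r, h0, h1⟩, ⟨t - s / 2, ht⟩), Subtype.ext ?_⟩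
  rw [← add_sub_cancel (s / 2) t] at h4
  exact h4

/-- The parametrization of the sphere by folded polar coordinates. -/
def spherePoint (x : P.PolarDomain) : UnitSphere := joukowski (P.discPoint x.1 x.2)

theorem continuous_discPoint : Continuous fun x : ℝ × ℝ => P.discPoint x.1 x.2 := by
  unfold discPoint
  fun_prop

theorem continuous_spherePoint : Continuous P.spherePoint := by
  have hc : Continuous fun x : P.PolarDomain => ((x.1 : ℝ), (x.2 : ℝ)) := by fun_prop
  exact continuous_joukowski.comp (P.continuous_discPoint.comp hc)

theorem spherePoint_surjective : Function.Surjective P.spherePoint := by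
  intro x
  obtain ⟨z, hz, rfl⟩ := exists_joukowski_eq x
  obtain ⟨r, t, h0, h1, h2, h3, rfl⟩ := P.exists_discPoint_eq hz
  exact ⟨⟨⟨r, h0, h1⟩, ⟨t, h2, h3⟩⟩, rfl⟩

/-- Folding the boundary in half gives a sphere. -/
theorem foldGluing_sphere (s : ℝ) : Nonempty ((P.foldGluing s).Surface ≃ₜ UnitSphere) :=
  nonempty_quotient_homeomorph _ (P.continuous_regionPoint s) (P.regionPoint_surjective s)
    P.continuous_spherePoint P.spherePoint_surjective fun x y =>
      P.foldGluing_setoid_cone_iff s x.1.2.1 x.1.2.2 y.1.2.1 y.1.2.2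

theorem foldGluing_isAleksandrov (s : ℝ) : (P.foldGluing s).IsAleksandrov :=
  ⟨P.foldGluing_angle_le s, P.foldGluing_sphere s⟩

end ConvexPolygon
end PolygonFolding
end

/-! ### The polygon with doubling edges and the quadratic lower bound -/

noncomputable section
namespace PolygonFolding
open Finset

/-- First coordinate of the `k`-th vertex of a polygonal spiral with doubling edges. -/
def spiralX (n k : ℕ) : ℝ := ∑ m ∈ range k, 2 ^ m * Real.cos (m / n)

/-- Second coordinate of the `k`-th vertex of a polygonal spiral with doubling edges. -/
def spiralY (n k : ℕ) : ℝ := ∑ m ∈ range k, 2 ^ m * Real.sin (m / n)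

/-- Edge `m` has length 2^m and direction `m / n`, so this expands the cross product of direction
`φ` with a chord edge by edge. All directions lie in [0, 1), hence the signs of the sines are those
of the differences of indices. -/
theorem cross_spiral (n : ℕ) (φ : ℝ) {a b : ℕ} (h : a ≤ b) :
    Real.cos φ * (spiralY n b - spiralY n a) - Real.sin φ * (spiralX n b - spiralX n a) =
      ∑ m ∈ Ico a b, 2 ^ m * Real.sin (m / n - φ) := by
  rw [spiralX, spiralX, spiralY, spiralY, ← sum_Ico_eq_sub _ h, ← sum_Ico_eq_sub _ h, mul_sum,
    mul_sum, ← sum_sub_distrib]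
  refine sum_congr rfl fun m _ => ?_
  rw [Real.sin_sub]
  ring

theorem sin_div_sub_div_pos {n k m : ℕ} (hkm : k < m) (hm : m < n) :
    0 < Real.sin ((m : ℝ) / n - k / n) := by
  have hn : (0 : ℝ) < n := by exact_mod_cast (by omega : 0 < n)
  have h1 : (k : ℝ) < m := by exact_mod_cast hkm
  have h2 : (m : ℝ) < n := by exact_mod_cast hm
  rw [← sub_div]
  refine Real.sin_pos_of_pos_of_lt_pi (div_pos (by linarith) hn) ?_
  refine lt_of_lt_of_le ((div_lt_one hn).2 ?_) (by linarith [Real.pi_gt_three])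
  linarith [(Nat.cast_nonneg k : (0 : ℝ) ≤ k)]

theorem cross_spiral_pos {n k a b : ℕ} (hab : a < b) (hka : k ≤ a) (hb : b ≤ n)
    (h : k < a ∨ a + 1 < b) :
    0 < Real.cos (k / n) * (spiralY n b - spiralY n a) -
      Real.sin (k / n) * (spiralX n b - spiralX n a) := by
  rw [cross_spiral n _ hab.le]
  have hterm : ∀ m, k < m → m < n → 0 < 2 ^ m * Real.sin ((m : ℝ) / n - k / n) := fun m h1 h2 =>
    mul_pos (by positivity) (sin_div_sub_div_pos h1 h2)
  refine sum_pos' (fun m hm => ?_) ⟨b - 1, mem_Ico.2 ⟨by omega, by omega⟩,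
    hterm _ (by omega) (by omega)⟩
  rw [mem_Ico] at hm
  rcases (hka.trans hm.1).eq_or_lt with rfl | h1
  · simp
  · exact (hterm m h1 (by omega)).le

theorem cross_spiral_neg {n k a b : ℕ} (hab : a < b) (hbk : b ≤ k) (hk : k < n) :
    Real.cos (k / n) * (spiralY n b - spiralY n a) -
      Real.sin (k / n) * (spiralX n b - spiralX n a) < 0 := by
  rw [cross_spiral n _ hab.le, ← neg_pos, ← sum_neg_distrib]
  refine sum_pos (fun m hm => ?_) ⟨a, mem_Ico.2 ⟨le_rfl, hab⟩⟩
  rw [mem_Ico] at hm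
  rw [← mul_neg, ← Real.sin_neg, neg_sub]
  exact mul_pos (by positivity) (sin_div_sub_div_pos (by omega) hk)

theorem spiralX_succ (n k : ℕ) : spiralX n (k + 1) = spiralX n k + 2 ^ k * Real.cos (k / n) :=
  sum_range_succ _ _

theorem spiralY_succ (n k : ℕ) : spiralY n (k + 1) = spiralY n k + 2 ^ k * Real.sin (k / n) :=
  sum_range_succ _ _

/-- Vertices of a convex polygon, each edge but the last being twice as long as the preceding
one. -/
def spiralVertex (n : ℕ) (i : Fin n) : Plane := !₂[spiralX n i, spiralY n i]

theorem signedArea_spiral {n : ℕ} (i j k : Fin n) :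
    signedArea (spiralVertex n i) (spiralVertex n j) (spiralVertex n k) =
      (spiralX n j - spiralX n i) * (spiralY n k - spiralY n i) -
        (spiralY n j - spiralY n i) * (spiralX n k - spiralX n i) := rfl

theorem signedArea_spiral_pos {n : ℕ} (i j : Fin n) (h1 : j ≠ i)
    (h2 : j ≠ finRotate n i) : 0 < signedArea (spiralVertex n i) (spiralVertex n (finRotate n i))
      (spiralVertex n j) := by
  have hj := j.2
  have hi := i.2
  rw [Ne, Fin.ext_iff] at h1 h2
  rw [val_finRotate] at h2
  rw [signedArea_spiral, val_finRotate]
  split_ifs at h2 ⊢ with hlast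
  -- For the closing edge, which has no prescribed direction, the area is the cross product of `v_j`
  -- and `v_i - v_j`; expanding `v_j` into edges from the origin makes every term positive.
  · have hsum : (spiralX n 0 - spiralX n i) * (spiralY n j - spiralY n i) -
        (spiralY n 0 - spiralY n i) * (spiralX n j - spiralX n i) =
        ∑ m ∈ range j, 2 ^ m * (Real.cos (m / n) * (spiralY n i - spiralY n j) -
          Real.sin (m / n) * (spiralX n i - spiralX n j)) := by
      have hx : ∑ m ∈ range j, (2 : ℝ) ^ m * Real.cos (m / n) = spiralX n j := rfl
      have hy : ∑ m ∈ range j, (2 : ℝ) ^ m * Real.sin (m / n) = spiralY n j := rfl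
      simp only [mul_sub (2 ^ _ : ℝ), ← mul_assoc, sum_sub_distrib, ← sum_mul, hx, hy]
      simp only [spiralX, spiralY, range_zero, sum_empty]
      ring
    rw [hsum]
    refine sum_pos (fun m hm => mul_pos (by positivity) ?_) ⟨0, mem_range.2 (by omega)⟩
    rw [mem_range] at hm
    exact cross_spiral_pos (by omega) hm.le (by omega) (Or.inl hm)
  · have hfac : (spiralX n (i + 1) - spiralX n i) * (spiralY n j - spiralY n i) -
        (spiralY n (i + 1) - spiralY n i) * (spiralX n j - spiralX n i) =
        2 ^ i.val * (Real.cos (i / n) * (spiralY n j - spiralY n i) -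
          Real.sin (i / n) * (spiralX n j - spiralX n i)) := by
      rw [spiralX_succ, spiralY_succ]
      ring
    rw [hfac]
    refine mul_pos (by positivity) ?_
    rcases lt_or_gt_of_ne h1 with h | h
    · have := cross_spiral_neg h le_rfl hi
      linarith
    · exact cross_spiral_pos h le_rfl hj.le (Or.inr (by omega))

/-- A convex polygon, each edge but the last being twice as long as the preceding one. -/
def spiralPolygon {n : ℕ} (hn : 3 ≤ n) : ConvexPolygon n where
  vertices := spiralVertex n
  three_le := hn
  convex := signedArea_spiral_pos

theorem edgeLength_spiralPolygon {n : ℕ} (hn : 3 ≤ n) (i : Fin n) (hi : i.val + 1 ≠ n) :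
    (spiralPolygon hn).edgeLength i = 2 ^ i.val := by
  change dist (spiralVertex n i) (spiralVertex n (finRotate n i)) = _
  rw [EuclideanSpace.dist_eq, Fin.sum_univ_two, Real.sqrt_eq_iff_eq_sq (by positivity)
    (by positivity), Real.dist_eq, Real.dist_eq, sq_abs, sq_abs]
  change (spiralX n i - spiralX n (finRotate n i)) ^ 2 +
    (spiralY n i - spiralY n (finRotate n i)) ^ 2 = _
  rw [val_finRotate, if_neg hi, spiralX_succ, spiralY_succ]
  linear_combination (2 ^ i.val) ^ 2 * Real.sin_sq_add_cos_sq ((i : ℝ) / n)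

theorem mark_spiralPolygon {n : ℕ} (hn : 3 ≤ n) (k : ℕ) (hk : k < n) :
    (spiralPolygon hn).mark ⟨k, hk⟩ = 2 ^ k - 1 := by
  induction k with
  | zero => rw [ConvexPolygon.mark_zero]; simp
  | succ k ih =>
    have hne : (⟨k, by omega⟩ : Fin n).val + 1 ≠ n := by simp; omega
    have h := (spiralPolygon hn).mark_finRotate ⟨k, by omega⟩ hne
    rw [ih, edgeLength_spiralPolygon hn _ hne] at h
    have e : finRotate n ⟨k, by omega⟩ = ⟨k + 1, hk⟩ := by
      rw [Fin.ext_iff, val_finRotate, if_neg hne]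
    rw [e] at h
    rw [h]
    simp only [pow_succ]
    ring

namespace ConvexPolygon
open Gluing
variable {n : ℕ} {P : ConvexPolygon n}

/-- If two half foldings, each identifying two vertices, have the same gluing tree, then they
identify the same parameters. -/
theorem eq_of_same_foldGluing {i j : Fin n} {s' : ℝ} (hij : i ≠ j)
    (hs0 : P.mark i + P.mark j < P.perimeter) (hs0' : 0 ≤ s') (hs1' : s' < P.perimeter)
    (h : LabeledGraph.Same (P.foldGluing (P.mark i + P.mark j)).gluingTree
      (P.foldGluing s').gluingTree) : s' = P.mark i + P.mark j := by
  set G := P.foldGluing (P.mark i + P.mark j)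
  obtain ⟨f, hf⟩ := h
  have hnode : G.IsNode (G.classOf (P.mark i)) :=
    nodeParam_of_rel_mark (isMark_mark i) (Rel.refl _)
  let c : G.gluingTree.Node := ⟨G.classOf (P.mark i), hnode⟩
  have hi : Sum.inl i ∈ G.gluingTree.label c :=
    ⟨P.vertices i, rfl, by rw [← P.boundaryPoint_mark]; exact Rel.refl _⟩
  have hj : Sum.inl j ∈ G.gluingTree.label c := by
    refine ⟨P.vertices j, rfl, ?_⟩
    rw [← P.boundaryPoint_mark]
    refine (P.foldGluing_rel_iff _).2 (Or.inr ?_)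
    rw [add_sub_cancel_left]
  rw [← hf] at hi hj
  obtain ⟨_, rfl, hi⟩ := hi
  obtain ⟨_, rfl, hj⟩ := hj
  obtain ⟨x, hx⟩ : ∃ x, (P.foldGluing s').classOf x = (f c).1 := (f c).2.exists_classOf.imp
    fun x hx => hx.symm
  have hi : P.vertices i ∈ (P.foldGluing s').classOf x := hx ▸ hi
  have hj : P.vertices j ∈ (P.foldGluing s').classOf x := hx ▸ hj
  have hrel : (P.foldGluing s').Rel (P.mark i) (P.mark j) := by
    rw [Gluing.Rel, P.boundaryPoint_mark, P.boundaryPoint_mark]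
    exact (P.foldGluing s').setoid.trans ((P.foldGluing s').setoid.symm hi) hj
  rcases (P.foldGluing_rel_iff s').1 hrel with h | h
  · rw [P.boundaryPoint_mark, P.boundaryPoint_mark] at h
    exact absurd (P.vertices_injective h).symm hij
  -- A node carrying both labels means that the fold with sum `s'` glues the two vertices, so `s'`
  -- equals the sum of their marks modulo the perimeter; both lie in one period.
  · obtain ⟨k, hk⟩ := P.boundaryPoint_eq_iff.1 h
    have e : P.boundaryPoint (P.mark i + P.mark j) = P.boundaryPoint s' :=
      P.boundaryPoint_eq_iff.2 ⟨k, by linarith⟩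
    refine (P.eq_of_boundaryPoint_eq e ?_).symm
    have := P.mark_nonneg i
    have := P.mark_nonneg j
    rw [abs_lt]
    constructor <;> linarith

end ConvexPolygon

theorem two_pow_add_two_pow_inj {i j i' j' : ℕ} (hij : i < j) (hij' : i' < j')
    (h : 2 ^ i + 2 ^ j = 2 ^ i' + 2 ^ j') : i = i' ∧ j = j' := by
  have key : ∀ {i j i' j' : ℕ}, i < j → 2 ^ i + 2 ^ j = 2 ^ i' + 2 ^ j' → j' ≤ j := by
    intro i j i' j' hij h
    have h1 : 2 ^ i < 2 ^ j := Nat.pow_lt_pow_right (by norm_num) hij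
    have h2 : 2 ^ j' < 2 ^ (j + 1) := by
      rw [pow_succ]
      have := Nat.two_pow_pos i'
      omega
    have := (Nat.pow_lt_pow_iff_right (by norm_num)).1 h2
    omega
  obtain rfl : j = j' := le_antisymm (key hij' h.symm) (key hij h)
  exact ⟨Nat.pow_right_injective le_rfl (by simpa using h), rfl⟩

/-- The polygon with doubling edges has quadratically many gluing trees. -/
theorem le_ncard_gluingTrees_spiralPolygon {n : ℕ} (hn : 3 ≤ n) :
    (n : ℝ) ^ 2 / 9 ≤ ((spiralPolygon hn).gluingTrees.ncard : ℝ) := by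
  set P := spiralPolygon hn with hP
  -- Pairs of vertices avoiding the last one: the sum of their marks is then at most 2^(n-1) - 2,
  -- below the last mark, so it stays within one period.
  let K : Finset (Σ _ : ℕ, ℕ) := (range (n - 1)).sigma fun j => range j
  have hmem : ∀ x ∈ K, x.2 < x.1 ∧ x.1 < n - 1 := fun x hx => by
    rw [mem_sigma, mem_range, mem_range] at hx
    exact ⟨hx.2, hx.1⟩
  let s : (Σ _ : ℕ, ℕ) → ℝ := fun x => (2 ^ x.2 - 1) + (2 ^ x.1 - 1)
  let T : (Σ _ : ℕ, ℕ) → Quotient (LabeledGraph.isoSetoid (Fin n ⊕ Fin n)) := fun x =>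
    Quotient.mk _ (P.foldGluing (s x)).gluingTree
  have hmark : ∀ k (hk : k < n), P.mark ⟨k, hk⟩ = 2 ^ k - 1 := mark_spiralPolygon hn
  have hs : ∀ x ∈ K, ∃ i j, i ≠ j ∧ s x = P.mark i + P.mark j ∧ s x < P.perimeter := by
    intro x hx
    obtain ⟨h1, h2⟩ := hmem x hx
    refine ⟨⟨x.2, by omega⟩, ⟨x.1, by omega⟩, fun h => h1.ne (Fin.ext_iff.1 h), ?_, ?_⟩
    · rw [hmark, hmark]
    · have h3 := P.mark_lt_perimeter ⟨n - 1, by omega⟩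
      rw [hmark] at h3
      have h4 : (2 : ℝ) ^ x.2 ≤ 2 ^ x.1 := pow_le_pow_right₀ (by norm_num) h1.le
      have h5 : (2 : ℝ) ^ (x.1 + 1) ≤ 2 ^ (n - 1) := pow_le_pow_right₀ (by norm_num) (by omega)
      rw [pow_succ] at h5
      change (2 ^ x.2 - 1 : ℝ) + (2 ^ x.1 - 1) < _
      linarith
  have hT : Set.MapsTo T ↑K P.gluingTrees := fun x _ => ⟨_, P.foldGluing_isAleksandrov _, rfl⟩
  have hinj : Set.InjOn T ↑K := by
    intro x hx y hy hxy
    obtain ⟨i, j, hij, h1, h2⟩ := hs x hx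
    obtain ⟨i', j', -, h3, h4⟩ := hs y hy
    have hsame := Quotient.exact hxy
    change LabeledGraph.Same (P.foldGluing (s x)).gluingTree _ at hsame
    rw [h1] at hsame h2
    have h5 := ConvexPolygon.eq_of_same_foldGluing hij h2
      (by rw [h3]; exact add_nonneg (P.mark_nonneg _) (P.mark_nonneg _)) h4 hsame
    rw [← h1] at h5
    have h6 : (2 : ℝ) ^ x.2 + 2 ^ x.1 = 2 ^ y.2 + 2 ^ y.1 := by
      change (2 ^ y.2 - 1 : ℝ) + (2 ^ y.1 - 1) = (2 ^ x.2 - 1) + (2 ^ x.1 - 1) at h5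
      linarith
    obtain ⟨e1, e2⟩ := two_pow_add_two_pow_inj (hmem x hx).1 (hmem y hy).1 (by exact_mod_cast h6)
    cases x
    cases y
    simp_all
  have hle := Set.ncard_le_ncard_of_injOn T hT hinj P.gluingTrees_finite.1
  rw [Set.ncard_coe_finset, card_sigma] at hle
  simp only [card_range] at hle
  have hgauss := sum_range_id_mul_two (n - 1)
  have h1 : (n - 1) * (n - 1 - 1) ≤ 2 * P.gluingTrees.ncard := by omega
  -- The number of pairs is (n - 1)(n - 2)/2, which is at least n²/9 for n ≥ 3, with equality at n =
  -- 3.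
  obtain ⟨k, rfl⟩ : ∃ k, n = k + 3 := ⟨n - 3, by omega⟩
  have h2 : (k + 2) * (k + 1) ≤ 2 * P.gluingTrees.ncard := h1
  have h3 : ((k : ℝ) + 2) * (k + 1) ≤ 2 * P.gluingTrees.ncard := by exact_mod_cast h2
  have hk : (0 : ℝ) ≤ k := Nat.cast_nonneg k
  push_cast
  nlinarith

end PolygonFolding
end


theorem mainTheorem6 :
    (∃ C : ℝ, ∀ (n : ℕ) (P : PolygonFolding.ConvexPolygon n),
      P.gluingTrees.Finite ∧ (P.gluingTrees.ncard : ℝ) ≤ C * (n : ℝ) ^ 3) ∧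
    (∃ c : ℝ, 0 < c ∧ ∀ n : ℕ, 3 ≤ n → ∃ P : PolygonFolding.ConvexPolygon n,
      c * (n : ℝ) ^ 2 ≤ (P.gluingTrees.ncard : ℝ)) := by
  refine ⟨PolygonFolding.ConvexPolygon.exists_ncard_gluingTrees_le, 1 / 9, by norm_num,
    fun n hn => ⟨PolygonFolding.spiralPolygon hn, ?_⟩⟩
  rw [one_div_mul_eq_div]
  exact PolygonFolding.le_ncard_gluingTrees_spiralPolygon hn
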